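/- Lemma (Morawetz inequality). Let $\alpha>0$ and $b>0$ be such that $s_c:=2-\frac{2-b}{\alpha}$ satisfies $1<s_c<\frac32$, and let $b<3-s_c$. Put $\gamma=2(\alpha+1)$ and $m=\frac{4\alpha(\alpha+1)}{\alpha+2-b(\alpha+1)}$ (so that $m>0$). There is a constant $C=C(\alpha,b)>0$ with the following property. Let $I\subseteq\mathbb R$ be an interval of length $|I|$, and let $u:I\times\mathbb R^4\to\mathbb C$ be a solution on $I$ of the defocusing inhomogeneous nonlinear Schrödinger equation $$iu_t+\Delta u=|x|^{-b}|u|^{\alpha}u ,$$ that is: $u$ is measurable; $u\in C(I;\dot H^{s_c}(\mathbb R^4))$ or $u\in C(I;L^2(\mathbb R^4))$; for every compact $J\subseteq I$, $u$ belongs to $L_t^{\gamma}L_x^{m,2}(J\times\mathbb R^4)$, where $L^{m,2}$ denotes the Lorentz space; and for all $t,t_0\in I$ the Duhamel formula $$u(t)=e^{i(t-t_0)\Delta}u(t_0)-i\int_{t_0}^t e^{i(t-\tau)\Delta}\big(|x|^{-b}|u(\tau)|^{\alpha}u(\tau)\big)\,d\tau$$ holds in the sense of tempered distributions. Then for every $A\ge1$,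 $$\int_I\int_{|x|\le A|I|^{1/2}}\frac{|u(t,x)|^{\alpha+2}}{|x|^{1+b}}\,dx\,dt\le C\,(A|I|^{1/2})^{2s_c-1}\Big(\|u\|^2_{L_t^\infty\dot H_x^{s_c}(I\times\mathbb R^4)}+\|u\|^{\alpha+2}_{L_t^\infty\dot H_x^{s_c}(I\times\mathbb R^4)}\Big).$$ Both sides are read in $[0,\infty]$ with $0\cdot\infty=0$; the norm is $\|f\|_{\dot H^{s}}=\|(-\Delta)^{s/2}f\|_{L^2}$, understood as $\infty$ if $f\notin\dot H^{s}$. -/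

import Mathlib

open MeasureTheory Filter Topology Set
open scoped ENNReal NNReal FourierTransform SchwartzMap

noncomputable section

namespace INLS

/-- The space `ℝ⁴` with the Euclidean norm. -/
abbrev E4 : Type := EuclideanSpace ℝ (Fin 4)

/-! ### Homogeneous Sobolev spaces -/

/-- The tempered distribution `T` is given by integration against the function `f`. -/
def Represents (T : 𝓢'(E4, ℂ)) (f : E4 → ℂ) : Prop :=
  ∀ φ : 𝓢(E4, ℂ), Integrable (fun x => φ x * f x) ∧ T φ = ∫ x, φ x * f x

/-- The norm `‖f‖_{Ḣˢ} = ‖|∇|ˢ f‖_{L²} = ‖(2π|ξ|)ˢ f̂‖_{L²}`, where `f` is a function that is a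
tempered distribution and `f̂(ξ) = ∫ e^{-2πi x·ξ} f(x) dx` is its Fourier transform in the sense of
tempered distributions, required to be a function. The value is `∞` if `f` is not a tempered
distribution or if its Fourier transform is not a function. The infimum is over a
family of functions which are all equal almost everywhere. -/
def homSobolevNorm (s : ℝ) (f : E4 → ℂ) : ℝ≥0∞ :=
  ⨅ (T : 𝓢'(E4, ℂ)) (g : E4 → ℂ) (_ : Represents T f) (_ : Represents (𝓕 T) g),
    (∫⁻ ξ, (ENNReal.ofReal ((2 * Real.pi * ‖ξ‖) ^ s) * ‖g ξ‖ₑ) ^ 2) ^ (1 / 2 : ℝ)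

/-- The norm of `L_t^∞ Ḣ_x^s (I × ℝ⁴)`. -/
def supHomSobolevNorm (s : ℝ) (I : Set ℝ) (u : ℝ → E4 → ℂ) : ℝ≥0∞ :=
  essSup (fun t => homSobolevNorm s (u t)) (volume.restrict I)

/-- `u ∈ C(I; Ḣˢ)`. -/
def ContinuousInHomSobolev (s : ℝ) (I : Set ℝ) (u : ℝ → E4 → ℂ) : Prop :=
  (∀ t ∈ I, homSobolevNorm s (u t) < ∞) ∧
  ∀ t₀ ∈ I, Tendsto (fun t => homSobolevNorm s (u t - u t₀)) (𝓝[I] t₀) (𝓝 0)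

/-- `u ∈ C(I; L²)`. -/
def ContinuousInL2 (I : Set ℝ) (u : ℝ → E4 → ℂ) : Prop :=
  (∀ t ∈ I, MemLp (u t) 2) ∧
  ∀ t₀ ∈ I, Tendsto (fun t => eLpNorm (u t - u t₀) 2 volume) (𝓝[I] t₀) (𝓝 0)

/-! ### Lorentz spaces -/

/-- The decreasing rearrangement `f*(σ) = inf {l > 0 : |{|f| > l}| ≤ σ}`. -/
def decreasingRearrangement (f : E4 → ℂ) (σ : ℝ) : ℝ≥0∞ :=
  sInf {l : ℝ≥0∞ | 0 < l ∧ volume {x | l < ‖f x‖ₑ} ≤ ENNReal.ofReal σ}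

/-- The Lorentz norm `‖f‖_{L^{r,ρ}} = ((ρ/r) ∫₀^∞ (σ^{1/r} f*(σ))^ρ dσ/σ)^{1/ρ}`
for `0 < r, ρ < ∞`. -/
def lorentzNorm (r ρ : ℝ) (f : E4 → ℂ) : ℝ≥0∞ :=
  (ENNReal.ofReal (ρ / r) * ∫⁻ σ in Ioi (0 : ℝ),
    (ENNReal.ofReal (σ ^ (1 / r)) * decreasingRearrangement f σ) ^ ρ *
      ENNReal.ofReal (1 / σ)) ^ (1 / ρ)

/-- The norm of `L_t^γ L_x^{r,ρ} (J × ℝ⁴)` for `0 < γ, r, ρ < ∞`. -/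
def mixedLorentzNorm (γ r ρ : ℝ) (J : Set ℝ) (u : ℝ → E4 → ℂ) : ℝ≥0∞ :=
  (∫⁻ t in J, lorentzNorm r ρ (u t) ^ γ) ^ (1 / γ)

/-! ### Solutions -/

/-- The free Schrödinger evolution `e^{itΔ} φ` of a Schwartz function `φ`. -/
def freeEvolution (t : ℝ) (φ : 𝓢(E4, ℂ)) : E4 → ℂ :=
  𝓕⁻ (fun ξ : E4 =>
    Complex.exp (-Complex.I * ((t * (2 * Real.pi * ‖ξ‖) ^ 2 : ℝ) : ℂ)) * 𝓕 (φ : E4 → ℂ) ξ)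

/-- The nonlinearity `|x|^{-b} |f|^α f`. -/
def nonlinearity (α b : ℝ) (f : E4 → ℂ) (x : E4) : ℂ :=
  ((‖x‖ ^ (-b) * ‖f x‖ ^ α : ℝ) : ℂ) * f x

/-- The Duhamel formula
`u(t) = e^{i(t-t₀)Δ} u(t₀) - i ∫_{t₀}^t e^{i(t-τ)Δ} |x|^{-b} |u(τ)|^α u(τ) dτ` for all `t, t₀ ∈ I`,
as an identity of tempered distributions. The operators `e^{itΔ}` act on tempered
distributions by `⟨e^{itΔ} T, φ⟩ = ⟨T, e^{itΔ} φ⟩`. -/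
def DuhamelFormula (α b : ℝ) (I : Set ℝ) (u : ℝ → E4 → ℂ) : Prop :=
  ∀ t ∈ I, ∀ t₀ ∈ I, ∀ φ : 𝓢(E4, ℂ),
    ∫ x, u t x * φ x =
      (∫ x, u t₀ x * freeEvolution (t - t₀) φ x) -
        Complex.I * ∫ τ in t₀..t, ∫ x,
          nonlinearity α b (u τ) x * freeEvolution (t - τ) φ x

/-- `u` is a (strong) solution on the time interval `I` of
`i u_t + Δ u = |x|^{-b} |u|^α u` on `ℝ⁴`, at the regularity `s`. -/
structure IsSolution (α b s : ℝ) (I : Set ℝ) (u : ℝ → E4 → ℂ) : Prop where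
  measurable : AEStronglyMeasurable (Function.uncurry u)
    ((volume.restrict I).prod (volume : Measure E4))
  continuous : ContinuousInHomSobolev s I u ∨ ContinuousInL2 I u
  scattering_norm : ∀ J : Set ℝ, J ⊆ I → IsCompact J →
    mixedLorentzNorm (2 * (α + 1))
      (4 * α * (α + 1) / (α + 2 - b * (α + 1))) 2 J u < ∞
  duhamel : DuhamelFormula α b I u

end INLS

end

/-!
The inequality is the virial estimate for the Morawetz weight `|x|`, localized to the ball of radius
`R = A|I|^{1/2}`. With a radial field `X = p(x) x`, where `p` is `|x|⁻¹` near the ball and is cut off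
beyond it, the action `∫ X · Im(ū ∇u)` has a time derivative which, by integration by parts
(`integral_momentum_schrodinger`, `integral_inner_nonlinear_ge`), is bounded below by a multiple of
`∫ |u|^{α+2} / |x|^{1+b}` over the ball: in dimension four the Hessian of `|x|` and `-Δ²|x|` are both
nonnegative, and so is the contribution of `|x|^{-b}` to the nonlinear term because the equation is
defocusing. The errors live where `|x| ~ R` and cost `R⁻¹|∇u|²`, `R⁻³|u|²` and `R^{-1-b}|u|^{α+2}`
(`exists_virial_lower_bound`). All of these, and the action itself, scale like powers of `R` times
powers of the `Ḣˢ` norm, by the embeddings of `Ḣˢ` and `Ḣ^{s-1}` into weak Lebesgue spaces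
(`exists_lintegral_schwartzConv_rpow_le`). Since `|I| ≤ R²`, integration over `I` gives the claim.

The embeddings are obtained on the Fourier side. Splitting `f̂` at a frequency `λ`, the low part is
bounded pointwise by Cauchy–Schwarz and the high part is bounded in `L²`; choosing `λ` according to
the level yields the weak-type bound, which suffices because every exponent that is used lies
strictly below the critical one and only balls are involved.

The solution is too rough for the computation, so that it is carried out for the mollified solution
`v = u ∗ ψₙ`, which satisfies `i v_t + Δv = N(u) ∗ ψₙ`, where `N(u) = |x|^{-b}|u|^α u`. This equation
follows from the Duhamel formula by Fubini's theorem (`weak_equation`) and holds in integrated form,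
for almost every time, which is all that the product rule needs (`integral_product_rule`,
`GoodSolution.momentum_eq`). The nonlinearity of `v` is `(|x|² + η)^{-b/2}|v|^α v` with
`η = 1/(n+1)`, to keep it continuous, and its difference from `N(u) ∗ ψₙ` tends to zero in `L¹` in time
with values in `L²` of a ball (`exists_eLpNorm_commutator_le`, `GoodSolution.tendsto_commutator`):
by Hölder's inequality `N(u)` is locally in `L²` once `u` is locally in `L^p` with
`p = 8(α+1)/(5-s-2b)`, and this exponent is below the Lorentz exponent of the solution, as `b < 3 - s`
ensures that `p` is positive and `s > 1` that it is small enough. Fatou's lemma removes the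
mollification, and then the regularization `θ` of the weight `(|x|² + θR²)^{-1/2}`
(`exists_good_morawetz`). Every time slice estimate is needed only at almost all times, so that
neither the continuity of `u` in time nor its values at the endpoints of `I` enter; the interval is
exhausted by intervals with good endpoints (`exists_interval_morawetz`).
-/

noncomputable section

namespace INLS

/-! ### Weak-type bounds and Lorentz norms -/

/-- Layer-cake form of the embedding of weak `L^q` into `L^r`, `r < q`, on a finite measure space. -/
theorem lintegral_rpow_le_of_weak_real {X : Type*} [MeasurableSpace X] {μ : Measure X} {f : X → ℝ}
    (hf0 : ∀ x, 0 ≤ f x) (hf : AEMeasurable f μ) {K V q r : ℝ} (hK : 0 < K) (hV : 0 < V)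
    (hμ : μ univ ≤ ENNReal.ofReal V) (hr : 0 < r) (hrq : r < q)
    (hw : ∀ t : ℝ, 0 < t → μ {x | t < f x} ≤ ENNReal.ofReal ((K / t) ^ q)) :
    ∫⁻ x, ENNReal.ofReal (f x ^ r) ∂μ ≤ ENNReal.ofReal (q / (q - r) * V ^ (1 - r / q) * K ^ r) := by
  have hq : 0 < q := hr.trans hrq
  rw [lintegral_rpow_eq_lintegral_meas_lt_mul μ (Eventually.of_forall hf0) hf hr]
  -- the level at which the trivial bound `μ ≤ V` and the weak-type bound agree
  set L : ℝ := K * V ^ (-(1 / q)) with hL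
  have hLpos : 0 < L := by positivity
  rw [← Ioc_union_Ioi_eq_Ioi hLpos.le]
  have h1 : ∫⁻ t in Ioc 0 L, μ {a | t < f a} * ENNReal.ofReal (t ^ (r - 1)) ≤
      ENNReal.ofReal (V * (L ^ r / r)) := by
    calc _ ≤ ∫⁻ t in Ioc 0 L, ENNReal.ofReal (V * t ^ (r - 1)) := by
          refine setLIntegral_mono' measurableSet_Ioc fun t ht => ?_
          rw [ENNReal.ofReal_mul hV.le]
          gcongr
          exact (measure_mono (subset_univ _)).trans hμ
      _ = ENNReal.ofReal (∫ t in Ioc 0 L, V * t ^ (r - 1)) := by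
          rw [ofReal_integral_eq_lintegral_ofReal]
          · refine Integrable.const_mul ?_ _
            have := (intervalIntegral.intervalIntegrable_rpow' (a := 0) (b := L)
              (r := r - 1) (by linarith))
            rwa [intervalIntegrable_iff_integrableOn_Ioc_of_le hLpos.le] at this
          · filter_upwards [ae_restrict_mem measurableSet_Ioc] with t ht
            have := ht.1
            positivity
      _ = _ := by
          congr 1
          rw [integral_const_mul, ← intervalIntegral.integral_of_le hLpos.le,
            integral_rpow (Or.inl (by linarith))]
          simp [Real.zero_rpow hr.ne']
  have h2 : ∫⁻ t in Ioi L, μ {a | t < f a} * ENNReal.ofReal (t ^ (r - 1)) ≤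
      ENNReal.ofReal (K ^ q * (L ^ (r - q) / (q - r))) := by
    calc _ ≤ ∫⁻ t in Ioi L, ENNReal.ofReal (K ^ q * t ^ (r - q - 1)) := by
          refine setLIntegral_mono' measurableSet_Ioi fun t ht => ?_
          have ht0 : 0 < t := hLpos.trans ht
          have : K ^ q * t ^ (r - q - 1) = (K / t) ^ q * t ^ (r - 1) := by
            rw [Real.div_rpow hK.le ht0.le, show r - q - 1 = (r - 1) - q by ring,
              Real.rpow_sub ht0]
            ring
          rw [this, ENNReal.ofReal_mul (by positivity)]
          gcongr
          exact hw t ht0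
      _ = ENNReal.ofReal (∫ t in Ioi L, K ^ q * t ^ (r - q - 1)) := by
          rw [ofReal_integral_eq_lintegral_ofReal]
          · exact (integrableOn_Ioi_rpow_of_lt (by linarith) hLpos).const_mul _
          · filter_upwards [ae_restrict_mem measurableSet_Ioi] with t ht
            have : 0 < t := hLpos.trans ht
            positivity
      _ = _ := by
          congr 1
          rw [integral_const_mul, integral_Ioi_rpow_of_lt (by linarith) hLpos]
          rw [show r - q - 1 + 1 = -(q - r) by ring, neg_div_neg_eq, neg_sub]
  calc _ ≤ ENNReal.ofReal r * (ENNReal.ofReal (V * (L ^ r / r)) +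
        ENNReal.ofReal (K ^ q * (L ^ (r - q) / (q - r)))) := by
        gcongr
        exact (lintegral_union_le _ _ _).trans (add_le_add h1 h2)
    _ = ENNReal.ofReal (r * (V * (L ^ r / r) + K ^ q * (L ^ (r - q) / (q - r)))) := by
        have : 0 < q - r := by linarith
        rw [← ENNReal.ofReal_add (by positivity) (by positivity), ← ENNReal.ofReal_mul hr.le]
    _ = _ := by
        congr 1
        have h3 : V * L ^ r = V ^ (1 - r / q) * K ^ r := by
          rw [hL, Real.mul_rpow hK.le (by positivity), ← Real.rpow_mul hV.le,
            show 1 - r / q = 1 + -(1 / q) * r by ring, Real.rpow_add hV, Real.rpow_one]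
          ring
        have h4 : K ^ q * L ^ (r - q) = V ^ (1 - r / q) * K ^ r := by
          rw [hL, Real.mul_rpow hK.le (by positivity), ← Real.rpow_mul hV.le,
            show 1 - r / q = -(1 / q) * (r - q) by field_simp; ring, Real.rpow_sub hK]
          field_simp
        have : q - r ≠ 0 := by linarith
        calc r * (V * (L ^ r / r) + K ^ q * (L ^ (r - q) / (q - r)))
            = V * L ^ r + r * (K ^ q * L ^ (r - q)) / (q - r) := by field_simp
          _ = _ := by rw [h3, h4]; field_simp; ring

/-- Weak `L^q` embeds into `L^r`, `r < q`, on a finite measure space, with a constant `K ∈ [0, ∞]`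
for the weak norm. -/
theorem lintegral_rpow_le_of_weak {X E : Type*} [MeasurableSpace X] [NormedAddCommGroup E]
    {μ : Measure X} {f : X → E} (hf : AEStronglyMeasurable f μ) {K : ℝ≥0∞} {V q r : ℝ} (hV : 0 < V)
    (hμ : μ univ ≤ ENNReal.ofReal V) (hr : 0 < r) (hrq : r < q)
    (hw : ∀ t : ℝ, 0 < t → μ {x | ENNReal.ofReal t < ‖f x‖ₑ} ≤ (K / ENNReal.ofReal t) ^ q) :
    ∫⁻ x, ‖f x‖ₑ ^ r ∂μ ≤ ENNReal.ofReal (q / (q - r) * V ^ (1 - r / q)) * K ^ r := by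
  have hq : 0 < q := hr.trans hrq
  have hqr : 0 < q - r := by linarith
  rcases eq_or_ne K ∞ with rfl | hK
  · rw [ENNReal.top_rpow_of_pos hr, ENNReal.mul_top]
    · exact le_top
    · rw [Ne, ENNReal.ofReal_eq_zero, not_le]; positivity
  rcases eq_or_ne K 0 with rfl | hK0
  · have : ∀ n : ℕ, ∀ᵐ x ∂μ, ‖f x‖ₑ ≤ ENNReal.ofReal (1 / ((n : ℝ) + 1)) := by
      intro n
      have h := hw (1 / ((n : ℝ) + 1)) (by positivity)
      simp only [ENNReal.zero_div, ENNReal.zero_rpow_of_pos hq, nonpos_iff_eq_zero] at h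
      rw [ae_iff]
      simpa only [not_le] using h
    have h0 : ∀ᵐ x ∂μ, ‖f x‖ₑ = 0 := by
      filter_upwards [ae_all_iff.2 this] with x hx
      have hlim : Tendsto (fun n : ℕ => ENNReal.ofReal (1 / ((n : ℝ) + 1))) atTop (𝓝 0) := by
        simpa using ENNReal.tendsto_ofReal tendsto_one_div_add_atTop_nhds_zero_nat
      exact le_antisymm (ge_of_tendsto' hlim hx) (zero_le)
    have : ∫⁻ x, ‖f x‖ₑ ^ r ∂μ = 0 := by
      rw [lintegral_congr_ae (g := fun _ => 0)]
      · simp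
      · filter_upwards [h0] with x hx
        rw [hx, ENNReal.zero_rpow_of_pos hr]
    rw [this]; exact zero_le
  lift K to ℝ≥0 using hK
  have hKp : (0 : ℝ) < K := by
    have : K ≠ 0 := by simpa using hK0
    positivity
  have key := lintegral_rpow_le_of_weak_real (μ := μ) (f := fun x => ‖f x‖)
    (fun x => norm_nonneg _) hf.norm.aemeasurable hKp hV hμ hr hrq (by
      intro t ht
      refine le_trans (le_of_eq ?_) ((hw t ht).trans (le_of_eq ?_))
      · congr 1
        ext x
        simp only [mem_ofPred_eq]
        rw [← ofReal_norm, ENNReal.ofReal_lt_ofReal_iff_of_nonneg ht.le]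
      · rw [← ENNReal.ofReal_coe_nnreal, ← ENNReal.ofReal_div_of_pos ht,
          ENNReal.ofReal_rpow_of_nonneg (by positivity) hq.le])
  refine le_trans (le_of_eq ?_) (key.trans (le_of_eq ?_))
  · refine lintegral_congr fun x => ?_
    rw [← ofReal_norm, ENNReal.ofReal_rpow_of_nonneg (norm_nonneg _) hr.le]
  · rw [ENNReal.ofReal_mul (by positivity), ← ENNReal.ofReal_rpow_of_nonneg hKp.le hr.le,
      ENNReal.ofReal_coe_nnreal]

/-- A Lorentz norm controls the weak norm of the same first exponent. -/
theorem volume_lt_le_lorentzNorm {r ρ : ℝ} (hr : 0 < r) (hρ : 0 < ρ) (f : E4 → ℂ) {t : ℝ}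
    (ht : 0 < t) :
    volume {x | ENNReal.ofReal t < ‖f x‖ₑ} ≤ (lorentzNorm r ρ f / ENNReal.ofReal t) ^ r := by
  have hto : ENNReal.ofReal t ≠ 0 := by simpa using ht
  have hto' : ENNReal.ofReal t ≠ ∞ := ENNReal.ofReal_ne_top
  -- it suffices to bound every `a` below the measure
  refine le_of_forall_lt fun a ha => ?_
  obtain ⟨c, hac, hc⟩ := exists_between ha
  refine hac.trans_le ?_
  lift c to ℝ≥0 using (hc.trans_le le_top).ne
  rcases eq_or_ne c 0 with rfl | hc0
  · simp
  have hcp : (0 : ℝ) < c := by positivity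
  have hstar : ∀ σ ∈ Ioc (0 : ℝ) c, ENNReal.ofReal t ≤ decreasingRearrangement f σ := by
    intro σ hσ
    refine le_sInf fun l hl => ?_
    by_contra hlt
    rw [not_le] at hlt
    have : volume {x | ENNReal.ofReal t < ‖f x‖ₑ} ≤ ENNReal.ofReal σ :=
      (measure_mono fun x (hx : _ < _) => hlt.trans hx).trans hl.2
    have h2 : ENNReal.ofReal σ ≤ (c : ℝ≥0∞) := by
      rw [← ENNReal.ofReal_coe_nnreal]; exact ENNReal.ofReal_le_ofReal hσ.2
    exact absurd hc (not_lt.2 (this.trans h2))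
  have hint : ENNReal.ofReal (ρ / r) * ∫⁻ σ in Ioi (0 : ℝ),
      (ENNReal.ofReal (σ ^ (1 / r)) * decreasingRearrangement f σ) ^ ρ * ENNReal.ofReal (1 / σ) ≥
      ENNReal.ofReal ((c : ℝ) ^ (ρ / r) * t ^ ρ) := by
    calc ENNReal.ofReal (ρ / r) * ∫⁻ σ in Ioi (0 : ℝ),
          (ENNReal.ofReal (σ ^ (1 / r)) * decreasingRearrangement f σ) ^ ρ * ENNReal.ofReal (1 / σ)
        ≥ ENNReal.ofReal (ρ / r) * ∫⁻ σ in Ioc (0 : ℝ) c,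
          ENNReal.ofReal (t ^ ρ * σ ^ (ρ / r - 1)) := by
          refine mul_le_mul' le_rfl ?_
          refine (setLIntegral_mono' measurableSet_Ioc fun σ hσ => ?_).trans
            (lintegral_mono_set (μ := volume) (fun _ hσ => hσ.1))
          have hσ0 : 0 < σ := hσ.1
          calc ENNReal.ofReal (t ^ ρ * σ ^ (ρ / r - 1))
              = (ENNReal.ofReal (σ ^ (1 / r)) * ENNReal.ofReal t) ^ ρ * ENNReal.ofReal (1 / σ) := by
                rw [← ENNReal.ofReal_mul (by positivity),
                  ENNReal.ofReal_rpow_of_nonneg (by positivity) hρ.le,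
                  ← ENNReal.ofReal_mul (by positivity)]
                congr 1
                rw [Real.mul_rpow (by positivity) ht.le, ← Real.rpow_mul hσ0.le,
                  Real.rpow_sub hσ0, Real.rpow_one, show 1 / r * ρ = ρ / r by ring]
                ring
            _ ≤ _ := by gcongr; exact hstar σ hσ
      _ = ENNReal.ofReal (ρ / r) * ENNReal.ofReal (∫ σ in Ioc (0 : ℝ) c,
            t ^ ρ * σ ^ (ρ / r - 1)) := by
          congr 1
          rw [ofReal_integral_eq_lintegral_ofReal]
          · refine Integrable.const_mul ?_ _
            have h := (intervalIntegral.intervalIntegrable_rpow' (a := 0) (b := (c : ℝ))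
              (r := ρ / r - 1) (by have : 0 < ρ / r := by positivity
                                   linarith))
            rwa [intervalIntegrable_iff_integrableOn_Ioc_of_le hcp.le] at h
          · filter_upwards [ae_restrict_mem measurableSet_Ioc] with σ hσ
            have := hσ.1
            positivity
      _ = _ := by
          have h0 : 0 < ρ / r := by positivity
          rw [← ENNReal.ofReal_mul h0.le]
          congr 1
          rw [integral_const_mul, ← intervalIntegral.integral_of_le hcp.le,
            integral_rpow (Or.inl (by linarith))]
          rw [sub_add_cancel, Real.zero_rpow h0.ne', sub_zero]
          field_simp
  have hnorm : ENNReal.ofReal ((c : ℝ) ^ (1 / r) * t) ≤ lorentzNorm r ρ f := by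
    rw [lorentzNorm]
    refine le_trans (le_of_eq ?_) (ENNReal.rpow_le_rpow hint (by positivity))
    rw [ENNReal.ofReal_rpow_of_nonneg (by positivity) (by positivity)]
    congr 1
    rw [Real.mul_rpow (by positivity) (by positivity), ← Real.rpow_mul hcp.le,
      ← Real.rpow_mul ht.le, mul_one_div_cancel hρ.ne', Real.rpow_one]
    congr 2
    field_simp
  calc (c : ℝ≥0∞) = ENNReal.ofReal ((c : ℝ) ^ (1 / r)) ^ r := by
        rw [ENNReal.ofReal_rpow_of_nonneg (by positivity) hr.le, ← Real.rpow_mul hcp.le,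
          one_div_mul_cancel hr.ne', Real.rpow_one, ENNReal.ofReal_coe_nnreal]
    _ ≤ _ := by
        gcongr
        rw [ENNReal.le_div_iff_mul_le (Or.inl hto) (Or.inl hto'), ← ENNReal.ofReal_mul (by positivity)]
        exact hnorm

/-! ### Fourier-side bounds for functions in homogeneous Sobolev spaces -/

/-- The volume of the unit ball of `ℝ⁴`. -/
def ballVol : ℝ := volume.real (Metric.closedBall (0 : E4) 1)

theorem ballVol_pos : 0 < ballVol :=
  ENNReal.toReal_pos (Metric.measure_closedBall_pos volume _ one_pos).ne'
    measure_closedBall_lt_top.ne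

theorem volume_closedBall_eq {ρ : ℝ} (hρ : 0 ≤ ρ) :
    volume (Metric.closedBall (0 : E4) ρ) = ENNReal.ofReal (ballVol * ρ ^ (4 : ℕ)) := by
  rw [Measure.addHaar_closedBall' volume 0 hρ, finrank_euclideanSpace_fin, mul_comm ballVol,
    ENNReal.ofReal_mul (by positivity), ballVol, Measure.real,
    ENNReal.ofReal_toReal measure_closedBall_lt_top.ne]

/-- The function `x ↦ |x|⁻¹` on `ℝ⁴` is in weak `L⁴`. -/
theorem volume_lt_inv_norm_le {t : ℝ} (ht : 0 < t) :
    volume {x : E4 | ENNReal.ofReal t < ‖(‖x‖⁻¹ : ℝ)‖ₑ} ≤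
      (ENNReal.ofReal (ballVol ^ (1 / 4 : ℝ)) / ENNReal.ofReal t) ^ (4 : ℝ) := by
  have h := ballVol_pos
  calc _ ≤ volume (Metric.closedBall (0 : E4) t⁻¹) := by
        refine measure_mono fun x hx => ?_
        simp only [mem_ofPred_eq] at hx
        rw [← ofReal_norm, ENNReal.ofReal_lt_ofReal_iff_of_nonneg ht.le, norm_inv, norm_norm] at hx
        rw [mem_closedBall_zero_iff]
        exact (lt_inv_of_lt_inv₀ ht hx).le
    _ = _ := by
        rw [volume_closedBall_eq (by positivity), ← ENNReal.ofReal_div_of_pos ht,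
          ENNReal.ofReal_rpow_of_nonneg (by positivity) (by norm_num)]
        congr 1
        rw [Real.div_rpow (by positivity) ht.le, ← Real.rpow_mul h.le]
        norm_num
        rw [div_eq_mul_inv]

/-- Powers `|x|^{-κ}` with `κ < 4` are integrable over finite measures bounded by the volume. -/
theorem lintegral_norm_rpow_neg_le {μ : Measure E4} (hle : μ ≤ volume) {V κ : ℝ} (hV : 0 < V)
    (hμ : μ univ ≤ ENNReal.ofReal V) (hκ : 0 < κ) (hκ4 : κ < 4) :
    ∫⁻ x, ENNReal.ofReal (‖x‖ ^ (-κ)) ∂μ ≤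
      ENNReal.ofReal (4 / (4 - κ) * V ^ (1 - κ / 4) * ballVol ^ (κ / 4)) := by
  have h := ballVol_pos
  have h1 := lintegral_rpow_le_of_weak (μ := μ) (f := fun x : E4 => (‖x‖⁻¹ : ℝ))
    (by fun_prop) (K := ENNReal.ofReal (ballVol ^ (1 / 4 : ℝ))) hV hμ hκ hκ4
    (fun t ht => (hle _).trans (volume_lt_inv_norm_le ht))
  refine le_trans (le_of_eq ?_) (h1.trans (le_of_eq ?_))
  · refine lintegral_congr fun x => ?_
    rw [← ofReal_norm, ENNReal.ofReal_rpow_of_nonneg (norm_nonneg _) hκ.le, norm_inv,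
      norm_norm, Real.inv_rpow (norm_nonneg _), Real.rpow_neg (norm_nonneg _)]
  · have h4 : 0 < 4 - κ := by linarith
    rw [ENNReal.ofReal_rpow_of_nonneg (by positivity) hκ.le, ← Real.rpow_mul h.le,
      ← ENNReal.ofReal_mul (by positivity)]
    congr 2
    ring_nf

/-- Plancherel's theorem for the inverse Fourier integral of a function in `L¹ ∩ L²`. -/
theorem eLpNorm_fourierInv_eq {h : E4 → ℂ} (h1 : Integrable h) (h2 : MemLp h 2) :
    eLpNorm (𝓕⁻ h) 2 volume = eLpNorm h 2 volume := by
  have hcont : Continuous (𝓕⁻ h) := by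
    have hF : Continuous (𝓕 h) :=
      VectorFourier.fourierIntegral_continuous Real.continuous_fourierChar
        (by exact continuous_inner) h1
    rw [show 𝓕⁻ h = fun x => 𝓕 h (-x) from funext fun x => Real.fourierInv_eq_fourier_neg h x]
    exact hF.comp continuous_neg
  set H : Lp ℂ 2 (volume : Measure E4) := h2.toLp h with hH
  have key : ((𝓕⁻ H : Lp ℂ 2 (volume : Measure E4)) : E4 → ℂ) =ᵐ[volume] 𝓕⁻ h := by
    refine ae_eq_of_integral_contDiff_smul_eq
      ((Lp.memLp _).locallyIntegrable (by norm_num)) hcont.locallyIntegrable fun φ hφ hφc => ?_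
    have hg₁ : HasCompactSupport (Complex.ofRealCLM ∘ φ) := hφc.comp_left rfl
    have hg₂ : ContDiff ℝ ((⊤ : ℕ∞) : WithTop ℕ∞) (Complex.ofRealCLM ∘ φ) := by fun_prop
    set g := hg₁.toSchwartzMap hg₂ with hg
    have e1 : (Lp.toTemperedDistribution (𝓕⁻ H)) g = (Lp.toTemperedDistribution H) (𝓕⁻ g) := by
      rw [← Lp.fourierInv_toTemperedDistribution_eq, TemperedDistribution.fourierInv_apply]
    rw [Lp.toTemperedDistribution_apply, Lp.toTemperedDistribution_apply] at e1
    have e2 : ∫ x, g x • (𝓕⁻ H : Lp ℂ 2 (volume : Measure E4)) x =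
        ∫ x, φ x • (𝓕⁻ H : Lp ℂ 2 (volume : Measure E4)) x := by
      refine integral_congr_ae (Eventually.of_forall fun x => ?_)
      simp [hg]
    have e3 : ∫ x, (𝓕⁻ g) x • H x = ∫ x, (𝓕⁻ g) x • h x := by
      refine integral_congr_ae ?_
      filter_upwards [h2.coeFn_toLp] with x hx
      rw [hH, hx]
    have e4 : ∫ x, (𝓕⁻ g) x • h x = ∫ x, g x • 𝓕⁻ h x := by
      have := VectorFourier.integral_fourierIntegral_smul_eq_flip (μ := volume) (ν := volume)
        (L := -innerₗ E4) (e := Real.fourierChar) (f := (g : E4 → ℂ)) (g := h)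
        Real.continuous_fourierChar (by simpa using! continuous_inner.neg) g.integrable h1
      have e5 : ∀ k : E4 → ℂ, VectorFourier.fourierIntegral Real.fourierChar volume
          (-innerₗ E4) k = 𝓕⁻ k := by
        intro k; ext w
        rw [Real.fourierInv_eq]
        simp [VectorFourier.fourierIntegral]
      have e6 : ∀ k : E4 → ℂ, VectorFourier.fourierIntegral Real.fourierChar volume
          (-innerₗ E4).flip k = 𝓕⁻ k := by
        intro k; ext w
        rw [Real.fourierInv_eq]
        simp [VectorFourier.fourierIntegral, real_inner_comm]
      rw [e5, e6] at this
      rw [SchwartzMap.fourierInv_coe]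
      exact this
    have e7 : ∫ x, g x • 𝓕⁻ h x = ∫ x, φ x • 𝓕⁻ h x := by
      refine integral_congr_ae (Eventually.of_forall fun x => ?_)
      simp [hg]
    rw [← e2, e1, e3, e4, e7]
  rw [← eLpNorm_congr_ae key, ← eLpNorm_congr_ae h2.coeFn_toLp]
  have n1 : ‖(𝓕⁻ H : Lp ℂ 2 (volume : Measure E4))‖ = ‖H‖ := by
    rw [← Lp.norm_fourier_eq (𝓕⁻ H), FourierTransform.fourier_fourierInv_eq]
  have : ‖(𝓕⁻ H : Lp ℂ 2 (volume : Measure E4))‖ₑ = ‖H‖ₑ := by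
    rw [← ofReal_norm, ← ofReal_norm, n1]
  simpa only [Lp.enorm_def] using this

/-- Weak-type Sobolev inequality on the Fourier side: if `(2π|ξ|)^σ h ∈ L²` with `0 < σ < 2`, then
the inverse Fourier transform of `h` lies in weak `L^{4/(2-σ)}`. The part of `h` on `|ξ| < N` is
bounded in `L¹`, the rest in `L²`, and `N` is chosen so that the former has half the height of the
level set. -/
theorem exists_volume_lt_fourierInv_le_real {σ : ℝ} (hσ : 0 < σ) (hσ2 : σ < 2) :
    ∃ C : ℝ, 0 < C ∧ ∀ (h : E4 → ℂ), Integrable h → ∀ M : ℝ, 0 < M →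
      (∫⁻ ξ, (ENNReal.ofReal ((2 * Real.pi * ‖ξ‖) ^ σ) * ‖h ξ‖ₑ) ^ 2) ≤ ENNReal.ofReal (M ^ 2) →
      ∀ t : ℝ, 0 < t → volume {x | ENNReal.ofReal t < ‖𝓕⁻ h x‖ₑ} ≤
        (ENNReal.ofReal C * ENNReal.ofReal M / ENNReal.ofReal t) ^ (4 / (2 - σ)) := by
  have hb := ballVol_pos
  have h4 : 0 < 4 - 2 * σ := by linarith
  have h2 : 0 < 2 - σ := by linarith
  have hpi := Real.pi_pos
  -- `B N ^ (4 - 2σ)` bounds the integral of `(2π|ξ|)^{-2σ}` over the ball of radius `N`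
  set B : ℝ := (2 * Real.pi) ^ (-(2 * σ)) * (4 / (4 - 2 * σ) * ballVol) with hB
  have hBpos : 0 < B := by positivity
  set D : ℝ := (2 * B ^ (1 / 2 : ℝ)) ^ (-(1 / (2 - σ))) with hD
  have hDpos : 0 < D := by positivity
  set E : ℝ := 4 * (2 * Real.pi * D) ^ (-(2 * σ)) with hE
  have hEpos : 0 < E := by positivity
  refine ⟨E ^ ((2 - σ) / 4), by positivity, fun h hint M hM hnorm t ht => ?_⟩
  set N : ℝ := D * (t / M) ^ (1 / (2 - σ)) with hN
  have hNpos : 0 < N := by positivity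
  set S : Set E4 := Metric.closedBall 0 N with hS
  have hSm : MeasurableSet S := measurableSet_closedBall
  set hl : E4 → ℂ := S.indicator h with hhl
  set hh : E4 → ℂ := Sᶜ.indicator h with hhh
  have hli : Integrable hl := hint.indicator hSm
  have hhi : Integrable hh := hint.indicator hSm.compl
  have hsum : ∀ x, 𝓕⁻ h x = 𝓕⁻ hl x + 𝓕⁻ hh x := by
    intro x
    rw [Real.fourierInv_eq, Real.fourierInv_eq, Real.fourierInv_eq, ← integral_add]
    · refine integral_congr_ae (Eventually.of_forall fun ξ => ?_)
      simp only [hhl, hhh]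
      rw [← smul_add]
      congr 1
      exact (congrFun (indicator_self_add_compl S h) ξ).symm
    · simpa using! (Real.fourierIntegral_convergent_iff' (-innerSL ℝ) x).2 hli
    · simpa using! (Real.fourierIntegral_convergent_iff' (-innerSL ℝ) x).2 hhi
  have hmeas : AEMeasurable (fun ξ => ENNReal.ofReal ((2 * Real.pi * ‖ξ‖) ^ σ) * ‖h ξ‖ₑ) :=
    AEMeasurable.mul (by fun_prop) hint.aestronglyMeasurable.enorm
  -- low frequencies
  have hne : ∀ᵐ ξ : E4, ξ ≠ 0 := by
    simp [ae_iff]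
  have hlowint : ∫⁻ ξ, ‖hl ξ‖ₑ ≤ ENNReal.ofReal (t / 2) := by
    have hw : ∫⁻ ξ in S, (ENNReal.ofReal ((2 * Real.pi * ‖ξ‖) ^ (-σ))) ^ (2 : ℝ) ≤
        ENNReal.ofReal (B * N ^ (4 - 2 * σ)) := by
      have h1 := lintegral_norm_rpow_neg_le (μ := volume.restrict S) Measure.restrict_le_self
        (V := ballVol * N ^ (4 : ℕ)) (κ := 2 * σ) (by positivity)
        (by rw [Measure.restrict_apply_univ, hS, volume_closedBall_eq hNpos.le]) (by linarith)
        (by linarith)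
      calc _ = ENNReal.ofReal ((2 * Real.pi) ^ (-(2 * σ))) *
            ∫⁻ ξ in S, ENNReal.ofReal (‖ξ‖ ^ (-(2 * σ))) := by
            rw [← lintegral_const_mul' _ _ ENNReal.ofReal_ne_top]
            refine lintegral_congr fun ξ => ?_
            rw [ENNReal.ofReal_rpow_of_nonneg (by positivity) (by norm_num),
              ← ENNReal.ofReal_mul (by positivity), ← Real.rpow_mul (by positivity),
              Real.mul_rpow (by positivity) (norm_nonneg _)]
            ring_nf
        _ ≤ _ := (mul_le_mul' le_rfl h1)
        _ = _ := by
            rw [← ENNReal.ofReal_mul (by positivity)]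
            congr 1
            rw [hB, Real.mul_rpow hb.le (by positivity), ← Real.rpow_natCast N 4,
              ← Real.rpow_mul hNpos.le,
              show 4 - 2 * σ = ((4 : ℕ) : ℝ) * (1 - 2 * σ / 4) by push_cast; ring]
            have : ballVol ^ (1 - 2 * σ / 4) * ballVol ^ (2 * σ / 4) = ballVol := by
              rw [← Real.rpow_add hb]; simp
            linear_combination (2 * Real.pi) ^ (-(2 * σ)) *
              (4 / (((4 : ℕ) : ℝ) * (1 - 2 * σ / 4))) *
              N ^ (((4 : ℕ) : ℝ) * (1 - 2 * σ / 4)) * this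
    calc ∫⁻ ξ, ‖hl ξ‖ₑ = ∫⁻ ξ in S, ‖h ξ‖ₑ := by
          rw [← lintegral_indicator hSm]
          refine lintegral_congr fun ξ => ?_
          rw [hhl, enorm_indicator_eq_indicator_enorm]
      _ = ∫⁻ ξ in S, (ENNReal.ofReal ((2 * Real.pi * ‖ξ‖) ^ (-σ))) *
            (ENNReal.ofReal ((2 * Real.pi * ‖ξ‖) ^ σ) * ‖h ξ‖ₑ) := by
          refine lintegral_congr_ae (ae_restrict_of_ae ?_)
          filter_upwards [hne] with ξ hξ
          have : 0 < 2 * Real.pi * ‖ξ‖ := by positivity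
          rw [← mul_assoc, ← ENNReal.ofReal_mul (by positivity), ← Real.rpow_add this]
          simp
      _ ≤ (∫⁻ ξ in S, (ENNReal.ofReal ((2 * Real.pi * ‖ξ‖) ^ (-σ))) ^ (2 : ℝ)) ^ (1 / 2 : ℝ) *
          (∫⁻ ξ in S, (ENNReal.ofReal ((2 * Real.pi * ‖ξ‖) ^ σ) * ‖h ξ‖ₑ) ^ (2 : ℝ)) ^
            (1 / 2 : ℝ) :=
          ENNReal.lintegral_mul_le_Lp_mul_Lq _ Real.HolderConjugate.two_two
            (by fun_prop) hmeas.restrict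
      _ ≤ (ENNReal.ofReal (B * N ^ (4 - 2 * σ))) ^ (1 / 2 : ℝ) *
          (ENNReal.ofReal (M ^ 2)) ^ (1 / 2 : ℝ) := by
          gcongr
          refine (setLIntegral_le_lintegral _ _).trans ?_
          simpa only [← ENNReal.rpow_natCast, Nat.cast_ofNat] using hnorm
      _ = ENNReal.ofReal (t / 2) := by
          rw [ENNReal.ofReal_rpow_of_nonneg (by positivity) (by norm_num),
            ENNReal.ofReal_rpow_of_nonneg (by positivity) (by norm_num),
            ← ENNReal.ofReal_mul (by positivity)]
          congr 1
          rw [← Real.sqrt_eq_rpow (M ^ 2), Real.sqrt_sq hM.le,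
            Real.mul_rpow hBpos.le (by positivity), ← Real.rpow_mul hNpos.le,
            show (4 - 2 * σ) * (1 / 2) = 2 - σ by ring, hN, Real.mul_rpow hDpos.le (by positivity),
            hD, ← Real.rpow_mul (by positivity), ← Real.rpow_mul (by positivity),
            show -(1 / (2 - σ)) * (2 - σ) = -1 by field_simp,
            show (1 / (2 - σ)) * (2 - σ) = 1 by field_simp, Real.rpow_one, Real.rpow_neg_one]
          field_simp
  have hlow : ∀ x, ‖𝓕⁻ hl x‖ₑ ≤ ENNReal.ofReal (t / 2) := by
    intro x
    rw [Real.fourierInv_eq]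
    refine (enorm_integral_le_lintegral_enorm _).trans (le_trans (le_of_eq ?_) hlowint)
    refine lintegral_congr fun ξ => ?_
    rw [← ofReal_norm, ← ofReal_norm, Circle.norm_smul]
  -- high frequencies
  have hhigh2 : ∫⁻ ξ, ‖hh ξ‖ₑ ^ 2 ≤
      ENNReal.ofReal ((2 * Real.pi * N) ^ (-(2 * σ)) * M ^ 2) := by
    calc ∫⁻ ξ, ‖hh ξ‖ₑ ^ 2 ≤ ∫⁻ ξ, ENNReal.ofReal ((2 * Real.pi * N) ^ (-(2 * σ))) *
          (ENNReal.ofReal ((2 * Real.pi * ‖ξ‖) ^ σ) * ‖h ξ‖ₑ) ^ 2 := by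
          refine lintegral_mono fun ξ => ?_
          by_cases hξ : ξ ∈ S
          · simp [hhh, hξ]
          · have hξN : N < ‖ξ‖ := by simpa [hS] using hξ
            rw [hhh, indicator_of_mem (show ξ ∈ Sᶜ from hξ), mul_pow, ← mul_assoc,
              ← ENNReal.ofReal_pow (by positivity), ← ENNReal.ofReal_mul (by positivity)]
            refine le_mul_of_one_le_left' ?_
            rw [← ENNReal.ofReal_one]
            refine ENNReal.ofReal_le_ofReal ?_
            rw [← Real.rpow_natCast, ← Real.rpow_mul (by positivity), Real.rpow_neg (by positivity),
              inv_mul_eq_div, one_le_div (by positivity)]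
            rw [show σ * ((2 : ℕ) : ℝ) = 2 * σ by push_cast; ring]
            gcongr
      _ = ENNReal.ofReal ((2 * Real.pi * N) ^ (-(2 * σ))) *
          ∫⁻ ξ, (ENNReal.ofReal ((2 * Real.pi * ‖ξ‖) ^ σ) * ‖h ξ‖ₑ) ^ 2 :=
          lintegral_const_mul' _ _ ENNReal.ofReal_ne_top
      _ ≤ _ := by
          rw [ENNReal.ofReal_mul (by positivity)]
          gcongr
  have heL : ∀ k : E4 → ℂ, eLpNorm k 2 volume = (∫⁻ ξ, ‖k ξ‖ₑ ^ 2) ^ (1 / 2 : ℝ) := by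
    intro k
    rw [eLpNorm_eq_lintegral_rpow_enorm_toReal (by norm_num) (by norm_num)]
    simp
  have hhL2 : MemLp hh 2 := by
    refine ⟨hhi.aestronglyMeasurable, ?_⟩
    rw [heL]
    exact ENNReal.rpow_lt_top_of_nonneg (by norm_num) (hhigh2.trans_lt ENNReal.ofReal_lt_top).ne
  have hplan : ∫⁻ x, ‖𝓕⁻ hh x‖ₑ ^ 2 = ∫⁻ ξ, ‖hh ξ‖ₑ ^ 2 := by
    have := eLpNorm_fourierInv_eq hhi hhL2
    rw [heL, heL] at this
    exact ENNReal.rpow_left_injective (by norm_num) this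
  have hcont : AEStronglyMeasurable (𝓕⁻ hh) volume := by
    have hF : Continuous (𝓕 hh) :=
      VectorFourier.fourierIntegral_continuous Real.continuous_fourierChar
        (by exact continuous_inner) hhi
    rw [show 𝓕⁻ hh = fun x => 𝓕 hh (-x) from
      funext fun x => Real.fourierInv_eq_fourier_neg hh x]
    exact (hF.comp continuous_neg).aestronglyMeasurable
  have ht2 : ENNReal.ofReal (t / 2) ≠ 0 := by simpa using ht
  calc volume {x | ENNReal.ofReal t < ‖𝓕⁻ h x‖ₑ}
      ≤ volume {x | ENNReal.ofReal (t / 2) ^ 2 ≤ ‖𝓕⁻ hh x‖ₑ ^ 2} := by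
        refine measure_mono fun x hx => ?_
        simp only [mem_ofPred_eq] at hx ⊢
        gcongr
        by_contra hlt
        rw [not_le] at hlt
        have : ‖𝓕⁻ h x‖ₑ ≤ ENNReal.ofReal (t / 2) + ENNReal.ofReal (t / 2) := by
          rw [hsum]
          exact (enorm_add_le _ _).trans (add_le_add (hlow x) hlt.le)
        rw [← ENNReal.ofReal_add (by positivity) (by positivity), add_halves] at this
        exact absurd hx (not_lt.2 this)
    _ ≤ (∫⁻ x, ‖𝓕⁻ hh x‖ₑ ^ 2) / ENNReal.ofReal (t / 2) ^ 2 :=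
        meas_ge_le_lintegral_div (hcont.enorm.pow_const 2) (by simpa using ht2) (by finiteness)
    _ ≤ ENNReal.ofReal ((2 * Real.pi * N) ^ (-(2 * σ)) * M ^ 2) / ENNReal.ofReal (t / 2) ^ 2 := by
        rw [hplan]
        gcongr
    _ = _ := by
        rw [← ENNReal.ofReal_pow (by positivity), ← ENNReal.ofReal_div_of_pos (by positivity),
          ← ENNReal.ofReal_mul (by positivity), ← ENNReal.ofReal_div_of_pos ht,
          ENNReal.ofReal_rpow_of_nonneg (by positivity) (by positivity)]
        congr 1
        rw [mul_div_assoc (E ^ ((2 - σ) / 4)),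
          Real.mul_rpow (x := E ^ ((2 - σ) / 4)) (by positivity) (by positivity),
          ← Real.rpow_mul hEpos.le,
          show (2 - σ) / 4 * (4 / (2 - σ)) = 1 by field_simp, Real.rpow_one, hN, ← mul_assoc,
          Real.mul_rpow (x := 2 * Real.pi * D) (by positivity) (by positivity),
          ← Real.rpow_mul (x := t / M) (by positivity),
          show 4 / (2 - σ) = 2 + 2 * σ / (2 - σ) by field_simp; ring,
          Real.rpow_add (by positivity)]
        have : (t / M) ^ (1 / (2 - σ) * -(2 * σ)) = (M / t) ^ (2 * σ / (2 - σ)) := by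
          rw [← inv_div M t, Real.inv_rpow (by positivity), ← Real.rpow_neg (by positivity)]
          congr 1
          ring
        rw [this, hE]
        norm_num
        field_simp
        ring

/-! ### Convolution with Schwartz functions -/

/-- The convolution `y ↦ ∫ f(x) ψ(y - x) dx` of a function with a Schwartz function. -/
def schwartzConv (f : E4 → ℂ) (ψ : 𝓢(E4, ℂ)) (y : E4) : ℂ := ∫ x, f x * ψ (y - x)

/-- The Schwartz function `x ↦ ψ(y - x)`. -/
def reflectShift (ψ : 𝓢(E4, ℂ)) (y : E4) : 𝓢(E4, ℂ) :=
  (SchwartzMap.compCLMOfContinuousLinearEquiv ℂ (LinearIsometryEquiv.neg ℝ (E := E4)) ψ).compSubConstCLM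
    ℂ y

@[simp] theorem reflectShift_apply (ψ : 𝓢(E4, ℂ)) (y x : E4) : reflectShift ψ y x = ψ (y - x) := by
  simp [reflectShift]

theorem fourierInv_reflectShift (ψ : 𝓢(E4, ℂ)) (y ξ : E4) :
    𝓕⁻ (reflectShift ψ y) ξ = Real.fourierChar (inner ℝ ξ y) • 𝓕 ψ ξ := by
  rw [SchwartzMap.fourierInv_coe, SchwartzMap.fourier_coe, Real.fourierInv_eq, Real.fourier_eq,
    Circle.smul_def, smul_eq_mul, ← integral_const_mul]
  rw [← integral_sub_left_eq_self _ volume y]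
  refine integral_congr_ae (Eventually.of_forall fun z => ?_)
  simp only [reflectShift_apply, sub_sub_cancel]
  rw [Circle.smul_def, Circle.smul_def, smul_eq_mul, smul_eq_mul, ← mul_assoc, ← Circle.coe_mul,
    ← AddChar.map_add_eq_mul, inner_sub_left, real_inner_comm ξ y, sub_eq_add_neg]

/-- Convolution with a Schwartz function is a multiplier on the Fourier side. -/
theorem schwartzConv_eq_fourierInv {T : 𝓢'(E4, ℂ)} {f g : E4 → ℂ} (hf : Represents T f)
    (hg : Represents (𝓕 T) g) (ψ : 𝓢(E4, ℂ)) :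
    Integrable (fun ξ => g ξ * 𝓕 ψ ξ) ∧
      schwartzConv f ψ = 𝓕⁻ (fun ξ => g ξ * 𝓕 ψ ξ) := by
  constructor
  · simpa only [mul_comm] using (hg (𝓕 ψ)).1
  · ext y
    have h1 : T (reflectShift ψ y) = (𝓕 T) (𝓕⁻ (reflectShift ψ y)) := by
      rw [TemperedDistribution.fourier_apply, FourierTransform.fourier_fourierInv_eq]
    rw [(hf _).2, (hg _).2] at h1
    rw [schwartzConv, Real.fourierInv_eq]
    calc _ = ∫ x, reflectShift ψ y x * f x := by simp only [reflectShift_apply, mul_comm]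
      _ = _ := h1
      _ = _ := by
        refine integral_congr_ae (Eventually.of_forall fun ξ => ?_)
        simp only [fourierInv_reflectShift, Circle.smul_def, smul_eq_mul]
        ring

/-- Weak-type Sobolev inequality for convolutions `f * ψ` with `f ∈ Ḣˢ`, where the multiplier `ψ̂`
costs `s - σ` derivatives. -/
theorem exists_volume_lt_schwartzConv_le {s σ : ℝ} (hσ : 0 < σ) (hσ2 : σ < 2) :
    ∃ C : ℝ, 0 < C ∧ ∀ (f : E4 → ℂ) (ψ : 𝓢(E4, ℂ)),
      (∀ ξ, (2 * Real.pi * ‖ξ‖) ^ σ * ‖𝓕 ψ ξ‖ ≤ (2 * Real.pi * ‖ξ‖) ^ s) →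
      ∀ t : ℝ, 0 < t → volume {x | ENNReal.ofReal t < ‖schwartzConv f ψ x‖ₑ} ≤
        (ENNReal.ofReal C * homSobolevNorm s f / ENNReal.ofReal t) ^ (4 / (2 - σ)) := by
  obtain ⟨C, hC, hmain⟩ := exists_volume_lt_fourierInv_le_real hσ hσ2
  have h2 : 0 < 2 - σ := by linarith
  have hq : 0 < 4 / (2 - σ) := by positivity
  refine ⟨C, hC, fun f ψ hψ t ht => ?_⟩
  have hC0 : ENNReal.ofReal C ≠ 0 := by simpa using hC
  have ht0 : ENNReal.ofReal t ≠ 0 := by simpa using ht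
  set V := volume {x | ENNReal.ofReal t < ‖schwartzConv f ψ x‖ₑ} with hV
  -- the assertion is equivalent to a lower bound for the infimum defining the norm
  suffices h : V ^ ((4 / (2 - σ))⁻¹) * ENNReal.ofReal t / ENNReal.ofReal C ≤ homSobolevNorm s f by
    rw [ENNReal.div_le_iff_le_mul (Or.inl hC0) (Or.inl (by finiteness)), mul_comm _ (ENNReal.ofReal C),
      ← ENNReal.le_div_iff_mul_le (Or.inl ht0) (Or.inl (by finiteness)),
      ENNReal.rpow_inv_le_iff hq] at h
    exact h
  refine le_iInf fun T => le_iInf fun g => le_iInf fun hf => le_iInf fun hg => ?_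
  obtain ⟨hint, heq⟩ := schwartzConv_eq_fourierInv hf hg ψ
  set a := (∫⁻ ξ, (ENNReal.ofReal ((2 * Real.pi * ‖ξ‖) ^ s) * ‖g ξ‖ₑ) ^ 2) ^ (1 / 2 : ℝ) with ha
  refine le_of_forall_gt fun m hm => ?_
  obtain ⟨M, hM, hMm⟩ := exists_between hm
  refine lt_of_le_of_lt ?_ hMm
  have hMtop : M ≠ ∞ := (hMm.trans_le le_top).ne
  have hM0 : 0 < M.toReal := ENNReal.toReal_pos (bot_le.trans_lt hM).ne' hMtop
  have h3 := hmain _ hint M.toReal hM0 (by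
    calc _ ≤ ∫⁻ ξ, (ENNReal.ofReal ((2 * Real.pi * ‖ξ‖) ^ s) * ‖g ξ‖ₑ) ^ 2 := by
          refine lintegral_mono fun ξ => ?_
          refine pow_le_pow_left' ?_ 2
          rw [enorm_mul, mul_comm ‖g ξ‖ₑ, ← mul_assoc, ← ofReal_norm (𝓕 ψ ξ),
            ← ENNReal.ofReal_mul (by positivity)]
          gcongr
          exact hψ ξ
      _ = a ^ (2 : ℝ) := by
          rw [ha, ← ENNReal.rpow_mul]; norm_num
      _ ≤ M ^ (2 : ℝ) := by gcongr
      _ = _ := by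
          rw [ENNReal.ofReal_pow hM0.le, ENNReal.ofReal_toReal hMtop]
          simp) t ht
  rw [← heq, ENNReal.ofReal_toReal hMtop] at h3
  rw [ENNReal.div_le_iff_le_mul (Or.inl hC0) (Or.inl (by finiteness)), mul_comm _ (ENNReal.ofReal C),
      ← ENNReal.le_div_iff_mul_le (Or.inl ht0) (Or.inl (by finiteness)),
      ENNReal.rpow_inv_le_iff hq]
  exact h3

/-- Local `L^r` bounds on balls from a weak `L^{4/(2-σ)}` bound, for subcritical `r`. -/
theorem lintegral_closedBall_rpow_le_of_weak {σ r : ℝ} (hσ2 : σ < 2) (hr : 0 < r)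
    (hr' : r * (2 - σ) < 4) {f : E4 → ℂ} (hf : AEStronglyMeasurable f volume) {K : ℝ≥0∞}
    (hw : ∀ t : ℝ, 0 < t →
      volume {x | ENNReal.ofReal t < ‖f x‖ₑ} ≤ (K / ENNReal.ofReal t) ^ (4 / (2 - σ)))
    {ρ : ℝ} (hρ : 0 < ρ) :
    ∫⁻ x in Metric.closedBall 0 ρ, ‖f x‖ₑ ^ r ≤
      ENNReal.ofReal (4 / (4 - r * (2 - σ)) * ballVol ^ (1 - r * (2 - σ) / 4) *
        ρ ^ (4 - r * (2 - σ))) * K ^ r := by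
  have h2 : 0 < 2 - σ := by linarith
  have hb := ballVol_pos
  have h := lintegral_rpow_le_of_weak (μ := volume.restrict (Metric.closedBall (0 : E4) ρ))
    (f := f) hf.restrict (K := K) (V := ballVol * ρ ^ (4 : ℕ)) (q := 4 / (2 - σ)) (r := r)
    (by positivity)
    (by rw [Measure.restrict_apply_univ, volume_closedBall_eq hρ.le]) hr
    (by rwa [lt_div_iff₀ h2]) (fun t ht => (Measure.restrict_le_self _).trans (hw t ht))
  refine h.trans (le_of_eq ?_)
  congr 2
  have h4 : 4 - r * (2 - σ) ≠ 0 := by linarith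
  rw [Real.mul_rpow hb.le (by positivity), ← Real.rpow_natCast ρ 4, ← Real.rpow_mul hρ.le, mul_assoc]
  congr 1
  · field_simp
  · congr 2 <;> push_cast <;> field_simp

/-! ### Mollification -/

/-- A bump function supported in the ball of radius `1 / (n + 1)`. -/
def bump (n : ℕ) : ContDiffBump (0 : E4) where
  rIn := 1 / (2 * ((n : ℝ) + 1))
  rOut := 1 / ((n : ℝ) + 1)
  rIn_pos := by positivity
  rIn_lt_rOut := by
    apply one_div_lt_one_div_of_lt <;> linarith [(by positivity : (0 : ℝ) < (n : ℝ) + 1)]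

/-- A standard sequence of mollifiers, as real functions. -/
def mollR (n : ℕ) : E4 → ℝ := (bump n).normed volume

theorem mollR_nonneg (n : ℕ) (x : E4) : 0 ≤ mollR n x := (bump n).nonneg_normed x

theorem mollR_continuous (n : ℕ) : Continuous (mollR n) := (bump n).continuous_normed

theorem bump_rOut_le (n : ℕ) : (bump n).rOut ≤ 1 := by
  rw [bump]
  simp only
  rw [div_le_one (by positivity)]
  linarith [(Nat.cast_nonneg n : (0 : ℝ) ≤ n)]

theorem mollR_eq_zero {n : ℕ} {x : E4} (hx : 1 ≤ ‖x‖) : mollR n x = 0 := by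
  have : x ∉ Function.support (mollR n) := by
    rw [mollR, ContDiffBump.support_normed_eq, mem_ball_zero_iff, not_lt]
    exact (bump_rOut_le n).trans hx
  simpa using this

theorem hasCompactSupport_ofReal_mollR (n : ℕ) : HasCompactSupport (Complex.ofRealCLM ∘ mollR n) :=
  ((bump n).hasCompactSupport_normed).comp_left rfl

theorem contDiff_ofReal_mollR (n : ℕ) :
    ContDiff ℝ ((⊤ : ℕ∞) : WithTop ℕ∞) (Complex.ofRealCLM ∘ mollR n) :=
  Complex.ofRealCLM.contDiff.comp (bump n).contDiff_normed

/-- The mollifiers as Schwartz functions. -/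
def moll (n : ℕ) : 𝓢(E4, ℂ) :=
  (hasCompactSupport_ofReal_mollR n).toSchwartzMap (contDiff_ofReal_mollR n)

theorem moll_apply (n : ℕ) (x : E4) : moll n x = (mollR n x : ℂ) := rfl

theorem hasCompactSupport_moll (n : ℕ) : HasCompactSupport (moll n) :=
  hasCompactSupport_ofReal_mollR n

theorem lintegral_mollR (n : ℕ) : ∫⁻ x, ENNReal.ofReal (mollR n x) = 1 := by
  rw [← ofReal_integral_eq_lintegral_ofReal (f := mollR n) (bump n).integrable_normed
    (Eventually.of_forall (mollR_nonneg n)), mollR, (bump n).integral_normed, ENNReal.ofReal_one]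

theorem norm_fourier_moll_le (n : ℕ) (ξ : E4) : ‖𝓕 (moll n) ξ‖ ≤ 1 := by
  rw [SchwartzMap.fourier_coe, Real.fourier_eq]
  refine (norm_integral_le_integral_norm _).trans (le_of_eq ?_)
  rw [← (bump n).integral_normed (μ := (volume : Measure E4))]
  refine integral_congr_ae (Eventually.of_forall fun x => ?_)
  simp only [Circle.norm_smul, moll_apply, Complex.norm_real, Real.norm_eq_abs,
    abs_of_nonneg (mollR_nonneg n x)]
  rfl

theorem schwartzConv_eq_convolution (f : E4 → ℂ) (ψ : 𝓢(E4, ℂ)) :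
    schwartzConv f ψ = convolution f ψ (ContinuousLinearMap.mul ℝ ℂ) volume := by
  ext y; simp [schwartzConv, convolution]

theorem schwartzConv_swap (f : E4 → ℂ) (ψ : 𝓢(E4, ℂ)) (y : E4) :
    schwartzConv f ψ y = ∫ z, f (y - z) * ψ z := by
  rw [schwartzConv, ← integral_sub_left_eq_self _ volume y]
  simp

theorem schwartzConv_moll (f : E4 → ℂ) (n : ℕ) :
    schwartzConv f (moll n) = convolution ((bump n).normed volume) f
      (ContinuousLinearMap.lsmul ℝ ℝ) volume := by
  ext y
  rw [schwartzConv_swap, convolution]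
  refine integral_congr_ae (Eventually.of_forall fun x => ?_)
  simp [moll_apply, mollR, mul_comm]

theorem tendsto_bump_rOut : Tendsto (fun n => (bump n).rOut) atTop (𝓝 0) :=
  tendsto_one_div_add_atTop_nhds_zero_nat

theorem ae_tendsto_schwartzConv_moll {f : E4 → ℂ} (hf : LocallyIntegrable f) :
    ∀ᵐ x, Tendsto (fun n => schwartzConv f (moll n) x) atTop (𝓝 (f x)) := by
  simp only [schwartzConv_moll]
  refine ContDiffBump.ae_convolution_tendsto_right_of_locallyIntegrable (K := 2)
    tendsto_bump_rOut (Eventually.of_forall fun n => le_of_eq ?_) hf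
  simp only [bump]
  field_simp

/-- The `k`-th coordinate vector. -/
def dir (k : Fin 4) : E4 := EuclideanSpace.single k (1 : ℝ)

/-- The `k`-th partial derivative. -/
def pd {F : Type*} [NormedAddCommGroup F] [NormedSpace ℝ F] (k : Fin 4) (f : E4 → F) (x : E4) : F :=
  fderiv ℝ f x (dir k)

open LineDeriv in
/-- The `k`-th partial derivative of a Schwartz function. -/
def spd (k : Fin 4) (ψ : 𝓢(E4, ℂ)) : 𝓢(E4, ℂ) := ∂_{dir k} ψ

theorem spd_apply (k : Fin 4) (ψ : 𝓢(E4, ℂ)) (x : E4) : spd k ψ x = pd k ψ x :=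
  SchwartzMap.lineDerivOp_apply_eq_fderiv _ _ _

theorem hasCompactSupport_spd {ψ : 𝓢(E4, ℂ)} (h : HasCompactSupport ψ) (k : Fin 4) :
    HasCompactSupport (spd k ψ) :=
  h.mono' ((subset_tsupport _).trans (SchwartzMap.tsupport_lineDerivOp_subset (dir k) ψ))

theorem norm_fourier_spd_le (k : Fin 4) (ψ : 𝓢(E4, ℂ)) (ξ : E4) :
    ‖𝓕 (spd k ψ) ξ‖ ≤ 2 * Real.pi * ‖ξ‖ * ‖𝓕 ψ ξ‖ := by
  have hg : (fun x : E4 => inner ℝ x (dir k)).HasTemperateGrowth := by fun_prop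
  rw [spd, SchwartzMap.fourier_lineDerivOp_eq, smul_apply,
    SchwartzMap.smulLeftCLM_apply_apply hg, norm_smul, norm_smul]
  have h1 : ‖(2 * (Real.pi : ℂ) * Complex.I)‖ = 2 * Real.pi := by
    simp [abs_of_pos Real.pi_pos]
  have h2 : ‖(inner ℝ ξ (dir k) : ℝ)‖ ≤ ‖ξ‖ := by
    refine (norm_inner_le_norm _ _).trans (le_of_eq ?_)
    simp [dir]
  rw [h1, mul_assoc (2 * Real.pi)]
  have := Real.pi_pos
  gcongr

theorem contDiff_schwartzConv {f : E4 → ℂ} (hf : LocallyIntegrable f) {ψ : 𝓢(E4, ℂ)}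
    (hψ : HasCompactSupport ψ) : ContDiff ℝ ((⊤ : ℕ∞) : WithTop ℕ∞) (schwartzConv f ψ) := by
  rw [schwartzConv_eq_convolution]
  exact hψ.contDiff_convolution_right _ hf (ψ.smooth _)

theorem pd_schwartzConv {f : E4 → ℂ} (hf : LocallyIntegrable f) {ψ : 𝓢(E4, ℂ)}
    (hψ : HasCompactSupport ψ) (k : Fin 4) :
    pd k (schwartzConv f ψ) = schwartzConv f (spd k ψ) := by
  ext y
  have h := hψ.hasFDerivAt_convolution_right (ContinuousLinearMap.mul ℝ ℂ) hf (ψ.smooth 1) y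
  rw [pd, schwartzConv_eq_convolution, h.fderiv]
  rw [convolution_precompR_apply _ hf (hψ.fderiv ℝ) ((ψ.smooth 1).continuous_fderiv one_ne_zero)]
  rw [schwartzConv, convolution]
  simp [spd_apply, pd]

/-- Young's inequality for the convolution with a mollifier. -/
theorem lintegral_schwartzConv_moll_rpow_le {f : E4 → ℂ} (hf : AEStronglyMeasurable f volume)
    {p : ℝ} (hp : 1 ≤ p) (n : ℕ) :
    ∫⁻ y, ‖schwartzConv f (moll n) y‖ₑ ^ p ≤ ∫⁻ y, ‖f y‖ₑ ^ p := by
  have hp0 : 0 < p := by linarith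
  have hm : Measurable fun z => ENNReal.ofReal (mollR n z) :=
    (mollR_continuous n).measurable.ennreal_ofReal
  set ν : Measure E4 := volume.withDensity fun z => ENNReal.ofReal (mollR n z) with hν
  have hprob : IsProbabilityMeasure ν :=
    ⟨by rw [hν, withDensity_apply _ MeasurableSet.univ, Measure.restrict_univ, lintegral_mollR]⟩
  have hac : ν ≪ volume := withDensity_absolutelyContinuous _ _
  have hsub : ∀ y : E4, AEStronglyMeasurable (fun z => f (y - z)) volume := fun y =>
    hf.comp_quasiMeasurePreserving (quasiMeasurePreserving_sub_left volume y)
  have hprod : AEMeasurable (fun q : E4 × E4 => ‖f (q.1 - q.2)‖ₑ ^ p) (volume.prod ν) :=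
    ((hf.enorm.pow_const p).comp_quasiMeasurePreserving
      (quasiMeasurePreserving_sub_of_right_invariant volume volume)).mono_ac
        (Measure.AbsolutelyContinuous.rfl.prod hac)
  calc ∫⁻ y, ‖schwartzConv f (moll n) y‖ₑ ^ p
      ≤ ∫⁻ y, ∫⁻ z, ‖f (y - z)‖ₑ ^ p ∂ν := by
        refine lintegral_mono fun y => ?_
        have h1 : ‖schwartzConv f (moll n) y‖ₑ ≤ ∫⁻ z, ‖f (y - z)‖ₑ ∂ν := by
          rw [schwartzConv_swap]
          refine (enorm_integral_le_lintegral_enorm _).trans (le_of_eq ?_)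
          rw [hν, lintegral_withDensity_eq_lintegral_mul₀ hm.aemeasurable (hsub y).enorm]
          refine lintegral_congr fun z => ?_
          rw [Pi.mul_apply, enorm_mul, mul_comm, moll_apply, ← ofReal_norm (Complex.ofReal _),
            Complex.norm_real, Real.norm_eq_abs, abs_of_nonneg (mollR_nonneg n z)]
        have h2 := eLpNorm'_le_eLpNorm'_of_exponent_le one_pos hp ν ((hsub y).mono_ac hac)
        rw [eLpNorm', eLpNorm'] at h2
        simp only [ENNReal.rpow_one, div_one] at h2
        calc _ ≤ (∫⁻ z, ‖f (y - z)‖ₑ ∂ν) ^ p := by gcongr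
          _ ≤ _ := by
            refine (ENNReal.rpow_le_rpow h2 hp0.le).trans (le_of_eq ?_)
            rw [← ENNReal.rpow_mul, one_div_mul_cancel hp0.ne', ENNReal.rpow_one]
    _ = ∫⁻ z, (∫⁻ y, ‖f (y - z)‖ₑ ^ p) ∂ν := lintegral_lintegral_swap hprod
    _ = ∫⁻ z, (∫⁻ y, ‖f y‖ₑ ^ p) ∂ν := by
        refine lintegral_congr fun z => ?_
        exact lintegral_sub_right_eq_self (fun y => ‖f y‖ₑ ^ p) z
    _ = _ := by simp

theorem eLpNorm_schwartzConv_moll_le {f : E4 → ℂ} (hf : AEStronglyMeasurable f volume)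
    {p : ℝ≥0∞} (hp : 1 ≤ p) (hp' : p ≠ ∞) (n : ℕ) :
    eLpNorm (schwartzConv f (moll n)) p volume ≤ eLpNorm f p volume := by
  have hp0 : p ≠ 0 := (zero_lt_one.trans_le hp).ne'
  rw [eLpNorm_eq_lintegral_rpow_enorm_toReal hp0 hp', eLpNorm_eq_lintegral_rpow_enorm_toReal hp0 hp']
  refine ENNReal.rpow_le_rpow (lintegral_schwartzConv_moll_rpow_le hf ?_ n) (by positivity)
  rwa [← ENNReal.toReal_one, ENNReal.toReal_le_toReal ENNReal.one_ne_top hp']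

/-- On a ball, the mollification only depends on the function on the ball with radius enlarged
by `1`. -/
theorem schwartzConv_moll_indicator (f : E4 → ℂ) (n : ℕ) {ρ : ℝ} {y : E4}
    (hy : y ∈ Metric.closedBall (0 : E4) ρ) :
    schwartzConv ((Metric.closedBall (0 : E4) (ρ + 1)).indicator f) (moll n) y =
      schwartzConv f (moll n) y := by
  refine integral_congr_ae (Eventually.of_forall fun x => ?_)
  simp only
  by_cases hx : x ∈ Metric.closedBall (0 : E4) (ρ + 1)
  · rw [indicator_of_mem hx]
  · rw [indicator_of_notMem hx, moll_apply, mollR_eq_zero]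
    · simp
    · rw [mem_closedBall_zero_iff] at hy hx
      have := norm_sub_norm_le x y
      rw [norm_sub_rev] at this
      linarith

theorem eLpNorm_restrict_schwartzConv_moll_le {f : E4 → ℂ} (hf : AEStronglyMeasurable f volume)
    {p : ℝ≥0∞} (hp : 1 ≤ p) (hp' : p ≠ ∞) (n : ℕ) (ρ : ℝ) :
    eLpNorm (schwartzConv f (moll n)) p (volume.restrict (Metric.closedBall 0 ρ)) ≤
      eLpNorm f p (volume.restrict (Metric.closedBall 0 (ρ + 1))) := by
  set S := Metric.closedBall (0 : E4) (ρ + 1)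
  have hS : MeasurableSet S := measurableSet_closedBall
  calc _ = eLpNorm (schwartzConv (S.indicator f) (moll n)) p
        (volume.restrict (Metric.closedBall 0 ρ)) := by
        refine eLpNorm_congr_ae ?_
        filter_upwards [ae_restrict_mem measurableSet_closedBall] with y hy
        exact (schwartzConv_moll_indicator f n hy).symm
    _ ≤ eLpNorm (schwartzConv (S.indicator f) (moll n)) p volume := eLpNorm_restrict_le _ _ _ _
    _ ≤ eLpNorm (S.indicator f) p volume := eLpNorm_schwartzConv_moll_le (hf.indicator hS) hp hp' n
    _ = _ := eLpNorm_indicator_eq_eLpNorm_restrict hS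

theorem schwartzConv_sub {f g : E4 → ℂ} (hf : LocallyIntegrable f) (hg : LocallyIntegrable g)
    {ψ : 𝓢(E4, ℂ)} (hψ : HasCompactSupport ψ) (y : E4) :
    schwartzConv (f - g) ψ y = schwartzConv f ψ y - schwartzConv g ψ y := by
  have h1 : ∀ {f : E4 → ℂ}, LocallyIntegrable f → Integrable fun x => f x * ψ (y - x) := by
    intro f hf
    have := hψ.convolutionExists_right (ContinuousLinearMap.mul ℝ ℂ) hf ψ.continuous y
    simpa [ConvolutionExistsAt] using this
  rw [schwartzConv, schwartzConv, schwartzConv, ← integral_sub (h1 hf) (h1 hg)]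
  refine integral_congr_ae (Eventually.of_forall fun x => ?_)
  simp [sub_mul]

/-- Mollifications converge in `L^p` on balls. -/
theorem tendsto_eLpNorm_schwartzConv_moll {f : E4 → ℂ} (hf : LocallyIntegrable f)
    {p : ℝ≥0∞} (hp : 1 ≤ p) (hp' : p ≠ ∞) {ρ : ℝ}
    (hfp : eLpNorm f p (volume.restrict (Metric.closedBall 0 (ρ + 1))) < ∞) :
    Tendsto (fun n => eLpNorm (schwartzConv f (moll n) - f) p
      (volume.restrict (Metric.closedBall 0 ρ))) atTop (𝓝 0) := by
  set S := Metric.closedBall (0 : E4) (ρ + 1) with hSdef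
  set B := Metric.closedBall (0 : E4) ρ with hB
  have hS : MeasurableSet S := measurableSet_closedBall
  have hBS : B ⊆ S := Metric.closedBall_subset_closedBall (by linarith)
  have hF : MemLp (S.indicator f) p volume :=
    ⟨hf.aestronglyMeasurable.indicator hS, by rwa [eLpNorm_indicator_eq_eLpNorm_restrict hS]⟩
  have hFl : LocallyIntegrable (S.indicator f) := hF.locallyIntegrable hp
  rw [ENNReal.tendsto_nhds_zero]
  intro ε hε
  rcases eq_or_ne ε ∞ with rfl | hεt
  · simp
  have hε4 : ε / 4 ≠ 0 := (ENNReal.div_pos hε.ne' (by norm_num)).ne'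
  obtain ⟨g, hgc, hgε, hgcont, hgp⟩ := hF.exists_hasCompactSupport_eLpNorm_sub_le hp' hε4
  have hgl : LocallyIntegrable g := hgcont.locallyIntegrable
  -- uniform convergence for the continuous approximation
  set V : ℝ≥0∞ := volume B ^ (1 / p.toReal) with hV
  have hVt : V ≠ ∞ := ENNReal.rpow_ne_top_of_nonneg (by positivity) measure_closedBall_lt_top.ne
  obtain ⟨δ, hδ, hδV⟩ : ∃ δ : ℝ, 0 < δ ∧ ENNReal.ofReal δ * V ≤ ε / 4 := by
    obtain ⟨δ, hδ, h⟩ := ENNReal.exists_nnreal_pos_mul_lt hVt hε4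
    exact ⟨δ, by exact_mod_cast hδ, by rw [ENNReal.ofReal_coe_nnreal]; exact h.le⟩
  have hunif := Metric.uniformContinuous_iff.1 (hgc.uniformContinuous_of_continuous hgcont) δ hδ
  obtain ⟨η, hη, hgη⟩ := hunif
  filter_upwards [tendsto_bump_rOut.eventually (gt_mem_nhds hη)] with n hn
  have hg1 : ∀ y, ‖schwartzConv g (moll n) y - g y‖ ≤ δ := by
    intro y
    rw [schwartzConv_moll, ← dist_eq_norm]
    refine ContDiffBump.dist_normed_convolution_le hgl.aestronglyMeasurable fun x hx => ?_
    exact (hgη ((Metric.mem_ball.1 hx).trans hn)).le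
  have hg2 : eLpNorm (schwartzConv g (moll n) - g) p (volume.restrict B) ≤ ε / 4 := by
    refine (eLpNorm_le_of_ae_bound (C := δ) (Eventually.of_forall hg1)).trans ?_
    rw [Measure.restrict_apply_univ, mul_comm, ← one_div]
    exact hδV
  have hcm : ∀ {k : E4 → ℂ}, LocallyIntegrable k →
      AEStronglyMeasurable (schwartzConv k (moll n)) (volume.restrict B) := fun hk =>
    (contDiff_schwartzConv hk (hasCompactSupport_moll n)).continuous.aestronglyMeasurable
  have hdl : LocallyIntegrable (S.indicator f - g) := hFl.sub hgl
  calc eLpNorm (schwartzConv f (moll n) - f) p (volume.restrict B)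
      = eLpNorm (schwartzConv (S.indicator f - g) (moll n) +
          ((schwartzConv g (moll n) - g) + (g - S.indicator f))) p (volume.restrict B) := by
        refine eLpNorm_congr_ae ?_
        filter_upwards [ae_restrict_mem measurableSet_closedBall] with y hy
        simp only [Pi.sub_apply, Pi.add_apply]
        rw [schwartzConv_sub hFl hgl (hasCompactSupport_moll n), hSdef,
          schwartzConv_moll_indicator f n hy, indicator_of_mem (hBS hy)]
        ring
    _ ≤ eLpNorm (schwartzConv (S.indicator f - g) (moll n)) p (volume.restrict B) +
          (eLpNorm (schwartzConv g (moll n) - g) p (volume.restrict B) +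
            eLpNorm (g - S.indicator f) p (volume.restrict B)) := by
        refine (eLpNorm_add_le (hcm hdl) ?_ hp).trans ?_
        · exact ((hcm hgl).sub hgcont.aestronglyMeasurable).add
            (hgcont.aestronglyMeasurable.sub hF.1.restrict)
        · gcongr
          exact eLpNorm_add_le ((hcm hgl).sub hgcont.aestronglyMeasurable)
            (hgcont.aestronglyMeasurable.sub hF.1.restrict) hp
    _ ≤ ε / 4 + (ε / 4 + ε / 4) := by
        gcongr
        · exact (eLpNorm_restrict_le _ _ _ _).trans
            ((eLpNorm_schwartzConv_moll_le hdl.aestronglyMeasurable hp hp' n).trans hgε)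
        · refine (eLpNorm_restrict_le _ _ _ _).trans ?_
          rw [eLpNorm_sub_comm]
          exact hgε
    _ ≤ ε := by
        have h4 : ε / 4 + (ε / 4 + ε / 4) + ε / 4 = ε := by
          have : ε / 4 + (ε / 4 + ε / 4) + ε / 4 = 4 * (ε / 4) := by ring
          rw [this, ENNReal.mul_div_cancel (by norm_num) (by norm_num)]
        exact le_self_add.trans h4.le

/-! ### The free evolution of Schwartz functions -/

/-- The oscillating factor `e^{i(2π x·ξ - t (2π|ξ|)²)}` of the free evolution. -/
def osc (t : ℝ) (x ξ : E4) : ℂ :=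
  Complex.exp (Complex.I * ((2 * Real.pi * inner ℝ ξ x - t * (2 * Real.pi * ‖ξ‖) ^ 2 : ℝ) : ℂ))

theorem norm_osc (t : ℝ) (x ξ : E4) : ‖osc t x ξ‖ = 1 := by
  rw [osc, mul_comm]; exact Complex.norm_exp_ofReal_mul_I _

theorem continuous_osc : Continuous fun q : ℝ × E4 × E4 => osc q.1 q.2.1 q.2.2 := by
  unfold osc; fun_prop

theorem freeEvolution_eq (t : ℝ) (φ : 𝓢(E4, ℂ)) (x : E4) :
    freeEvolution t φ x = ∫ ξ, osc t x ξ * 𝓕 φ ξ := by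
  rw [freeEvolution, Real.fourierInv_eq]
  refine integral_congr_ae (Eventually.of_forall fun ξ => ?_)
  simp only [osc, SchwartzMap.fourier_coe]
  rw [Circle.smul_def, smul_eq_mul, ← mul_assoc, Real.fourierChar_apply, ← Complex.exp_add]
  congr 2
  push_cast
  ring

theorem integrable_osc_mul (t : ℝ) (x : E4) (ψ : 𝓢(E4, ℂ)) :
    Integrable fun ξ => osc t x ξ * ψ ξ := by
  refine ψ.integrable.bdd_mul (c := 1) ?_ (Eventually.of_forall fun ξ => (norm_osc t x ξ).le)
  exact (continuous_osc.comp (by fun_prop : Continuous fun ξ : E4 => (t, x, ξ))).aestronglyMeasurable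

theorem freeEvolution_zero (φ : 𝓢(E4, ℂ)) (x : E4) : freeEvolution 0 φ x = φ x := by
  have h : freeEvolution 0 φ = 𝓕⁻ (𝓕 φ) := by
    rw [freeEvolution, SchwartzMap.fourierInv_coe, SchwartzMap.fourier_coe]
    simp
  rw [h, FourierTransform.fourierInv_fourier_eq]

theorem norm_freeEvolution_le (t : ℝ) (φ : 𝓢(E4, ℂ)) (x : E4) :
    ‖freeEvolution t φ x‖ ≤ ∫ ξ, ‖𝓕 φ ξ‖ := by
  rw [freeEvolution_eq]
  refine (norm_integral_le_integral_norm _).trans (le_of_eq ?_)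
  simp [norm_osc]

theorem continuous_freeEvolution (φ : 𝓢(E4, ℂ)) :
    Continuous fun q : ℝ × E4 => freeEvolution q.1 φ q.2 := by
  simp only [freeEvolution_eq]
  refine continuous_of_dominated (bound := fun ξ => ‖𝓕 φ ξ‖) (fun q => ?_) (fun q => ?_)
    (𝓕 φ).integrable.norm ?_
  · exact (integrable_osc_mul _ _ _).aestronglyMeasurable
  · exact Eventually.of_forall fun ξ => by simp [norm_osc]
  · refine Eventually.of_forall fun ξ => ?_
    exact (continuous_osc.comp (by fun_prop : Continuous fun q : ℝ × E4 => (q.1, q.2, ξ))).mul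
      continuous_const

/-- The Laplacian on Schwartz functions. -/
def slap (ψ : 𝓢(E4, ℂ)) : 𝓢(E4, ℂ) := ∑ k, spd k (spd k ψ)

/-- Multiplication of a Schwartz function by the `k`-th coordinate. -/
def smulCoord (k : Fin 4) (ψ : 𝓢(E4, ℂ)) : 𝓢(E4, ℂ) :=
  SchwartzMap.smulLeftCLM ℂ (fun x : E4 => inner ℝ x (dir k)) ψ

theorem inner_dir (x : E4) (k : Fin 4) : (inner ℝ x (dir k) : ℝ) = x k := by
  simp [dir, EuclideanSpace.inner_single_right]

theorem smulCoord_apply (k : Fin 4) (ψ : 𝓢(E4, ℂ)) (x : E4) : smulCoord k ψ x = x k * ψ x := by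
  have hg : (fun x : E4 => inner ℝ x (dir k)).HasTemperateGrowth := by fun_prop
  rw [smulCoord, SchwartzMap.smulLeftCLM_apply_apply hg, inner_dir, Complex.real_smul]

theorem fourier_spd (k : Fin 4) (ψ : 𝓢(E4, ℂ)) (ξ : E4) :
    𝓕 (spd k ψ) ξ = 2 * Real.pi * Complex.I * ξ k * 𝓕 ψ ξ := by
  rw [spd, SchwartzMap.fourier_lineDerivOp_eq, smul_apply]
  change _ • smulCoord k (𝓕 ψ) ξ = _
  rw [smulCoord_apply, smul_eq_mul]
  ring

theorem spd_fourier (k : Fin 4) (ψ : 𝓢(E4, ℂ)) (ξ : E4) :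
    spd k (𝓕 ψ) ξ = -(2 * Real.pi * Complex.I) * 𝓕 (smulCoord k ψ) ξ := by
  rw [spd, SchwartzMap.lineDerivOp_fourier_eq, FourierTransform.fourier_smul]
  rfl

theorem norm_sq_eq (x : E4) : ‖x‖ ^ 2 = ∑ k, x k ^ 2 := by
  rw [EuclideanSpace.norm_sq_eq]; simp

theorem fourier_slap (ψ : 𝓢(E4, ℂ)) (ξ : E4) :
    𝓕 (slap ψ) ξ = -((2 * Real.pi * ‖ξ‖) ^ 2 : ℝ) * 𝓕 ψ ξ := by
  have h : 𝓕 (slap ψ) ξ = ∑ k, 𝓕 (spd k (spd k ψ)) ξ := by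
    rw [slap, ← SchwartzMap.fourierTransformCLM_apply ℂ, map_sum, sum_apply]
    rfl
  rw [h, mul_pow, norm_sq_eq]
  simp only [fourier_spd, Fin.sum_univ_four]
  push_cast
  linear_combination (4 * (Real.pi : ℂ) ^ 2 * (ξ 0 ^ 2 + ξ 1 ^ 2 + ξ 2 ^ 2 + ξ 3 ^ 2) * 𝓕 ψ ξ) *
    Complex.I_sq

/-- `∂_t e^{itΔ} φ = i e^{itΔ} Δφ`. -/
theorem hasDerivAt_freeEvolution (φ : 𝓢(E4, ℂ)) (t : ℝ) (x : E4) :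
    HasDerivAt (fun t => freeEvolution t φ x) (Complex.I * freeEvolution t (slap φ) x) t := by
  simp only [freeEvolution_eq]
  rw [← integral_const_mul]
  refine (hasDerivAt_integral_of_dominated_loc_of_deriv_le (s := univ)
    (bound := fun ξ => ‖𝓕 (slap φ) ξ‖)
    (F' := fun t ξ => Complex.I * (osc t x ξ * 𝓕 (slap φ) ξ)) univ_mem
    (Eventually.of_forall fun t => (integrable_osc_mul t x _).aestronglyMeasurable)
    (integrable_osc_mul t x _) ((integrable_osc_mul t x _).const_mul _).aestronglyMeasurable
    ?_ (𝓕 (slap φ)).integrable.norm ?_).2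
  · exact Eventually.of_forall fun ξ t _ => by simp [norm_osc]
  · refine Eventually.of_forall fun ξ t _ => ?_
    have h1 : HasDerivAt (fun t : ℝ => Complex.I *
        ((2 * Real.pi * inner ℝ ξ x - t * (2 * Real.pi * ‖ξ‖) ^ 2 : ℝ) : ℂ))
        (Complex.I * ((-(2 * Real.pi * ‖ξ‖) ^ 2 : ℝ) : ℂ)) t := by
      refine (HasDerivAt.ofReal_comp ?_).const_mul _
      simpa using ((hasDerivAt_id t).mul_const ((2 * Real.pi * ‖ξ‖) ^ 2)).const_sub
        (2 * Real.pi * inner ℝ ξ x)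
    have h2 := (h1.cexp).mul_const (𝓕 φ ξ)
    convert! h2 using 1
    rw [fourier_slap, osc]
    push_cast
    ring

theorem pd_osc (k : Fin 4) (t : ℝ) (x ξ : E4) :
    pd k (osc t x) ξ =
      Complex.I * (2 * Real.pi * x k - 8 * Real.pi ^ 2 * t * ξ k) * osc t x ξ := by
  have h0 : HasFDerivAt (fun ξ : E4 => 2 * Real.pi * inner ℝ ξ x - t * (2 * Real.pi) ^ 2 * ‖ξ‖ ^ 2)
      ((2 * Real.pi) • (innerSL ℝ x) - (t * (2 * Real.pi) ^ 2) • (2 • innerSL ℝ ξ)) ξ := by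
    refine HasFDerivAt.sub ?_ ?_
    · refine HasFDerivAt.const_mul ?_ _
      have := (innerSL ℝ x).hasFDerivAt (x := ξ)
      refine this.congr_of_eventuallyEq (Eventually.of_forall fun η => ?_)
      simp [real_inner_comm]
    · exact (hasStrictFDerivAt_norm_sq ξ).hasFDerivAt.const_mul _
  have h1 := ((Complex.ofRealCLM.hasFDerivAt.comp ξ h0).const_mul Complex.I).cexp
  have h2 : osc t x = fun ξ : E4 => Complex.exp (Complex.I * ((Complex.ofRealCLM ∘
      fun ξ : E4 => 2 * Real.pi * inner ℝ ξ x - t * (2 * Real.pi) ^ 2 * ‖ξ‖ ^ 2) ξ)) := by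
    ext η; simp only [osc, Function.comp, Complex.ofRealCLM_apply]; congr 3; ring
  rw [pd, h2, h1.fderiv]
  simp [inner_dir]
  ring

theorem differentiable_osc (t : ℝ) (x : E4) : Differentiable ℝ (osc t x) := by
  have : ContDiff ℝ 1 (osc t x) := by
    unfold osc
    refine ContDiff.cexp (contDiff_const.mul (Complex.ofRealCLM.contDiff.comp ?_))
    have h1 : ContDiff ℝ 1 fun ξ : E4 => ‖ξ‖ ^ 2 := contDiff_norm_sq ℝ
    simp only [mul_pow]
    exact (contDiff_const.mul (contDiff_id.inner ℝ contDiff_const)).sub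
      (contDiff_const.mul (contDiff_const.mul h1))
  exact this.differentiable one_ne_zero

/-- The commutator relation `x_k e^{itΔ} φ = e^{itΔ} (x_k φ - 2it ∂_k φ)`. -/
theorem coord_mul_freeEvolution (k : Fin 4) (t : ℝ) (φ : 𝓢(E4, ℂ)) (x : E4) :
    x k * freeEvolution t φ x =
      freeEvolution t (smulCoord k φ) x - 2 * Complex.I * t * freeEvolution t (spd k φ) x := by
  have hosc := fun ψ : 𝓢(E4, ℂ) => integrable_osc_mul t x ψ
  have hpd : ∀ ξ, pd k (osc t x) ξ * 𝓕 φ ξ = Complex.I * (2 * Real.pi * x k) * (osc t x ξ * 𝓕 φ ξ) -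
      4 * Real.pi * t * (osc t x ξ * 𝓕 (spd k φ) ξ) := by
    intro ξ
    rw [pd_osc, fourier_spd]
    ring
  have hibp := integral_mul_fderiv_eq_neg_fderiv_mul_of_integrable (μ := volume)
    (f := osc t x) (g := (𝓕 φ : 𝓢(E4, ℂ))) (v := dir k)
    (by
      change Integrable fun ξ => pd k (osc t x) ξ * 𝓕 φ ξ
      simp only [hpd]
      exact ((hosc _).const_mul _).sub ((hosc _).const_mul _))
    (by simpa only [spd_apply] using! hosc (spd k (𝓕 φ))) (hosc _)
    (fun ξ _ => differentiable_osc t x ξ) (fun ξ _ => (𝓕 φ).differentiable ξ)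
  change ∫ ξ, osc t x ξ * pd k (𝓕 φ : 𝓢(E4, ℂ)) ξ = -∫ ξ, pd k (osc t x) ξ * 𝓕 φ ξ at hibp
  simp only [← spd_apply, hpd, spd_fourier] at hibp
  rw [integral_sub ((hosc _).const_mul _) ((hosc _).const_mul _), integral_const_mul,
    integral_const_mul] at hibp
  simp only [mul_left_comm (osc t x _)] at hibp
  rw [integral_const_mul] at hibp
  rw [← freeEvolution_eq, ← freeEvolution_eq, ← freeEvolution_eq] at hibp
  have hpi : (Real.pi : ℂ) ≠ 0 := by exact_mod_cast Real.pi_ne_zero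
  have h3 : (2 * Real.pi * Complex.I : ℂ) ≠ 0 := by simp [hpi]
  refine mul_left_cancel₀ h3 ?_
  linear_combination hibp + (4 * Real.pi * t * freeEvolution t (spd k φ) x) * Complex.I_sq

theorem norm_le_sum_abs (x : E4) : ‖x‖ ≤ ∑ k, |x k| := by
  have h : x = ∑ k, x k • dir k := by
    have := (EuclideanSpace.basisFun (Fin 4) ℝ).sum_repr x
    simpa [dir] using this.symm
  conv_lhs => rw [h]
  refine (norm_sum_le _ _).trans (Finset.sum_le_sum fun k _ => ?_)
  rw [norm_smul]; simp [dir]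

/-- Decay of order `j` by induction on `j`: by the commutator relation, multiplication by a coordinate
is absorbed into the Schwartz function. -/
theorem exists_pow_mul_norm_freeEvolution_le (j : ℕ) (L : ℝ) : ∀ φ : 𝓢(E4, ℂ),
    ∃ C : ℝ, 0 ≤ C ∧ ∀ t : ℝ, |t| ≤ L → ∀ x : E4,
      (1 + ∑ k, |x k|) ^ j * ‖freeEvolution t φ x‖ ≤ C := by
  induction j with
  | zero =>
    intro φ
    exact ⟨∫ ξ, ‖𝓕 φ ξ‖, integral_nonneg fun _ => norm_nonneg _, fun t _ x => by
      simpa using norm_freeEvolution_le t φ x⟩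
  | succ j ih =>
    intro φ
    obtain ⟨C0, hC0, h0⟩ := ih φ
    choose C1 hC1 h1 using fun k => ih (smulCoord k φ)
    choose C2 hC2 h2 using fun k => ih (spd k φ)
    refine ⟨C0 + ∑ k, (C1 k + 2 * |L| * C2 k), by
      have := Finset.sum_nonneg fun k (_ : k ∈ Finset.univ) =>
        add_nonneg (hC1 k) (mul_nonneg (by positivity : 0 ≤ 2 * |L|) (hC2 k))
      positivity, fun t ht x => ?_⟩
    set P := (1 + ∑ k, |x k|) ^ j with hP
    have hP0 : 0 ≤ P := by positivity
    have hk : ∀ k, |x k| * ‖freeEvolution t φ x‖ ≤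
        ‖freeEvolution t (smulCoord k φ) x‖ + 2 * |L| * ‖freeEvolution t (spd k φ) x‖ := by
      intro k
      have h3 : |x k| * ‖freeEvolution t φ x‖ = ‖(x k : ℂ) * freeEvolution t φ x‖ := by
        rw [norm_mul, Complex.norm_real, Real.norm_eq_abs]
      rw [h3, coord_mul_freeEvolution]
      refine (norm_sub_le _ _).trans ?_
      gcongr
      rw [norm_mul]
      gcongr
      simp only [norm_mul, Complex.norm_I, Complex.norm_real, Real.norm_eq_abs, mul_one,
        Complex.norm_ofNat]
      exact mul_le_mul_of_nonneg_left (ht.trans (le_abs_self L)) zero_le_two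
    calc (1 + ∑ k, |x k|) ^ (j + 1) * ‖freeEvolution t φ x‖
        = P * ‖freeEvolution t φ x‖ + P * ∑ k, |x k| * ‖freeEvolution t φ x‖ := by
          rw [pow_succ, ← Finset.sum_mul]; ring
      _ ≤ P * ‖freeEvolution t φ x‖ + P * ∑ k, (‖freeEvolution t (smulCoord k φ) x‖ +
            2 * |L| * ‖freeEvolution t (spd k φ) x‖) := by
          gcongr with k; exact hk k
      _ = P * ‖freeEvolution t φ x‖ + ∑ k, (P * ‖freeEvolution t (smulCoord k φ) x‖ +
            2 * |L| * (P * ‖freeEvolution t (spd k φ) x‖)) := by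
          rw [Finset.mul_sum]; congr 1; refine Finset.sum_congr rfl fun k _ => ?_; ring
      _ ≤ _ := by
          gcongr with k
          · exact h0 t ht x
          · exact h1 k t ht x
          · exact h2 k t ht x

/-- A polynomially decaying, integrable weight on `ℝ⁴` that dominates free evolutions of Schwartz
functions. -/
def wt (x : E4) : ℝ := (1 + ‖x‖) ^ (-8 : ℝ)

theorem wt_pos (x : E4) : 0 < wt x := by unfold wt; positivity

theorem continuous_wt : Continuous wt := by
  unfold wt
  exact (continuous_const.add continuous_norm).rpow_const fun x => Or.inl (ne_of_gt (show 0 < 1 + ‖x‖ by positivity))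

theorem wt_le_one (x : E4) : wt x ≤ 1 :=
  Real.rpow_le_one_of_one_le_of_nonpos (by linarith [norm_nonneg x]) (by norm_num)

theorem integrable_wt : Integrable wt :=
  integrable_one_add_norm (by rw [finrank_euclideanSpace_fin]; norm_num)

/-- The free evolution of a Schwartz function decays polynomially, locally uniformly in time. -/
theorem exists_norm_freeEvolution_le (φ : 𝓢(E4, ℂ)) (L : ℝ) :
    ∃ C : ℝ, 0 ≤ C ∧ ∀ t : ℝ, |t| ≤ L → ∀ x : E4, ‖freeEvolution t φ x‖ ≤ C * wt x := by
  obtain ⟨C, hC, h⟩ := exists_pow_mul_norm_freeEvolution_le 8 L φ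
  refine ⟨C, hC, fun t ht x => ?_⟩
  have h1 : (1 + ‖x‖) ^ 8 * ‖freeEvolution t φ x‖ ≤ C := by
    refine le_trans ?_ (h t ht x)
    gcongr
    exact norm_le_sum_abs x
  have h2 : wt x = ((1 + ‖x‖) ^ 8)⁻¹ := by
    rw [wt, Real.rpow_neg (by positivity)]; norm_cast
  rw [h2, ← div_eq_mul_inv, le_div_iff₀ (by positivity), mul_comm]
  exact h1

/-! ### The equation tested against Schwartz functions -/

theorem Integrable.mul_of_norm_le_weight {X : Type*} [MeasurableSpace X] {μ : Measure X}
    {f k : X → ℂ} {w : X → ℝ} (hf : AEStronglyMeasurable f μ) (hfw : Integrable (fun x => ‖f x‖ * w x) μ)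
    (hk : AEStronglyMeasurable k μ) {C : ℝ} (hkw : ∀ᵐ x ∂μ, ‖k x‖ ≤ C * w x) :
    Integrable (fun x => f x * k x) μ := by
  refine (hfw.const_mul C).mono' (hf.mul hk) ?_
  filter_upwards [hkw] with x hx
  rw [norm_mul]
  calc ‖f x‖ * ‖k x‖ ≤ ‖f x‖ * (C * w x) := by gcongr
    _ = _ := by ring

theorem hasDerivAt_freeEvolution_sub (φ : 𝓢(E4, ℂ)) (x : E4) (c σ : ℝ) :
    HasDerivAt (fun σ => freeEvolution (σ - c) φ x)
      (Complex.I * freeEvolution (σ - c) (slap φ) x) σ :=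
  HasDerivAt.comp_sub_const (f := fun t => freeEvolution t φ x) σ c
    (hasDerivAt_freeEvolution φ (σ - c) x)

theorem integral_Ioc_freeEvolution_slap (φ : 𝓢(E4, ℂ)) (x : E4) (c : ℝ) {a b : ℝ} (hab : a ≤ b) :
    ∫ σ in Ioc a b, Complex.I * freeEvolution (σ - c) (slap φ) x =
      freeEvolution (b - c) φ x - freeEvolution (a - c) φ x := by
  have h : Continuous fun σ : ℝ => freeEvolution (σ - c) (slap φ) x :=
    continuous_iff_continuousAt.2 fun σ =>
      (hasDerivAt_freeEvolution_sub (slap φ) x c σ).continuousAt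
  rw [← intervalIntegral.integral_of_le hab]
  exact intervalIntegral.integral_eq_sub_of_hasDerivAt
    (fun σ _ => hasDerivAt_freeEvolution_sub φ x c σ)
    ((continuous_const.mul h).intervalIntegrable _ _)

/-- The Duhamel formula implies the differential equation, integrated in time and tested against a
Schwartz function. The Duhamel formula for `Δφ` is integrated over time, and Fubini's theorem on
the triangle `t₀ < τ ≤ σ ≤ t₁` is applied together with `i e^{itΔ} Δφ = ∂_t e^{itΔ} φ`. -/
theorem weak_equation {t₀ t₁ : ℝ} (h01 : t₀ ≤ t₁) {u N : ℝ → E4 → ℂ}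
    (hum : AEStronglyMeasurable (u t₀) volume) (hu : Integrable fun x => ‖u t₀ x‖ * wt x)
    (hNm : AEStronglyMeasurable (Function.uncurry N) ((volume.restrict (Ioc t₀ t₁)).prod volume))
    (hN : Integrable (fun q : ℝ × E4 => ‖N q.1 q.2‖ * wt q.2)
      ((volume.restrict (Ioc t₀ t₁)).prod volume))
    (φ : 𝓢(E4, ℂ))
    (hD : ∀ᵐ t ∂(volume.restrict (Ioc t₀ t₁)), ∫ x, u t x * slap φ x =
      (∫ x, u t₀ x * freeEvolution (t - t₀) (slap φ) x) -
        Complex.I * ∫ τ in t₀..t, ∫ x, N τ x * freeEvolution (t - τ) (slap φ) x)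
    (hD1 : ∫ x, u t₁ x * φ x = (∫ x, u t₀ x * freeEvolution (t₁ - t₀) φ x) -
        Complex.I * ∫ τ in t₀..t₁, ∫ x, N τ x * freeEvolution (t₁ - τ) φ x) :
    IntegrableOn (fun τ => ∫ x, u τ x * slap φ x) (Ioc t₀ t₁) ∧
    IntegrableOn (fun τ => ∫ x, N τ x * φ x) (Ioc t₀ t₁) ∧
    (∫ x, u t₁ x * φ x) - ∫ x, u t₀ x * φ x =
      ∫ τ in Ioc t₀ t₁, (Complex.I * (∫ x, u τ x * slap φ x) - Complex.I * ∫ x, N τ x * φ x) := by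
  set μ : Measure ℝ := volume.restrict (Ioc t₀ t₁) with hμ
  set L : ℝ := t₁ - t₀ with hL
  obtain ⟨C, hC, hdec⟩ := exists_norm_freeEvolution_le (slap φ) L
  obtain ⟨C', hC', hdec'⟩ := exists_norm_freeEvolution_le φ L
  have hL0 : 0 ≤ L := by rw [hL]; linarith
  have hmem : ∀ᵐ τ ∂μ, τ ∈ Ioc t₀ t₁ := ae_restrict_mem measurableSet_Ioc
  have hmemp : ∀ᵐ q ∂(μ.prod (volume : Measure E4)), q.1 ∈ Ioc t₀ t₁ :=
    Measure.quasiMeasurePreserving_fst.ae hmem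
  have hwt : Integrable (fun q : ℝ × E4 => ‖u t₀ q.2‖ * wt q.2) (μ.prod volume) := hu.comp_snd μ
  -- the contribution of the datum
  have hAint : Integrable (fun q : ℝ × E4 => u t₀ q.2 * freeEvolution (q.1 - t₀) (slap φ) q.2)
      (μ.prod volume) := by
    refine Integrable.mul_of_norm_le_weight (w := fun q => wt q.2) hum.comp_snd hwt
      (((continuous_freeEvolution (slap φ)).comp
        (by fun_prop : Continuous fun q : ℝ × E4 => (q.1 - t₀, q.2))).aestronglyMeasurable)
      (C := C) ?_
    filter_upwards [hmemp] with q hq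
    exact hdec _ (by rw [abs_of_nonneg (by linarith [hq.1])]; linarith [hq.2]) _
  have hA : ∫ σ, Complex.I * (∫ x, u t₀ x * freeEvolution (σ - t₀) (slap φ) x) ∂μ =
      (∫ x, u t₀ x * freeEvolution (t₁ - t₀) φ x) - ∫ x, u t₀ x * φ x := by
    have e0 : Integrable fun x => u t₀ x * freeEvolution (t₁ - t₀) φ x :=
      Integrable.mul_of_norm_le_weight hum hu
        (((continuous_freeEvolution φ).comp
          (by fun_prop : Continuous fun x : E4 => (t₁ - t₀, x))).aestronglyMeasurable)
        (Eventually.of_forall fun x => hdec' _ (abs_of_nonneg hL0).le x)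
    have e1 : Integrable fun x => u t₀ x * φ x := by
      refine Integrable.mul_of_norm_le_weight (C := C') hum hu φ.continuous.aestronglyMeasurable
        (Eventually.of_forall fun x => ?_)
      have := hdec' 0 (by simpa using hL0) x
      rwa [freeEvolution_zero] at this
    rw [← integral_sub e0 e1, integral_const_mul,
      integral_integral_swap (f := fun σ x => u t₀ x * freeEvolution (σ - t₀) (slap φ) x) hAint,
      ← integral_const_mul]
    refine integral_congr_ae (Eventually.of_forall fun x => ?_)
    simp only
    have := integral_Ioc_freeEvolution_slap φ x t₀ h01
    rw [sub_self, freeEvolution_zero, integral_const_mul] at this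
    rw [integral_const_mul, mul_left_comm, hμ, this]
    ring
  -- the contribution of the forcing term
  have hNφ' : Integrable (fun q : ℝ × E4 => N q.1 q.2 * freeEvolution (t₁ - q.1) φ q.2)
      (μ.prod volume) := by
    refine Integrable.mul_of_norm_le_weight (w := fun q => wt q.2) (C := C') hNm hN
      (((continuous_freeEvolution φ).comp
        (by fun_prop : Continuous fun q : ℝ × E4 => (t₁ - q.1, q.2))).aestronglyMeasurable) ?_
    filter_upwards [hmemp] with q hq
    exact hdec' _ (by rw [abs_of_nonneg (by linarith [hq.2])]; linarith [hq.1]) _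
  have hNφ : Integrable (fun q : ℝ × E4 => N q.1 q.2 * φ q.2) (μ.prod volume) := by
    refine Integrable.mul_of_norm_le_weight (w := fun q => wt q.2) (C := C') hNm hN
      ((φ.continuous.comp continuous_snd).aestronglyMeasurable)
      (Eventually.of_forall fun q => ?_)
    have := hdec' 0 (by simpa using hL0) q.2
    rwa [freeEvolution_zero] at this
  set H : ℝ → ℝ × E4 → ℂ := fun σ q =>
    N q.1 q.2 * ({p : ℝ × ℝ × E4 | p.2.1 ≤ p.1}.indicator
      (fun p => freeEvolution (p.1 - p.2.1) (slap φ) p.2.2) (σ, q)) with hH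
  have hset : MeasurableSet {p : ℝ × ℝ × E4 | p.2.1 ≤ p.1} :=
    measurableSet_le (by fun_prop) (by fun_prop)
  have hHint : Integrable (Function.uncurry H) (μ.prod (μ.prod volume)) := by
    have hmem2 : ∀ᵐ p ∂(μ.prod (μ.prod (volume : Measure E4))), p.1 ∈ Ioc t₀ t₁ :=
      Measure.quasiMeasurePreserving_fst.ae hmem
    have hmem3 : ∀ᵐ p ∂(μ.prod (μ.prod (volume : Measure E4))), p.2.1 ∈ Ioc t₀ t₁ :=
      Measure.quasiMeasurePreserving_snd.ae hmemp
    refine Integrable.mul_of_norm_le_weight (f := fun p : ℝ × ℝ × E4 => N p.2.1 p.2.2)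
      (w := fun p => wt p.2.2) (C := C) hNm.comp_snd
      (hN.comp_snd μ) ?_ ?_
    · refine AEStronglyMeasurable.indicator ?_ hset
      exact ((continuous_freeEvolution (slap φ)).comp (by fun_prop : Continuous
        fun p : ℝ × ℝ × E4 => (p.1 - p.2.1, p.2.2))).aestronglyMeasurable
    · filter_upwards [hmem2, hmem3] with p hp2 hp3
      by_cases hp : p ∈ {p : ℝ × ℝ × E4 | p.2.1 ≤ p.1}
      · rw [indicator_of_mem hp]
        have hp' : p.2.1 ≤ p.1 := hp
        exact hdec _ (by rw [abs_of_nonneg (by linarith)]; linarith [hp2.2, hp3.1]) _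
      · rw [indicator_of_notMem hp, norm_zero]
        exact mul_nonneg hC (wt_pos _).le
  have hc : ∀ᵐ σ ∂μ, ∫ τ in t₀..σ, ∫ x, N τ x * freeEvolution (σ - τ) (slap φ) x =
      ∫ q, H σ q ∂(μ.prod volume) := by
    filter_upwards [hmem, hHint.prod_right_ae] with σ hσ hint
    rw [integral_prod (H σ) hint, intervalIntegral.integral_of_le hσ.1.le]
    have e1 : ∀ τ, ∫ x, H σ (τ, x) = (Iic σ).indicator
        (fun τ => ∫ x, N τ x * freeEvolution (σ - τ) (slap φ) x) τ := by
      intro τ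
      by_cases hτ : τ ∈ Iic σ
      · rw [indicator_of_mem hτ]
        refine integral_congr_ae (Eventually.of_forall fun x => ?_)
        simp only [hH]
        rw [indicator_of_mem (show (σ, τ, x) ∈ {p : ℝ × ℝ × E4 | p.2.1 ≤ p.1} from hτ)]
      · rw [indicator_of_notMem hτ]
        have : ∀ x, H σ (τ, x) = 0 := by
          intro x
          simp only [hH]
          rw [indicator_of_notMem (show (σ, τ, x) ∉ {p : ℝ × ℝ × E4 | p.2.1 ≤ p.1} from hτ),
            mul_zero]
        simp [this]
    simp only [e1]
    rw [hμ, setIntegral_indicator measurableSet_Iic]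
    congr 2
    ext τ
    simp only [mem_inter_iff, mem_Ioc, mem_Iic]
    exact ⟨fun h => ⟨⟨h.1, h.2.trans hσ.2⟩, h.2⟩, fun h => ⟨h.1.1, h.2⟩⟩
  have hB : ∫ σ, Complex.I * (∫ q, H σ q ∂(μ.prod volume)) ∂μ =
      (∫ q, N q.1 q.2 * freeEvolution (t₁ - q.1) φ q.2 ∂(μ.prod volume)) -
        ∫ q, N q.1 q.2 * φ q.2 ∂(μ.prod volume) := by
    rw [integral_const_mul, integral_integral_swap hHint, ← integral_const_mul,
      ← integral_sub hNφ' hNφ]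
    refine integral_congr_ae ?_
    filter_upwards [hmemp] with q hq
    have e2 : ∀ σ, H σ q = N q.1 q.2 * (Ici q.1).indicator
        (fun σ => freeEvolution (σ - q.1) (slap φ) q.2) σ := by
      intro σ
      simp only [hH]
      congr 1
    simp only [e2]
    rw [integral_const_mul, hμ, setIntegral_indicator measurableSet_Ici]
    have e3 : ∫ σ in Ioc t₀ t₁ ∩ Ici q.1, freeEvolution (σ - q.1) (slap φ) q.2 =
        ∫ σ in Ioc q.1 t₁, freeEvolution (σ - q.1) (slap φ) q.2 := by
      rw [← integral_Icc_eq_integral_Ioc]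
      congr 2
      ext σ
      simp only [mem_inter_iff, mem_Ioc, mem_Ici, mem_Icc]
      exact ⟨fun h => ⟨h.2, h.1.2⟩, fun h => ⟨⟨hq.1.trans_le h.1, h.2⟩, h.1⟩⟩
    have e4 := integral_Ioc_freeEvolution_slap φ q.2 q.1 hq.2
    rw [sub_self, freeEvolution_zero, integral_const_mul] at e4
    rw [e3, mul_left_comm, e4]
    ring
  have hAi : Integrable (fun σ => ∫ x, u t₀ x * freeEvolution (σ - t₀) (slap φ) x) μ :=
    hAint.integral_prod_left
  have hBi : Integrable (fun σ => ∫ q, H σ q ∂(μ.prod volume)) μ := hHint.integral_prod_left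
  have hrep : (fun σ => ∫ x, u σ x * slap φ x) =ᵐ[μ] fun σ =>
      (∫ x, u t₀ x * freeEvolution (σ - t₀) (slap φ) x) -
        Complex.I * ∫ q, H σ q ∂(μ.prod volume) := by
    filter_upwards [hD, hc] with σ h1 h2
    rw [h1, h2]
  have hui : Integrable (fun σ => ∫ x, u σ x * slap φ x) μ :=
    (hAi.sub (hBi.const_mul _)).congr hrep.symm
  have hNi : Integrable (fun τ => ∫ x, N τ x * φ x) μ := hNφ.integral_prod_left
  refine ⟨hui, hNi, ?_⟩
  rw [integral_sub (hui.const_mul _) (hNi.const_mul _), integral_const_mul, integral_congr_ae hrep,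
    integral_sub hAi (hBi.const_mul _), integral_const_mul, integral_const_mul]
  rw [integral_const_mul] at hA hB
  rw [integral_prod _ hNφ, integral_prod _ hNφ'] at hB
  rw [hD1, intervalIntegral.integral_of_le h01]
  linear_combination -hA + Complex.I * hB

/-! ### Divergence identities for radial vector fields -/

theorem hasDerivAt_line {F : Type*} [NormedAddCommGroup F] [NormedSpace ℝ F] {f : E4 → F} {x : E4}
    (hf : DifferentiableAt ℝ f x) (k : Fin 4) :
    HasDerivAt (fun t : ℝ => f (x + t • dir k)) (pd k f x) 0 :=
  hf.hasFDerivAt.hasLineDerivAt (dir k)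

theorem pd_eq_of_hasDerivAt {F : Type*} [NormedAddCommGroup F] [NormedSpace ℝ F] {f : E4 → F}
    {x : E4} (hf : DifferentiableAt ℝ f x) {k : Fin 4} {f' : F}
    (h : HasDerivAt (fun t : ℝ => f (x + t • dir k)) f' 0) : pd k f x = f' :=
  (hasDerivAt_line hf k).unique h

/-- Kronecker's delta, the derivative of the `j`-th coordinate in direction `k`. -/
def kron (k j : Fin 4) : ℝ := if j = k then 1 else 0

theorem dir_apply (k j : Fin 4) : dir k j = kron k j := by
  simp [dir, kron]

theorem hasDerivAt_coord (x : E4) (k j : Fin 4) :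
    HasDerivAt (fun t : ℝ => (x + t • dir k) j) (kron k j) 0 := by
  have : HasDerivAt (fun t : ℝ => x j + t * kron k j) (kron k j) 0 := by
    simpa using ((hasDerivAt_id (0 : ℝ)).mul_const (kron k j)).const_add (x j)
  refine this.congr_of_eventuallyEq (Eventually.of_forall fun t => ?_)
  simp [dir_apply]

theorem integral_pd_eq_zero {f : E4 → ℝ} (hf : ContDiff ℝ 1 f) (hc : HasCompactSupport f)
    (k : Fin 4) : ∫ x, pd k f x = 0 := by
  have hi : Integrable f := hf.continuous.integrable_of_hasCompactSupport hc
  have hi' : Integrable fun x => pd k f x :=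
    ((hf.continuous_fderiv one_ne_zero).clm_apply continuous_const).integrable_of_hasCompactSupport
      ((hc.fderiv ℝ).mono fun x hx => by
        simp only [Function.mem_support, ne_eq] at hx ⊢
        intro h; exact hx (by simp [h]))
  have := integral_mul_fderiv_eq_neg_fderiv_mul_of_integrable (μ := (volume : Measure E4))
    (f := fun _ => (1 : ℝ)) (g := f) (v := dir k) (by simp) (by simpa using! hi') (by simpa using hi)
    (fun _ _ => differentiableAt_const _) (fun x _ => hf.differentiable one_ne_zero x)
  simpa using! this

/-- The integral of a divergence of a compactly supported vector field vanishes, for a divergence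
given in the form `A - B`. -/
theorem integral_eq_of_divergence {Y : Fin 4 → E4 → ℝ} (hY : ∀ k, ContDiff ℝ 1 (Y k))
    (hc : ∀ k, HasCompactSupport (Y k)) {A B : E4 → ℝ} (hA : Integrable A) (hB : Integrable B)
    (h : ∀ x, ∑ k, pd k (Y k) x = A x - B x) : ∫ x, A x = ∫ x, B x := by
  have h1 : ∫ x, ∑ k, pd k (Y k) x = 0 := by
    rw [integral_finsetSum]
    · simp [integral_pd_eq_zero (hY _) (hc _)]
    · intro k _
      exact (((hY k).continuous_fderiv one_ne_zero).clm_apply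
        continuous_const).integrable_of_hasCompactSupport
        (((hc k).fderiv ℝ).mono fun x hx => by
          simp only [Function.mem_support, ne_eq] at hx ⊢
          intro h; exact hx (by simp [h]))
  simp only [h] at h1
  rw [integral_sub hA hB] at h1
  linarith

/-- A radial weight `p₀` on `ℝ⁴`, supported in the ball of radius `2R`, with its derivatives
`p₁, p₂, p₃` with respect to `|x|²`. The vector field of the Morawetz action is `p₀(x) x`. -/
structure RadialWeight (R : ℝ) (p : Fin 4 → E4 → ℝ) : Prop where
  contDiff : ∀ i, ContDiff ℝ 1 (p i)
  pd_zero : ∀ k x, pd k (p 0) x = 2 * x k * p 1 x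
  pd_one : ∀ k x, pd k (p 1) x = 2 * x k * p 2 x
  pd_two : ∀ k x, pd k (p 2) x = 2 * x k * p 3 x
  support : ∀ i x, 2 * R ≤ ‖x‖ → p i x = 0

/-- The divergence of the vector field `p₀(x) x`. -/
def divW (p : Fin 4 → E4 → ℝ) (x : E4) : ℝ := 4 * p 0 x + 2 * ‖x‖ ^ 2 * p 1 x

/-- The Laplacian of the divergence of the vector field `p₀(x) x`. -/
def lapDivW (p : Fin 4 → E4 → ℝ) (x : E4) : ℝ :=
  48 * p 1 x + 48 * ‖x‖ ^ 2 * p 2 x + 8 * (‖x‖ ^ 2) ^ 2 * p 3 x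

/-- The expression `2X·∇f + (div X) f` for `X = p₀(x) x`. -/
def multW {F : Type*} [NormedAddCommGroup F] [NormedSpace ℝ F] (p : Fin 4 → E4 → ℝ) (f : E4 → F)
    (x : E4) : F := (2 * p 0 x) • (∑ j, x j • pd j f x) + divW p x • f x

section
variable {R : ℝ} {p : Fin 4 → E4 → ℝ}

theorem RadialWeight.hasCompactSupport (hp : RadialWeight R p) {F : Type*} [NormedAddCommGroup F]
    {f : E4 → F} (h : ∀ x, (∀ i, p i x = 0) → f x = 0) : HasCompactSupport f := by
  refine HasCompactSupport.intro (isCompact_closedBall (0 : E4) (2 * R)) fun x hx => ?_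
  refine h x fun i => hp.support i x ?_
  rw [mem_closedBall_zero_iff, not_le] at hx
  exact hx.le

theorem contDiff_coord (j : Fin 4) {n : WithTop ℕ∞} : ContDiff ℝ n fun x : E4 => x j :=
  contDiff_piLp_apply (p := 2)

theorem contDiff_pd {F : Type*} [NormedAddCommGroup F] [NormedSpace ℝ F] {f : E4 → F}
    (hf : ContDiff ℝ ((⊤ : ℕ∞) : WithTop ℕ∞) f) (k : Fin 4) :
    ContDiff ℝ ((⊤ : ℕ∞) : WithTop ℕ∞) (pd k f) :=
  (hf.fderiv_right (m := ((⊤ : ℕ∞) : WithTop ℕ∞)) (by simp)).clm_apply contDiff_const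

theorem pd_comm {F : Type*} [NormedAddCommGroup F] [NormedSpace ℝ F] {f : E4 → F}
    (hf : ContDiff ℝ ((⊤ : ℕ∞) : WithTop ℕ∞) f) (j k : Fin 4) (x : E4) :
    pd j (pd k f) x = pd k (pd j f) x := by
  have hd : DifferentiableAt ℝ (fderiv ℝ f) x :=
    ((hf.fderiv_right (m := ((⊤ : ℕ∞) : WithTop ℕ∞)) (by simp)).differentiable (by simp)) x
  have h1 : ∀ i l, pd i (pd l f) x = fderiv ℝ (fderiv ℝ f) x (dir i) (dir l) := by
    intro i l
    have : pd l f = fun y => fderiv ℝ f y (dir l) := rfl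
    rw [pd, this, fderiv_clm_apply hd (differentiableAt_const _)]
    simp
  rw [h1, h1]
  exact (hf.contDiffAt.isSymmSndFDerivAt (by
    simpa using WithTop.coe_le_coe.2 (le_top (a := (2 : ℕ∞))))).eq (dir j) (dir k)

theorem RadialWeight.contDiff_divW (hp : RadialWeight R p) : ContDiff ℝ 1 (divW p) := by
  have h := contDiff_norm_sq ℝ (E := E4) (n := 1)
  exact (contDiff_const.mul (hp.contDiff 0)).add ((contDiff_const.mul h).mul (hp.contDiff 1))

/-- The integrated form of `Δa (2X·∇a + (div X) a)` for real functions. -/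
theorem integral_lap_mul_multW (hp : RadialWeight R p) {a : E4 → ℝ}
    (ha : ContDiff ℝ ((⊤ : ℕ∞) : WithTop ℕ∞) a) :
    ∫ x, (∑ k, pd k (pd k a) x) * multW p a x =
      ∫ x, (lapDivW p x / 2 * a x ^ 2 - (2 * p 0 x * ∑ j, pd j a x ^ 2 +
        4 * p 1 x * (∑ j, x j * pd j a x) ^ 2)) := by
  have hA : ∀ j, ContDiff ℝ 1 (pd j a) := fun j => (contDiff_pd ha j).of_le (by exact_mod_cast le_top)
  have hA2 : ∀ j k, Continuous (pd k (pd j a)) := fun j k => (contDiff_pd (contDiff_pd ha j) k).continuous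
  have ha1 : ContDiff ℝ 1 a := ha.of_le (by exact_mod_cast le_top)
  have hc := fun j : Fin 4 => contDiff_coord j (n := 1)
  have hnorm := contDiff_norm_sq ℝ (E := E4) (n := 1)
  have hp0 := hp.contDiff 0
  have hp1 := hp.contDiff 1
  have hp2 := hp.contDiff 2
  have hp3 := hp.contDiff 3
  have hdiv := hp.contDiff_divW
  have hmult : ContDiff ℝ 1 (multW p a) := by
    unfold multW
    exact ((contDiff_const.mul hp0).smul (ContDiff.sum fun j _ => (hc j).smul (hA j))).add
      (hdiv.smul ha1)
  have hY : ∀ k, ContDiff ℝ 1 fun x => pd k a x * multW p a x -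
      p 0 x * x k * (∑ j, pd j a x ^ 2) - x k * (6 * p 1 x + 2 * ‖x‖ ^ 2 * p 2 x) * a x ^ 2 := by
    intro k
    refine ContDiff.sub (((hA k).mul hmult).sub ((hp0.mul (hc k)).mul
      (ContDiff.sum fun j _ => (hA j).pow 2))) (((hc k).mul ?_).mul (ha1.pow 2))
    exact (contDiff_const.mul hp1).add ((contDiff_const.mul hnorm).mul hp2)
  refine integral_eq_of_divergence hY (fun k => ?_) ?_ ?_ fun x => ?_
  · exact hp.hasCompactSupport fun x hx => by simp [multW, divW, hx]
  · refine Continuous.integrable_of_hasCompactSupport ?_ (hp.hasCompactSupport fun x hx => by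
      simp [multW, divW, hx])
    exact (continuous_finsetSum _ fun k _ => hA2 k k).mul hmult.continuous
  · refine Continuous.integrable_of_hasCompactSupport ?_ (hp.hasCompactSupport fun x hx => by
      simp [lapDivW, hx])
    have h0 := hp0.continuous
    have h1 := hp1.continuous
    have h2 := hp2.continuous
    have h3 := hp3.continuous
    have h4 := ha1.continuous
    have h5 := fun j => (hA j).continuous
    have h6 := fun j => (hc j).continuous
    unfold lapDivW
    fun_prop
  · have hk : ∀ k, pd k (fun x => pd k a x * multW p a x -
        p 0 x * x k * (∑ j, pd j a x ^ 2) - x k * (6 * p 1 x + 2 * ‖x‖ ^ 2 * p 2 x) * a x ^ 2) x =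
        pd k (pd k a) x * multW p a x + pd k a x *
          (4 * x k * p 1 x * (∑ j, x j * pd j a x) +
            2 * p 0 x * (pd k a x + ∑ j, x j * pd k (pd j a) x) +
            (12 * x k * p 1 x + 4 * x k * ‖x‖ ^ 2 * p 2 x) * a x + divW p x * pd k a x) -
        ((2 * x k * p 1 x * x k + p 0 x) * (∑ j, pd j a x ^ 2) +
          p 0 x * x k * (∑ j, 2 * pd j a x * pd k (pd j a) x)) -
        ((6 * p 1 x + 2 * ‖x‖ ^ 2 * p 2 x + x k * (12 * x k * p 2 x + 4 * x k * p 2 x +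
          4 * x k * ‖x‖ ^ 2 * p 3 x)) * a x ^ 2 +
          x k * (6 * p 1 x + 2 * ‖x‖ ^ 2 * p 2 x) * (2 * a x * pd k a x)) := by
      intro k
      have dn : HasDerivAt (fun t : ℝ => ‖x + t • dir k‖ ^ 2) (2 * x k) 0 := by
        simp only [norm_sq_eq]
        have := HasDerivAt.fun_sum (u := Finset.univ) fun j (_ : j ∈ Finset.univ) =>
          (hasDerivAt_coord x k j).pow 2
        refine this.congr_deriv ?_
        simp [kron]
      have dcoord := fun j => hasDerivAt_coord x k j
      have d0 := hasDerivAt_line (hp0.differentiable one_ne_zero x) k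
      have d1 := hasDerivAt_line (hp1.differentiable one_ne_zero x) k
      have d2 := hasDerivAt_line (hp2.differentiable one_ne_zero x) k
      have da := hasDerivAt_line (ha1.differentiable one_ne_zero x) k
      have dA := fun j => hasDerivAt_line ((hA j).differentiable one_ne_zero x) k
      rw [hp.pd_zero] at d0
      rw [hp.pd_one] at d1
      rw [hp.pd_two] at d2
      have dsum := HasDerivAt.fun_sum (u := Finset.univ) fun j (_ : j ∈ Finset.univ) =>
        (dcoord j).mul (dA j)
      replace dsum := dsum.congr_deriv (g' := pd k a x + ∑ j, x j * pd k (pd j a) x) (by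
        simp [kron, Finset.sum_add_distrib])
      have dsq := HasDerivAt.fun_sum (u := Finset.univ) fun j (_ : j ∈ Finset.univ) => (dA j).pow 2
      replace dsq := dsq.congr_deriv (g' := ∑ j, 2 * pd j a x * pd k (pd j a) x) (by simp)
      have hkk : kron k k = 1 := by simp [kron]
      have ddiv := (d0.const_mul 4).add ((dn.const_mul 2).mul d1)
      have dmult := ((d0.const_mul 2).mul dsum).add (ddiv.mul da)
      have dY := (((dA k).mul dmult).sub ((d0.mul (dcoord k)).mul dsq)).sub
        (((dcoord k).mul ((d1.const_mul 6).add ((dn.const_mul 2).mul d2))).mul (da.pow 2))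
      refine pd_eq_of_hasDerivAt ((hY k).differentiable one_ne_zero x) (dY.congr_deriv ?_)
      simp only [Pi.mul_apply, zero_smul, add_zero, hkk, Pi.add_apply, Pi.pow_apply, Nat.cast_ofNat,
        divW, multW, smul_eq_mul, Nat.add_one_sub_one, pow_one]
      ring
    rw [Finset.sum_congr rfl fun k _ => hk k]
    simp only [Fin.sum_univ_four, multW, divW, lapDivW, smul_eq_mul]
    rw [pd_comm ha 1 0, pd_comm ha 2 0, pd_comm ha 3 0, pd_comm ha 2 1, pd_comm ha 3 1,
      pd_comm ha 3 2, norm_sq_eq x, Fin.sum_univ_four]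
    ring

theorem pd_re {f : E4 → ℂ} {x : E4} (hf : DifferentiableAt ℝ f x) (k : Fin 4) :
    pd k (fun y => (f y).re) x = (pd k f x).re :=
  pd_eq_of_hasDerivAt (Complex.reCLM.differentiableAt.comp x hf)
    (Complex.reCLM.hasFDerivAt.comp_hasDerivAt (0 : ℝ) (hasDerivAt_line hf k))

theorem pd_im {f : E4 → ℂ} {x : E4} (hf : DifferentiableAt ℝ f x) (k : Fin 4) :
    pd k (fun y => (f y).im) x = (pd k f x).im :=
  pd_eq_of_hasDerivAt (Complex.imCLM.differentiableAt.comp x hf)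
    (Complex.imCLM.hasFDerivAt.comp_hasDerivAt (0 : ℝ) (hasDerivAt_line hf k))

theorem continuous_multW (hp : RadialWeight R p) {f : E4 → ℂ}
    (hf : ContDiff ℝ ((⊤ : ℕ∞) : WithTop ℕ∞) f) : Continuous (multW p f) := by
  have h1 := fun j => (contDiff_pd hf j).continuous
  have h2 := fun j => (contDiff_coord j (n := 1)).continuous
  have h3 := (hp.contDiff 0).continuous
  have h4 := hp.contDiff_divW.continuous
  have h5 := hf.continuous
  unfold multW
  fun_prop

theorem integral_inner_lap_multW (hp : RadialWeight R p) {v : E4 → ℂ}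
    (hv : ContDiff ℝ ((⊤ : ℕ∞) : WithTop ℕ∞) v) :
    ∫ x, inner ℝ (∑ k, pd k (pd k v) x) (multW p v x) =
      ∫ x, (lapDivW p x / 2 * ‖v x‖ ^ 2 - (2 * p 0 x * ∑ j, ‖pd j v x‖ ^ 2 +
        4 * p 1 x * ‖∑ j, x j • pd j v x‖ ^ 2)) := by
  have hd : ∀ x, DifferentiableAt ℝ v x := hv.differentiable (by simp)
  have hd1 : ∀ j x, DifferentiableAt ℝ (pd j v) x := fun j => (contDiff_pd hv j).differentiable (by simp)
  have hre : ContDiff ℝ ((⊤ : ℕ∞) : WithTop ℕ∞) fun x => (v x).re := Complex.reCLM.contDiff.comp hv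
  have him : ContDiff ℝ ((⊤ : ℕ∞) : WithTop ℕ∞) fun x => (v x).im := Complex.imCLM.contDiff.comp hv
  have e1 : ∀ k, pd k (fun y => (v y).re) = fun x => (pd k v x).re := fun k => funext fun x =>
    pd_re (hd x) k
  have e2 : ∀ k, pd k (fun y => (v y).im) = fun x => (pd k v x).im := fun k => funext fun x =>
    pd_im (hd x) k
  have e3 : ∀ k x, pd k (fun y => (pd k v y).re) x = (pd k (pd k v) x).re := fun k x =>
    pd_re (hd1 k x) k
  have e4 : ∀ k x, pd k (fun y => (pd k v y).im) x = (pd k (pd k v) x).im := fun k x =>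
    pd_im (hd1 k x) k
  have I1 := integral_lap_mul_multW hp hre
  have I2 := integral_lap_mul_multW hp him
  have hc0 := (hp.contDiff 0).continuous
  have hc1 := (hp.contDiff 1).continuous
  have hc2 := (hp.contDiff 2).continuous
  have hc3 := (hp.contDiff 3).continuous
  have hcv := hv.continuous
  have hcd := hp.contDiff_divW.continuous
  have hcp := fun j => (contDiff_pd hv j).continuous
  have hcpp := fun j => (contDiff_pd (contDiff_pd hv j) j).continuous
  have hcc := fun j => (contDiff_coord j (n := 1)).continuous
  simp only [multW, e1, e2, e3, e4] at I1 I2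
  have hcr := Complex.continuous_re
  have hci := Complex.continuous_im
  rw [← sub_eq_zero] at I1 I2 ⊢
  rw [← integral_sub] at I1 I2 ⊢
  · rw [← add_zero (0 : ℝ)]
    nth_rewrite 1 [← I1]
    rw [← I2, ← integral_add]
    · refine integral_congr_ae (Eventually.of_forall fun x => ?_)
      simp only [multW, Complex.inner, ← Complex.normSq_eq_norm_sq, Complex.normSq_apply,
        Fin.sum_univ_four, Complex.add_re, Complex.add_im, Complex.mul_re, Complex.conj_re,
        Complex.conj_im, Complex.real_smul, Complex.ofReal_re, Complex.ofReal_im, Complex.mul_im,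
        smul_eq_mul]
      ring
    all_goals
      refine Continuous.integrable_of_hasCompactSupport ?_ (hp.hasCompactSupport fun x hx => by
        simp [divW, lapDivW, hx])
      unfold lapDivW
      fun_prop
  all_goals
    refine Continuous.integrable_of_hasCompactSupport ?_ (hp.hasCompactSupport fun x hx => by
      simp [multW, divW, lapDivW, hx])
    first
    | unfold multW; fun_prop
    | unfold lapDivW; fun_prop
    | fun_prop

/-- The momentum density `X·Im(v̄ ∇v)` of the field `X = p₀(x) x`. -/
def momentum (p : Fin 4 → E4 → ℝ) (v w : E4 → ℂ) (x : E4) : ℝ :=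
  ∑ j, p 0 x * x j * ((starRingEnd ℂ) (v x) * pd j w x).im

/-- The derivative of the Morawetz action in the direction `w`. -/
theorem integral_momentum_add (hp : RadialWeight R p) {v w : E4 → ℂ}
    (hv : ContDiff ℝ ((⊤ : ℕ∞) : WithTop ℕ∞) v) (hw : ContDiff ℝ ((⊤ : ℕ∞) : WithTop ℕ∞) w) :
    ∫ x, (momentum p w v x + momentum p v w x) =
      ∫ x, ((starRingEnd ℂ) (w x) * multW p v x).im := by
  have hp0 := hp.contDiff 0
  have hc := fun j : Fin 4 => contDiff_coord j (n := 1)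
  have hv1 : ContDiff ℝ 1 v := hv.of_le (by exact_mod_cast le_top)
  have hw1 : ContDiff ℝ 1 w := hw.of_le (by exact_mod_cast le_top)
  have hY : ∀ k : Fin 4, ContDiff ℝ 1 fun x => p 0 x * x k *
      ((v x).re * (w x).im - (v x).im * (w x).re) := by
    intro k
    have h1 : ContDiff ℝ 1 fun x => (v x).re := Complex.reCLM.contDiff.comp hv1
    have h2 : ContDiff ℝ 1 fun x => (v x).im := Complex.imCLM.contDiff.comp hv1
    have h3 : ContDiff ℝ 1 fun x => (w x).re := Complex.reCLM.contDiff.comp hw1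
    have h4 : ContDiff ℝ 1 fun x => (w x).im := Complex.imCLM.contDiff.comp hw1
    have h5 := hc k
    fun_prop
  have c1 := fun j => (contDiff_pd hv j).continuous
  have c2 := fun j => (contDiff_pd hw j).continuous
  have c3 := fun j => (hc j).continuous
  have c4 := hp0.continuous
  have c5 := hv.continuous
  have c6 := hw.continuous
  have c7 := Complex.continuous_im
  have c8 := Complex.continuous_conj
  have c9 := continuous_multW hp hv
  refine integral_eq_of_divergence hY (fun k => ?_) ?_ ?_ fun x => ?_
  · exact hp.hasCompactSupport fun x hx => by simp [hx]
  · refine Continuous.integrable_of_hasCompactSupport ?_ (hp.hasCompactSupport fun x hx => by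
      simp [momentum, hx])
    unfold momentum
    fun_prop
  · refine Continuous.integrable_of_hasCompactSupport ?_ (hp.hasCompactSupport fun x hx => by
      simp [multW, divW, hx])
    fun_prop
  · have hk : ∀ k, pd k (fun x => p 0 x * x k *
        ((v x).re * (w x).im - (v x).im * (w x).re)) x =
        (2 * x k * p 1 x * x k + p 0 x) * ((v x).re * (w x).im - (v x).im * (w x).re) +
        p 0 x * x k * ((pd k v x).re * (w x).im + (v x).re * (pd k w x).im -
          ((pd k v x).im * (w x).re + (v x).im * (pd k w x).re)) := by
      intro k
      have dv := hasDerivAt_line (hv1.differentiable one_ne_zero x) k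
      have dw := hasDerivAt_line (hw1.differentiable one_ne_zero x) k
      have d0 := hasDerivAt_line (hp0.differentiable one_ne_zero x) k
      rw [hp.pd_zero] at d0
      have dc := hasDerivAt_coord x k k
      have d1 := Complex.reCLM.hasFDerivAt.comp_hasDerivAt (0 : ℝ) dv
      have d2 := Complex.imCLM.hasFDerivAt.comp_hasDerivAt (0 : ℝ) dv
      have d3 := Complex.reCLM.hasFDerivAt.comp_hasDerivAt (0 : ℝ) dw
      have d4 := Complex.imCLM.hasFDerivAt.comp_hasDerivAt (0 : ℝ) dw
      have dY := (d0.mul dc).mul ((d1.mul d4).sub (d2.mul d3))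
      refine pd_eq_of_hasDerivAt ((hY k).differentiable one_ne_zero x) (dY.congr_deriv ?_)
      have hkk : kron k k = 1 := by simp [kron]
      simp only [Pi.mul_apply, Pi.sub_apply, Function.comp_apply, zero_smul, add_zero, hkk,
        Complex.reCLM_apply, Complex.imCLM_apply]
      ring
    rw [Finset.sum_congr rfl fun k _ => hk k]
    simp only [momentum, multW, divW, norm_sq_eq x, Fin.sum_univ_four, Complex.add_re, Complex.add_im,
      Complex.mul_re, Complex.conj_re, Complex.conj_im, Complex.real_smul, Complex.ofReal_re,
      Complex.ofReal_im, Complex.mul_im]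
    ring

/-- The virial identity: the derivative of the Morawetz action along `v' = i(Δv - F)`. -/
theorem integral_momentum_schrodinger (hp : RadialWeight R p) {v F : E4 → ℂ}
    (hv : ContDiff ℝ ((⊤ : ℕ∞) : WithTop ℕ∞) v) (hF : ContDiff ℝ ((⊤ : ℕ∞) : WithTop ℕ∞) F) :
    ∫ x, (momentum p (fun y => Complex.I * ((∑ k, pd k (pd k v) y) - F y)) v x +
        momentum p v (fun y => Complex.I * ((∑ k, pd k (pd k v) y) - F y)) x) =
      (∫ x, (2 * p 0 x * ∑ j, ‖pd j v x‖ ^ 2 + 4 * p 1 x * ‖∑ j, x j • pd j v x‖ ^ 2 -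
        lapDivW p x / 2 * ‖v x‖ ^ 2)) + ∫ x, inner ℝ (F x) (multW p v x) := by
  have hlap : ContDiff ℝ ((⊤ : ℕ∞) : WithTop ℕ∞) fun y => ∑ k, pd k (pd k v) y :=
    ContDiff.sum fun k _ => contDiff_pd (contDiff_pd hv k) k
  have hw : ContDiff ℝ ((⊤ : ℕ∞) : WithTop ℕ∞)
      fun y => Complex.I * ((∑ k, pd k (pd k v) y) - F y) := contDiff_const.mul (hlap.sub hF)
  have c9 := continuous_multW hp hv
  have cF := hF.continuous
  have cl := hlap.continuous
  rw [integral_momentum_add hp hv hw]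
  have e : ∀ x, ((starRingEnd ℂ) (Complex.I * ((∑ k, pd k (pd k v) x) - F x)) * multW p v x).im =
      inner ℝ (F x) (multW p v x) - inner ℝ (∑ k, pd k (pd k v) x) (multW p v x) := by
    intro x
    simp only [Complex.inner, map_mul, map_sub, Complex.conj_I, Complex.mul_im, Complex.mul_re,
      Complex.sub_re, Complex.sub_im, Complex.neg_re, Complex.neg_im, Complex.I_re, Complex.I_im]
    ring
  simp only [e]
  rw [integral_sub, integral_inner_lap_multW hp hv, sub_eq_add_neg, ← integral_neg, add_comm]
  · congr 1
    refine integral_congr_ae (Eventually.of_forall fun x => ?_)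
    simp only
    ring
  all_goals
    refine Continuous.integrable_of_hasCompactSupport (by fun_prop) (hp.hasCompactSupport fun x hx => by
      simp [multW, divW, hx])

/-- The repulsive sign of the nonlinear term. Only the decay of the coefficient `(|x|² + η)^{-b/2}`
in `|x|` and `p₀ ≥ 0` matter. -/
theorem integral_inner_nonlinear_ge (hp : RadialWeight R p) (hp0 : ∀ x, 0 ≤ p 0 x) {v : E4 → ℂ}
    (hv : ContDiff ℝ ((⊤ : ℕ∞) : WithTop ℕ∞) v) {α b η : ℝ} (hα : 0 < α) (hb : 0 ≤ b) (hη : 0 < η) :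
    α / (α + 2) * ∫ x, (‖x‖ ^ 2 + η) ^ (-b / 2) * divW p x * ‖v x‖ ^ (α + 2) ≤
      ∫ x, inner ℝ (((‖x‖ ^ 2 + η) ^ (-b / 2) * ‖v x‖ ^ α) • v x) (multW p v x) := by
  have hv1 : ContDiff ℝ 1 v := hv.of_le (by exact_mod_cast le_top)
  have hpc := hp.contDiff 0
  have hc := fun j : Fin 4 => contDiff_coord j (n := 1)
  have hpos : ∀ x : E4, 0 < ‖x‖ ^ 2 + η := fun x => by positivity
  have hW : ∀ e : ℝ, ContDiff ℝ 1 fun x : E4 => (‖x‖ ^ 2 + η) ^ e := fun e =>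
    ((contDiff_norm_sq ℝ).add contDiff_const).rpow_const_of_ne fun x => (hpos x).ne'
  have hP : ContDiff ℝ 1 fun x => ‖v x‖ ^ (α + 2) := (contDiff_norm_rpow (by linarith)).comp hv1
  have hY : ∀ k : Fin 4, ContDiff ℝ 1 fun x => 2 / (α + 2) * ((‖x‖ ^ 2 + η) ^ (-b / 2) * (p 0 x * x k) *
      ‖v x‖ ^ (α + 2)) := fun k =>
    contDiff_const.mul (((hW _).mul (hpc.mul (hc k))).mul hP)
  have c1 := continuous_multW hp hv
  have c2 := (hW (-b / 2)).continuous
  have c3 := (hW (-b / 2 - 1)).continuous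
  have c4 := hP.continuous
  have c5 := hpc.continuous
  have c6 := hp.contDiff_divW.continuous
  have c7 := hv.continuous
  have c8 : Continuous fun x => ‖v x‖ ^ α := c7.norm.rpow_const fun x => Or.inr hα.le
  have iB1 : Integrable fun x => (‖x‖ ^ 2 + η) ^ (-b / 2) * divW p x * ‖v x‖ ^ (α + 2) :=
    Continuous.integrable_of_hasCompactSupport (by fun_prop) (hp.hasCompactSupport fun x hx => by
      simp [divW, hx])
  have iB2 : Integrable fun x => 2 * b / (α + 2) * (p 0 x * ‖x‖ ^ 2 *
      (‖x‖ ^ 2 + η) ^ (-b / 2 - 1) * ‖v x‖ ^ (α + 2)) :=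
    Continuous.integrable_of_hasCompactSupport (by fun_prop) (hp.hasCompactSupport fun x hx => by
      simp [hx])
  have key : ∫ x, inner ℝ (((‖x‖ ^ 2 + η) ^ (-b / 2) * ‖v x‖ ^ α) • v x) (multW p v x) =
      ∫ x, (α / (α + 2) * ((‖x‖ ^ 2 + η) ^ (-b / 2) * divW p x * ‖v x‖ ^ (α + 2)) +
        2 * b / (α + 2) * (p 0 x * ‖x‖ ^ 2 * (‖x‖ ^ 2 + η) ^ (-b / 2 - 1) * ‖v x‖ ^ (α + 2))) := by
    refine integral_eq_of_divergence hY (fun k => ?_) ?_ ((iB1.const_mul _).add iB2) fun x => ?_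
    · exact hp.hasCompactSupport fun x hx => by simp [hx]
    · exact Continuous.integrable_of_hasCompactSupport (by fun_prop) (hp.hasCompactSupport fun x hx => by
        simp [multW, divW, hx])
    · have hk : ∀ k, pd k (fun x => 2 / (α + 2) * ((‖x‖ ^ 2 + η) ^ (-b / 2) * (p 0 x * x k) *
          ‖v x‖ ^ (α + 2))) x = 2 / (α + 2) * (
          (-b / 2 * (‖x‖ ^ 2 + η) ^ (-b / 2 - 1) * (2 * x k) * (p 0 x * x k) +
            (‖x‖ ^ 2 + η) ^ (-b / 2) * (2 * x k * p 1 x * x k + p 0 x)) * ‖v x‖ ^ (α + 2) +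
          (‖x‖ ^ 2 + η) ^ (-b / 2) * (p 0 x * x k) *
            ((α + 2) * ‖v x‖ ^ α * inner ℝ (v x) (pd k v x))) := by
        intro k
        have dv := hasDerivAt_line (hv1.differentiable one_ne_zero x) k
        have d0 := hasDerivAt_line (hpc.differentiable one_ne_zero x) k
        rw [hp.pd_zero] at d0
        have dc := hasDerivAt_coord x k k
        have dn : HasDerivAt (fun t : ℝ => ‖x + t • dir k‖ ^ 2 + η) (2 * x k) 0 := by
          simp only [norm_sq_eq]
          have := HasDerivAt.fun_sum (u := Finset.univ) fun j (_ : j ∈ Finset.univ) =>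
            (hasDerivAt_coord x k j).pow 2
          refine (this.congr_deriv ?_).add_const η
          simp [kron]
        have dW := dn.rpow_const (p := -b / 2) (Or.inl (by simpa using (hpos x).ne'))
        have dP := (hasFDerivAt_norm_rpow (v (x + (0 : ℝ) • dir k))
          (show 1 < α + 2 by linarith)).comp_hasDerivAt (0 : ℝ) dv
        have dY := ((dW.mul (d0.mul dc)).mul dP).const_mul (2 / (α + 2))
        refine pd_eq_of_hasDerivAt ((hY k).differentiable one_ne_zero x) (dY.congr_deriv ?_)
        have hkk : kron k k = 1 := by simp [kron]
        simp only [Pi.mul_apply, Function.comp_apply, zero_smul, add_zero, hkk,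
          smul_apply, innerSL_apply_apply, smul_eq_mul,
          add_sub_cancel_right]
        ring
      rw [Finset.sum_congr rfl fun k _ => hk k]
      have hα2 : α + 2 ≠ 0 := by linarith
      have hPe : ‖v x‖ ^ (α + 2) = ‖v x‖ ^ α * ‖v x‖ ^ 2 := by
        rw [Real.rpow_add_of_nonneg (norm_nonneg _) hα.le (by norm_num), Real.rpow_two]
      simp only [multW, inner_add_right, inner_smul_right, inner_smul_left,
        real_inner_self_eq_norm_sq, RCLike.conj_to_real, hPe, Fin.sum_univ_four, divW, norm_sq_eq x]
      field_simp
      ring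
  rw [key, integral_add (iB1.const_mul _) iB2, integral_const_mul]
  refine le_add_of_nonneg_right (integral_nonneg fun x => ?_)
  have := hp0 x
  have := (hpos x).le
  simp only [Pi.zero_apply]
  positivity

end

/-! ### The Morawetz weight -/

/-- The derivatives of a smooth cutoff that is `1` on `(-∞, 2]` and `0` on `[3, ∞)`. -/
def cutoff (n : ℕ) : ℝ → ℝ := iteratedDeriv n fun r => Real.smoothTransition (3 - r)

theorem contDiff_smoothTransition_three_sub {m : ℕ∞} :
    ContDiff ℝ m fun r : ℝ => Real.smoothTransition (3 - r) :=
  Real.smoothTransition.contDiff.comp (contDiff_const.sub contDiff_id)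

theorem hasDerivAt_cutoff (n : ℕ) (r : ℝ) : HasDerivAt (cutoff n) (cutoff (n + 1) r) r := by
  have h := (contDiff_smoothTransition_three_sub (m := ⊤)).differentiable_iteratedDeriv n
    (by exact_mod_cast ENat.natCast_lt_top n)
  rw [cutoff, cutoff, iteratedDeriv_succ]
  exact (h r).hasDerivAt

theorem continuous_cutoff (n : ℕ) : Continuous (cutoff n) :=
  continuous_iff_continuousAt.2 fun r => (hasDerivAt_cutoff n r).continuousAt

theorem contDiff_cutoff (n : ℕ) : ContDiff ℝ 1 (cutoff n) := by
  rw [contDiff_one_iff_deriv, show deriv (cutoff n) = cutoff (n + 1) from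
    funext fun r => (hasDerivAt_cutoff n r).deriv]
  exact ⟨fun r => (hasDerivAt_cutoff n r).differentiableAt, continuous_cutoff _⟩

theorem cutoff_zero_apply (r : ℝ) : cutoff 0 r = Real.smoothTransition (3 - r) := by
  simp [cutoff]

theorem cutoff_succ_eq_zero (n : ℕ) {r : ℝ} (hr : r < 2) : cutoff (n + 1) r = 0 := by
  have h : (fun r : ℝ => Real.smoothTransition (3 - r)) =ᶠ[𝓝 r] fun _ => 1 := by
    filter_upwards [Iio_mem_nhds hr] with y hy
    exact Real.smoothTransition.one_of_one_le (by have := mem_Iio.1 hy; linarith)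
  rw [cutoff, (h.iteratedDeriv (n + 1)).eq_of_nhds, iteratedDeriv_const]
  simp

theorem cutoff_eq_zero (n : ℕ) {r : ℝ} (hr : 3 < r) : cutoff n r = 0 := by
  have h : (fun r : ℝ => Real.smoothTransition (3 - r)) =ᶠ[𝓝 r] fun _ => 0 := by
    filter_upwards [Ioi_mem_nhds hr] with y hy
    exact Real.smoothTransition.zero_of_nonpos (by have := mem_Ioi.1 hy; linarith)
  rw [cutoff, (h.iteratedDeriv n).eq_of_nhds, iteratedDeriv_const]
  simp

/-- The regularized inverse square root `(r + θ)^{-1/2}`. -/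
def invSqrt (θ r : ℝ) : ℝ := (√(r + θ))⁻¹

theorem hasDerivAt_invSqrt {θ r : ℝ} (h : 0 < r + θ) :
    HasDerivAt (invSqrt θ) (-(1 / 2) * invSqrt θ r ^ 3) r := by
  have := (((hasDerivAt_id r).add_const θ).sqrt h.ne').inv (Real.sqrt_pos.2 h).ne'
  refine this.congr_deriv ?_
  have h2 : √(r + θ) ≠ 0 := (Real.sqrt_pos.2 h).ne'
  simp only [id, invSqrt]
  field_simp

/-- The profile `χ(r) (r + θ)^{-1/2}` of the Morawetz weight and its first three derivatives. -/
def profile (θ : ℝ) : Fin 4 → ℝ → ℝ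
  | 0 => fun r => cutoff 0 r * invSqrt θ r
  | 1 => fun r => cutoff 1 r * invSqrt θ r - 1 / 2 * cutoff 0 r * invSqrt θ r ^ 3
  | 2 => fun r => cutoff 2 r * invSqrt θ r - cutoff 1 r * invSqrt θ r ^ 3 +
      3 / 4 * cutoff 0 r * invSqrt θ r ^ 5
  | 3 => fun r => cutoff 3 r * invSqrt θ r - 3 / 2 * cutoff 2 r * invSqrt θ r ^ 3 +
      9 / 4 * cutoff 1 r * invSqrt θ r ^ 5 - 15 / 8 * cutoff 0 r * invSqrt θ r ^ 7

theorem hasDerivAt_profile_zero {θ r : ℝ} (h : 0 < r + θ) :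
    HasDerivAt (profile θ 0) (profile θ 1 r) r := by
  refine ((hasDerivAt_cutoff 0 r).mul (hasDerivAt_invSqrt h)).congr_deriv ?_
  simp only [profile, zero_add]
  ring

theorem hasDerivAt_profile_one {θ r : ℝ} (h : 0 < r + θ) :
    HasDerivAt (profile θ 1) (profile θ 2 r) r := by
  have d := hasDerivAt_invSqrt h
  refine (((hasDerivAt_cutoff 1 r).mul d).sub
    (((hasDerivAt_cutoff 0 r).const_mul (1 / 2)).mul (d.pow 3))).congr_deriv ?_
  simp only [profile, zero_add, Nat.reduceAdd, Nat.cast_ofNat, Nat.add_one_sub_one, Pi.pow_apply]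
  ring

theorem hasDerivAt_profile_two {θ r : ℝ} (h : 0 < r + θ) :
    HasDerivAt (profile θ 2) (profile θ 3 r) r := by
  have d := hasDerivAt_invSqrt h
  refine ((((hasDerivAt_cutoff 2 r).mul d).sub ((hasDerivAt_cutoff 1 r).mul (d.pow 3))).add
    (((hasDerivAt_cutoff 0 r).const_mul (3 / 4)).mul (d.pow 5))).congr_deriv ?_
  simp only [profile, zero_add, Nat.reduceAdd, Nat.cast_ofNat, Nat.add_one_sub_one, Pi.pow_apply]
  ring

/-- The Morawetz weight `|x|⁻¹`, regularized at the origin at scale `√θ R` and cut off beyond the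
scale `R`, together with its derivatives with respect to `|x|²`. -/
def weight (R θ : ℝ) (i : Fin 4) (x : E4) : ℝ :=
  R⁻¹ ^ (1 + 2 * (i : ℕ)) * profile θ i (‖x‖ ^ 2 / R ^ 2)

section
variable {R θ : ℝ}

theorem contDiff_weight (hθ : 0 < θ) (i : Fin 4) : ContDiff ℝ 1 (weight R θ i) := by
  have h0 : ContDiff ℝ 1 fun x : E4 => ‖x‖ ^ 2 / R ^ 2 := (contDiff_norm_sq ℝ).div_const _
  have hpos : ∀ x : E4, 0 < ‖x‖ ^ 2 / R ^ 2 + θ := fun x => by positivity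
  have h1 : ContDiff ℝ 1 fun x : E4 => invSqrt θ (‖x‖ ^ 2 / R ^ 2) :=
    ((h0.add contDiff_const).sqrt fun x => (hpos x).ne').inv fun x => (Real.sqrt_pos.2 (hpos x)).ne'
  have h2 := fun n => (contDiff_cutoff n).comp h0
  have h3 : ContDiff ℝ 1 fun x : E4 => profile θ i (‖x‖ ^ 2 / R ^ 2) := by
    fin_cases i
    · exact (h2 0).mul h1
    · exact ((h2 1).mul h1).sub ((contDiff_const.mul (h2 0)).mul (h1.pow 3))
    · exact (((h2 2).mul h1).sub ((h2 1).mul (h1.pow 3))).add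
        ((contDiff_const.mul (h2 0)).mul (h1.pow 5))
    · exact ((((h2 3).mul h1).sub ((contDiff_const.mul (h2 2)).mul (h1.pow 3))).add
        ((contDiff_const.mul (h2 1)).mul (h1.pow 5))).sub ((contDiff_const.mul (h2 0)).mul (h1.pow 7))
  exact contDiff_const.mul h3

theorem pd_weight (hθ : 0 < θ) {i j : Fin 4} (hij : (j : ℕ) = i + 1) {x : E4}
    (h : HasDerivAt (profile θ i) (profile θ j (‖x‖ ^ 2 / R ^ 2)) (‖x‖ ^ 2 / R ^ 2)) (k : Fin 4) :
    pd k (weight R θ i) x = 2 * x k * weight R θ j x := by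
  refine pd_eq_of_hasDerivAt ((contDiff_weight hθ i).differentiable one_ne_zero x) ?_
  have dn : HasDerivAt (fun t : ℝ => ‖x + t • dir k‖ ^ 2 / R ^ 2) (2 * x k / R ^ 2) 0 := by
    simp only [norm_sq_eq]
    have := HasDerivAt.fun_sum (u := Finset.univ) fun j (_ : j ∈ Finset.univ) =>
      (hasDerivAt_coord x k j).pow 2
    refine (this.congr_deriv ?_).div_const _
    simp [kron]
  refine ((HasDerivAt.comp (h₂ := profile θ i) (0 : ℝ) (by simpa using h) dn).const_mul
    (R⁻¹ ^ (1 + 2 * (i : ℕ)))).congr_deriv ?_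
  simp only [weight, hij]
  ring

theorem radialWeight_weight (hR : 0 < R) (hθ : 0 < θ) : RadialWeight R (weight R θ) where
  contDiff := contDiff_weight hθ
  pd_zero k x := pd_weight hθ rfl (hasDerivAt_profile_zero (by positivity)) k
  pd_one k x := pd_weight hθ rfl (hasDerivAt_profile_one (by positivity)) k
  pd_two k x := pd_weight hθ rfl (hasDerivAt_profile_two (by positivity)) k
  support i x hx := by
    have h : 3 < ‖x‖ ^ 2 / R ^ 2 := by
      rw [lt_div_iff₀ (by positivity)]
      have := pow_le_pow_left₀ (by positivity) hx 2
      nlinarith [pow_pos hR 2]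
    have : profile θ i (‖x‖ ^ 2 / R ^ 2) = 0 := by
      fin_cases i <;> simp [profile, cutoff_eq_zero _ h]
    simp [weight, this]

theorem weight_zero_nonneg (hR : 0 < R) (x : E4) : 0 ≤ weight R θ 0 x := by
  have := Real.smoothTransition.nonneg (3 - ‖x‖ ^ 2 / R ^ 2)
  simp only [weight, profile, cutoff_zero_apply, invSqrt]
  positivity

theorem mul_invSqrt_sq {r : ℝ} (h : 0 < r + θ) : (r + θ) * invSqrt θ r ^ 2 = 1 := by
  rw [invSqrt, inv_pow, Real.sq_sqrt h.le, mul_inv_cancel₀ h.ne']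

theorem weight_zero_mul_norm_le (hR : 0 < R) (hθ : 0 < θ) (x : E4) :
    weight R θ 0 x * ‖x‖ ≤ 1 := by
  set r := ‖x‖ ^ 2 / R ^ 2 with hr
  have hpos : 0 < r + θ := by positivity
  have h1 := mul_invSqrt_sq hpos
  have hu : 0 < invSqrt θ r := by unfold invSqrt; positivity
  have h2 : invSqrt θ r * (‖x‖ / R) ≤ 1 := by
    rw [← sq_le_one_iff₀ (by positivity), mul_pow, div_pow, ← hr]
    nlinarith [pow_pos hu 2]
  have h3 := Real.smoothTransition.le_one (3 - r)
  have h4 := Real.smoothTransition.nonneg (3 - r)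
  simp only [weight, profile, cutoff_zero_apply, ← hr]
  calc _ = Real.smoothTransition (3 - r) * (invSqrt θ r * (‖x‖ / R)) := by
        simp only [Fin.val_zero, mul_zero, add_zero, pow_one]; ring
    _ ≤ 1 * 1 := mul_le_mul h3 h2 (by positivity) zero_le_one
    _ = 1 := one_mul 1

/-- The convexity of the weight in the ball of radius `R`, where the cutoff is `1`: the matrix
`∇(p₀(x) x)` is nonnegative, and `Δ div(p₀(x) x) ≤ 0`. The bound `div(p₀(x) x) ≥ 3 p₀` is what makes the
coefficient of the nonlinear term positive. -/
theorem weight_core (hR : 0 < R) (hθ : 0 < θ) {x : E4} (hx : ‖x‖ ≤ R) :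
    weight R θ 0 x = (√(‖x‖ ^ 2 + θ * R ^ 2))⁻¹ ∧ 3 * weight R θ 0 x ≤ divW (weight R θ) x ∧
      weight R θ 1 x ≤ 0 ∧ 0 ≤ weight R θ 0 x + 2 * ‖x‖ ^ 2 * weight R θ 1 x ∧
      lapDivW (weight R θ) x ≤ 0 := by
  set r := ‖x‖ ^ 2 / R ^ 2 with hr
  have hr0 : 0 ≤ r := by positivity
  have hpos : 0 < r + θ := by positivity
  have h1 := mul_invSqrt_sq hpos
  have hu : 0 < invSqrt θ r := by unfold invSqrt; positivity
  set z := invSqrt θ r with hz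
  have hr1 : r ≤ 1 := by
    rw [hr, div_le_one (by positivity)]
    exact pow_le_pow_left₀ (norm_nonneg _) hx 2
  have hr2 : r < 2 := by linarith
  have hxr : ‖x‖ ^ 2 = r * R ^ 2 := by rw [hr]; field_simp
  have hc0 : cutoff 0 r = 1 := by
    rw [cutoff_zero_apply]; exact Real.smoothTransition.one_of_one_le (by linarith)
  have hc1 := cutoff_succ_eq_zero 0 hr2
  have hc2 := cutoff_succ_eq_zero 1 hr2
  have hc3 := cutoff_succ_eq_zero 2 hr2
  simp only [Nat.reduceAdd, zero_add] at hc1 hc2 hc3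
  have e0 : weight R θ 0 x = R⁻¹ * z := by simp [weight, profile, ← hr, ← hz, hc0]
  have e1 : weight R θ 1 x = -(1 / 2) * R⁻¹ ^ 3 * z ^ 3 := by
    simp [weight, profile, ← hr, ← hz, hc0, hc1]; ring
  have e2 : weight R θ 2 x = 3 / 4 * R⁻¹ ^ 5 * z ^ 5 := by
    simp [weight, profile, ← hr, ← hz, hc0, hc1, hc2]; ring
  have e3 : weight R θ 3 x = -(15 / 8) * R⁻¹ ^ 7 * z ^ 7 := by
    simp [weight, profile, ← hr, ← hz, hc0, hc1, hc2, hc3]; ring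
  have hq : r * z ^ 2 ≤ 1 := by nlinarith [pow_pos hu 2]
  have hq0 : 0 ≤ r * z ^ 2 := by positivity
  have hRi : 0 < R⁻¹ := by positivity
  have hRz : 0 < R⁻¹ * z := by positivity
  refine ⟨?_, ?_, ?_, ?_, ?_⟩
  · rw [e0, hxr, show r * R ^ 2 + θ * R ^ 2 = (r + θ) * R ^ 2 by ring, Real.sqrt_mul hpos.le,
      Real.sqrt_sq hR.le, mul_inv, hz, invSqrt, mul_comm]
  · rw [divW, e0, e1, hxr]
    have : 4 * (R⁻¹ * z) + 2 * (r * R ^ 2) * (-(1 / 2) * R⁻¹ ^ 3 * z ^ 3) =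
        R⁻¹ * z * (4 - r * z ^ 2) := by field_simp; ring
    rw [this]
    nlinarith
  · rw [e1]
    have : 0 < R⁻¹ ^ 3 * z ^ 3 := by positivity
    nlinarith
  · rw [e0, e1, hxr]
    have : R⁻¹ * z + 2 * (r * R ^ 2) * (-(1 / 2) * R⁻¹ ^ 3 * z ^ 3) =
        R⁻¹ * z * (1 - r * z ^ 2) := by field_simp; ring
    rw [this]
    exact mul_nonneg hRz.le (by linarith)
  · rw [lapDivW, e1, e2, e3, hxr]
    have : 48 * (-(1 / 2) * R⁻¹ ^ 3 * z ^ 3) + 48 * (r * R ^ 2) * (3 / 4 * R⁻¹ ^ 5 * z ^ 5) +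
        8 * (r * R ^ 2) ^ 2 * (-(15 / 8) * R⁻¹ ^ 7 * z ^ 7) =
        -(R⁻¹ ^ 3 * z ^ 3 * (24 - 36 * (r * z ^ 2) + 15 * (r * z ^ 2) ^ 2)) := by field_simp; ring
    rw [this, Left.neg_nonpos_iff]
    refine mul_nonneg (by positivity) ?_
    nlinarith [sq_nonneg (5 * (r * z ^ 2) - 6)]

end

/-- Away from the origin the weight and its derivatives are bounded by the powers of `R` that
scaling predicts, uniformly in the regularization parameter `θ`. -/
theorem exists_weight_outer : ∃ K : ℝ, 0 < K ∧ ∀ R θ : ℝ, 0 < R → 0 < θ → θ ≤ 1 → ∀ x : E4,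
    R ≤ ‖x‖ → |weight R θ 0 x| ≤ K / R ∧ ‖x‖ ^ 2 * |weight R θ 1 x| ≤ K / R ∧
      |divW (weight R θ) x| ≤ K / R ∧ |lapDivW (weight R θ) x| ≤ K / R ^ 3 := by
  have hb : ∀ n, ∃ C, ∀ r ∈ Icc (1 : ℝ) 4, ‖cutoff n r‖ ≤ C := fun n =>
    isCompact_Icc.exists_bound_of_continuousOn (continuous_cutoff n).continuousOn
  choose C hC using hb
  set K := |C 0| + |C 1| + |C 2| + |C 3| + 1 with hK
  have hK0 : 0 < K := by positivity
  refine ⟨1568 * K, by positivity, fun R θ hR hθ hθ1 x hx => ?_⟩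
  set r := ‖x‖ ^ 2 / R ^ 2 with hr
  have hr1 : 1 ≤ r := by
    rw [hr, one_le_div (by positivity)]
    exact pow_le_pow_left₀ hR.le hx 2
  have hxr : ‖x‖ ^ 2 = r * R ^ 2 := by rw [hr]; field_simp
  rcases le_or_gt r 4 with hr4 | hr4
  · have hpos : 0 < r + θ := by positivity
    have h1 := mul_invSqrt_sq hpos
    have hu : 0 < invSqrt θ r := by unfold invSqrt; positivity
    have hu1 : invSqrt θ r ≤ 1 := by
      rw [← sq_le_one_iff₀ hu.le]
      nlinarith [pow_pos hu 2]
    set z := invSqrt θ r with hz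
    have b0 : |cutoff 0 r| ≤ K :=
      (hC 0 r ⟨hr1, hr4⟩).trans (by
        linarith [le_abs_self (C 0), abs_nonneg (C 1), abs_nonneg (C 2), abs_nonneg (C 3)])
    have b1 : |cutoff 1 r| ≤ K :=
      (hC 1 r ⟨hr1, hr4⟩).trans (by
        linarith [le_abs_self (C 1), abs_nonneg (C 0), abs_nonneg (C 2), abs_nonneg (C 3)])
    have b2 : |cutoff 2 r| ≤ K :=
      (hC 2 r ⟨hr1, hr4⟩).trans (by
        linarith [le_abs_self (C 2), abs_nonneg (C 0), abs_nonneg (C 1), abs_nonneg (C 3)])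
    have b3 : |cutoff 3 r| ≤ K :=
      (hC 3 r ⟨hr1, hr4⟩).trans (by
        linarith [le_abs_self (C 3), abs_nonneg (C 0), abs_nonneg (C 2), abs_nonneg (C 1)])
    have m : ∀ {c : ℝ} (n : ℕ), |c| ≤ K → |c * z ^ n| ≤ K := by
      intro c n hc
      rw [abs_mul, abs_of_pos (pow_pos hu n)]
      calc |c| * z ^ n ≤ K * 1 := mul_le_mul hc (pow_le_one₀ hu.le hu1) (by positivity) hK0.le
        _ = K := mul_one K
    have g0 : |profile θ 0 r| ≤ K := by simpa [profile, ← hz] using m 1 b0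
    have g1 : |profile θ 1 r| ≤ 2 * K := by
      have e1 := abs_le.1 (m 1 b1)
      have e2 := abs_le.1 (m 3 b0)
      simp only [profile, ← hz]
      rw [abs_le]
      constructor <;> linarith
    have g2 : |profile θ 2 r| ≤ 3 * K := by
      have e1 := abs_le.1 (m 1 b2)
      have e2 := abs_le.1 (m 3 b1)
      have e3 := abs_le.1 (m 5 b0)
      simp only [profile, ← hz]
      rw [abs_le]
      constructor <;> linarith
    have g3 : |profile θ 3 r| ≤ 7 * K := by
      have e1 := abs_le.1 (m 1 b3)
      have e2 := abs_le.1 (m 3 b2)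
      have e3 := abs_le.1 (m 5 b1)
      have e4 := abs_le.1 (m 7 b0)
      simp only [profile, ← hz]
      rw [abs_le]
      constructor <;> linarith
    have hRi : 0 < R⁻¹ := by positivity
    have e0 : weight R θ 0 x = R⁻¹ * profile θ 0 r := by simp [weight, ← hr]
    have e1 : ‖x‖ ^ 2 * weight R θ 1 x = R⁻¹ * (r * profile θ 1 r) := by
      simp only [weight, hxr, Fin.val_one, mul_one, Nat.reduceAdd]; field_simp
    have e2 : divW (weight R θ) x = R⁻¹ * (4 * profile θ 0 r + 2 * (r * profile θ 1 r)) := by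
      rw [divW, e0, mul_assoc, e1]; ring
    have e3 : lapDivW (weight R θ) x = R⁻¹ ^ 3 *
        (48 * profile θ 1 r + 48 * (r * profile θ 2 r) + 8 * (r ^ 2 * profile θ 3 r)) := by
      simp only [lapDivW, weight, hxr, Fin.val_one, Fin.val_two, show ((3 : Fin 4) : ℕ) = 3 from rfl,
        mul_one, Nat.reduceAdd, Nat.reduceMul]
      field_simp
    have hrg1 : |r * profile θ 1 r| ≤ 8 * K := by
      rw [abs_mul, abs_of_nonneg (by linarith : 0 ≤ r)]
      calc r * |profile θ 1 r| ≤ 4 * (2 * K) := mul_le_mul hr4 g1 (abs_nonneg _) (by norm_num)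
        _ = 8 * K := by ring
    have hrg2 : |r * profile θ 2 r| ≤ 12 * K := by
      rw [abs_mul, abs_of_nonneg (by linarith : 0 ≤ r)]
      calc r * |profile θ 2 r| ≤ 4 * (3 * K) := mul_le_mul hr4 g2 (abs_nonneg _) (by norm_num)
        _ = 12 * K := by ring
    have hrg3 : |r ^ 2 * profile θ 3 r| ≤ 112 * K := by
      rw [abs_mul, abs_of_nonneg (by positivity)]
      calc r ^ 2 * |profile θ 3 r| ≤ 4 ^ 2 * (7 * K) :=
            mul_le_mul (pow_le_pow_left₀ (by linarith) hr4 2) g3 (abs_nonneg _) (by norm_num)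
        _ = 112 * K := by ring
    have main : ∀ {c : ℝ} (n : ℕ), |c| ≤ 1568 * K → |R⁻¹ ^ n * c| ≤ 1568 * K / R ^ n := by
      intro c n hc
      rw [abs_mul, abs_of_pos (pow_pos hRi n), inv_pow, div_eq_inv_mul]
      exact mul_le_mul_of_nonneg_left hc (by positivity)
    rw [e0, e2, e3, ← abs_of_nonneg (sq_nonneg ‖x‖), ← abs_mul, e1]
    refine ⟨?_, ?_, ?_, ?_⟩
    · simpa using main 1 (c := profile θ 0 r) (by linarith)
    · simpa using main 1 (c := r * profile θ 1 r) (by linarith)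
    · have a1 := abs_le.1 g0
      have a2 := abs_le.1 hrg1
      simpa using main 1 (c := 4 * profile θ 0 r + 2 * (r * profile θ 1 r)) (abs_le.2
        (by constructor <;> linarith))
    · have a1 := abs_le.1 g1
      have a2 := abs_le.1 hrg2
      have a3 := abs_le.1 hrg3
      exact main 3 (abs_le.2 (by constructor <;> linarith))
  · have hz : ∀ i, weight R θ i x = 0 := fun i => (radialWeight_weight hR hθ).support i x (by
      refine le_of_sq_le_sq ?_ (norm_nonneg x)
      rw [hxr]; nlinarith [pow_pos hR 2])
    simp only [divW, lapDivW, hz, mul_zero, abs_zero, add_zero]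
    refine ⟨?_, ?_, ?_, ?_⟩ <;> positivity

/-- The pointwise form of `exists_virial_lower_bound`. -/
theorem virial_pointwise {K : ℝ} (hK0 : 0 < K) {R θ η α b : ℝ} (hR : 0 < R) (hθ : 0 < θ)
    (hη : 0 < η) (hα : 0 < α) (hb : 0 ≤ b) {x : E4} (hK : R ≤ ‖x‖ → |weight R θ 0 x| ≤ K / R ∧
      ‖x‖ ^ 2 * |weight R θ 1 x| ≤ K / R ∧ |divW (weight R θ) x| ≤ K / R ∧
      |lapDivW (weight R θ) x| ≤ K / R ^ 3) (v F N : E4 → ℂ) :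
    3 * α / (α + 2) * (Metric.closedBall (0 : E4) R).indicator (fun x => (‖x‖ ^ 2 + η) ^ (-b / 2) *
      (√(‖x‖ ^ 2 + θ * R ^ 2))⁻¹ * ‖v x‖ ^ (α + 2)) x ≤ ((2 * weight R θ 0 x * ∑ j, ‖pd j v x‖ ^ 2 +
      4 * weight R θ 1 x * ‖∑ j, x j • pd j v x‖ ^ 2 - lapDivW (weight R θ) x / 2 * ‖v x‖ ^ 2) +
      (α / (α + 2) * ((‖x‖ ^ 2 + η) ^ (-b / 2) * divW (weight R θ) x * ‖v x‖ ^ (α + 2)) +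
      inner ℝ (F x - N x) (multW (weight R θ) v x))) + (6 * K / R * ∑ j, ‖pd j v x‖ ^ 2 +
        6 * K / R ^ 3 * ‖v x‖ ^ 2 + 6 * K / R * R ^ (-b) * ‖v x‖ ^ (α + 2) +
        ‖F x - N x‖ * ‖multW (weight R θ) v x‖) := by
  have hpos : 0 < ‖x‖ ^ 2 + η := by positivity
  set e : ℝ := 3 * α / (α + 2) * (Metric.closedBall (0 : E4) R).indicator
    (fun x => (‖x‖ ^ 2 + η) ^ (-b / 2) * (√(‖x‖ ^ 2 + θ * R ^ 2))⁻¹ * ‖v x‖ ^ (α + 2)) x with he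
  have hcs : ‖∑ j, x j • pd j v x‖ ^ 2 ≤ ‖x‖ ^ 2 * ∑ j, ‖pd j v x‖ ^ 2 := by
    refine (pow_le_pow_left₀ (norm_nonneg _) (norm_sum_le _ _) 2).trans ?_
    rw [norm_sq_eq x]
    refine (le_of_eq ?_).trans (Finset.sum_mul_sq_le_sq_mul_sq Finset.univ (fun j => |x j|)
      (fun j => ‖pd j v x‖)) |>.trans (le_of_eq ?_)
    · simp
    · simp
  set D := ∑ j, ‖pd j v x‖ ^ 2 with hD
  set G := ‖∑ j, x j • pd j v x‖ ^ 2 with hG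
  have hD0 : 0 ≤ D := by positivity
  have hG0 : 0 ≤ G := by positivity
  have h1 : -(‖F x - N x‖ * ‖multW (weight R θ) v x‖) ≤
      inner ℝ (F x - N x) (multW (weight R θ) v x) :=
    neg_le_of_abs_le (abs_real_inner_le_norm _ _)
  have hw : 0 < (‖x‖ ^ 2 + η) ^ (-b / 2) := Real.rpow_pos_of_pos hpos _
  have hP : 0 ≤ ‖v x‖ ^ (α + 2) := by positivity
  have hwP := mul_nonneg hw.le hP
  have hα2 : 0 < α / (α + 2) := by positivity
  have hα3 : α / (α + 2) ≤ 1 := by rw [div_le_one (by linarith)]; linarith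
  have hRb : 0 < R ^ (-b) := Real.rpow_pos_of_pos hR _
  rcases le_or_gt ‖x‖ R with hx | hx
  · obtain ⟨k0, k1, k2, k3, k4⟩ := weight_core hR hθ hx
    have hex : e = α / (α + 2) * ((‖x‖ ^ 2 + η) ^ (-b / 2) * (3 * weight R θ 0 x) *
        ‖v x‖ ^ (α + 2)) := by
      rw [he, k0, indicator_of_mem (mem_closedBall_zero_iff.2 hx)]
      ring
    have t1 : e ≤ α / (α + 2) * ((‖x‖ ^ 2 + η) ^ (-b / 2) * divW (weight R θ) x *
        ‖v x‖ ^ (α + 2)) := by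
      rw [hex]
      gcongr
    have t2 : 0 ≤ 2 * weight R θ 0 x * D + 4 * weight R θ 1 x * G -
        lapDivW (weight R θ) x / 2 * ‖v x‖ ^ 2 := by
      have s1 := mul_le_mul_of_nonpos_left hcs k2
      have s2 := mul_nonneg k3 hD0
      have s3 := mul_nonneg (neg_nonneg.2 k4) (sq_nonneg ‖v x‖)
      nlinarith
    have t3 : 0 ≤ 6 * K / R * D + 6 * K / R ^ 3 * ‖v x‖ ^ 2 +
      6 * K / R * R ^ (-b) * ‖v x‖ ^ (α + 2) := by positivity
    linarith
  · obtain ⟨k0, k1, k2, k3⟩ := hK hx.le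
    have hex : e = 0 := by
      rw [he, indicator_of_notMem (fun h => hx.not_ge (mem_closedBall_zero_iff.1 h)), mul_zero]
    have t1 : -(K / R * R ^ (-b) * ‖v x‖ ^ (α + 2)) ≤ α / (α + 2) *
        ((‖x‖ ^ 2 + η) ^ (-b / 2) * divW (weight R θ) x * ‖v x‖ ^ (α + 2)) := by
      refine neg_le_of_abs_le ?_
      have hwR : (‖x‖ ^ 2 + η) ^ (-b / 2) ≤ R ^ (-b) := by
        calc (‖x‖ ^ 2 + η) ^ (-b / 2) ≤ (R ^ 2) ^ (-b / 2) :=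
            Real.rpow_le_rpow_of_nonpos (by positivity) (by nlinarith) (by linarith)
          _ = R ^ (-b) := by
            rw [← Real.rpow_natCast, ← Real.rpow_mul hR.le]
            congr 1
            push_cast
            ring
      rw [abs_mul, abs_mul, abs_mul, abs_of_pos hα2, abs_of_pos hw, abs_of_nonneg hP]
      calc α / (α + 2) * ((‖x‖ ^ 2 + η) ^ (-b / 2) * |divW (weight R θ) x| * ‖v x‖ ^ (α + 2))
          ≤ 1 * (R ^ (-b) * (K / R) * ‖v x‖ ^ (α + 2)) := by gcongr
        _ = _ := by ring
    have t2 : -(6 * K / R * D) ≤ 2 * weight R θ 0 x * D + 4 * weight R θ 1 x * G := by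
      have s1 := mul_le_mul_of_nonneg_right (neg_le_of_abs_le k0) hD0
      have s2 : |weight R θ 1 x * G| ≤ K / R * D := by
        rw [abs_mul, abs_of_nonneg hG0]
        calc |weight R θ 1 x| * G ≤ |weight R θ 1 x| * (‖x‖ ^ 2 * D) := by gcongr
          _ = (‖x‖ ^ 2 * |weight R θ 1 x|) * D := by ring
          _ ≤ K / R * D := by gcongr
      have s3 := neg_le_of_abs_le s2
      have : 6 * K / R * D = 2 * (K / R * D) + 4 * (K / R * D) := by ring
      linarith
    have t3 : -(6 * K / R ^ 3 * ‖v x‖ ^ 2) ≤ -(lapDivW (weight R θ) x / 2 * ‖v x‖ ^ 2) := by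
      have s1 := mul_le_mul_of_nonneg_right ((le_abs_self _).trans k3) (sq_nonneg ‖v x‖)
      have s2 : 0 ≤ K / R ^ 3 * ‖v x‖ ^ 2 := by positivity
      have : 6 * K / R ^ 3 * ‖v x‖ ^ 2 = 6 * (K / R ^ 3 * ‖v x‖ ^ 2) := by ring
      linarith
    have t4 : K / R * R ^ (-b) * ‖v x‖ ^ (α + 2) ≤ 6 * K / R * R ^ (-b) * ‖v x‖ ^ (α + 2) := by
      have : 0 ≤ K / R * R ^ (-b) * ‖v x‖ ^ (α + 2) := by positivity
      have h6 : 6 * K / R * R ^ (-b) * ‖v x‖ ^ (α + 2) = 6 * (K / R * R ^ (-b) * ‖v x‖ ^ (α + 2)) := by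
        ring
      linarith
    rw [hex]
    linarith

/-- The virial inequality for the Morawetz weight: up to terms that live at `|x| ~ R`, the
nonlinear term bounds the derivative of the Morawetz action from below. -/
theorem exists_virial_lower_bound : ∃ K : ℝ, 0 < K ∧ ∀ {R θ η α b : ℝ}, 0 < R → 0 < θ → θ ≤ 1 →
    0 < η → 0 < α → 0 ≤ b → ∀ {v F : E4 → ℂ}, ContDiff ℝ ((⊤ : ℕ∞) : WithTop ℕ∞) v →
    ContDiff ℝ ((⊤ : ℕ∞) : WithTop ℕ∞) F →
    3 * α / (α + 2) * ∫ x in Metric.closedBall (0 : E4) R,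
        (‖x‖ ^ 2 + η) ^ (-b / 2) * (√(‖x‖ ^ 2 + θ * R ^ 2))⁻¹ * ‖v x‖ ^ (α + 2) ≤
      (∫ x, (momentum (weight R θ) (fun y => Complex.I * ((∑ k, pd k (pd k v) y) - F y)) v x +
        momentum (weight R θ) v (fun y => Complex.I * ((∑ k, pd k (pd k v) y) - F y)) x)) +
      ∫ x in Metric.closedBall (0 : E4) (2 * R), (K / R * ∑ j, ‖pd j v x‖ ^ 2 +
        K / R ^ 3 * ‖v x‖ ^ 2 + K / R * R ^ (-b) * ‖v x‖ ^ (α + 2) +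
        ‖F x - ((‖x‖ ^ 2 + η) ^ (-b / 2) * ‖v x‖ ^ α) • v x‖ * ‖multW (weight R θ) v x‖) := by
  obtain ⟨K, hK0, hK⟩ := exists_weight_outer
  refine ⟨6 * K, by positivity, fun {R θ η α b} hR hθ hθ1 hη hα hb {v F} hv hF => ?_⟩
  have hp := radialWeight_weight hR hθ
  have hv1 : ContDiff ℝ 1 v := hv.of_le (by exact_mod_cast le_top)
  have hpos : ∀ x : E4, 0 < ‖x‖ ^ 2 + η := fun x => by positivity
  have hpos' : ∀ x : E4, 0 < ‖x‖ ^ 2 + θ * R ^ 2 := fun x => by positivity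
  have c0 : Continuous fun x : E4 => (‖x‖ ^ 2 + η) ^ (-b / 2) :=
    (by fun_prop : Continuous fun x : E4 => ‖x‖ ^ 2 + η).rpow_const fun x => Or.inl (hpos x).ne'
  have c1 : Continuous fun x : E4 => (√(‖x‖ ^ 2 + θ * R ^ 2))⁻¹ :=
    (by fun_prop : Continuous fun x : E4 => √(‖x‖ ^ 2 + θ * R ^ 2)).inv₀
      fun x => (Real.sqrt_pos.2 (hpos' x)).ne'
  have c2 : Continuous fun x => ‖v x‖ ^ (α + 2) :=
    hv.continuous.norm.rpow_const fun x => Or.inr (by linarith)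
  have c3 : Continuous fun x => ‖v x‖ ^ α := hv.continuous.norm.rpow_const fun x => Or.inr hα.le
  have c4 := continuous_multW hp hv
  have c5 := fun j => (contDiff_pd hv j).continuous
  have c6 := hv.continuous
  have c7 := hF.continuous
  have c8 := hp.contDiff_divW.continuous
  have c9 := (hp.contDiff 0).continuous
  have c10 := (hp.contDiff 1).continuous
  have c11 : Continuous (lapDivW (weight R θ)) := by
    have := (hp.contDiff 2).continuous
    have := (hp.contDiff 3).continuous
    unfold lapDivW
    fun_prop
  have c12 := fun j : Fin 4 => (contDiff_coord j (n := 1)).continuous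
  set N : E4 → ℂ := fun x => ((‖x‖ ^ 2 + η) ^ (-b / 2) * ‖v x‖ ^ α) • v x with hN
  have cN : Continuous N := by fun_prop
  set B := Metric.closedBall (0 : E4) (2 * R) with hB
  have hBm : MeasurableSet B := Metric.isClosed_closedBall.measurableSet
  have hBc : IsCompact B := isCompact_closedBall _ _
  -- Both integrals of the virial identity are supported in the ball of radius `2R`.
  have hsupp : ∀ {f : E4 → ℝ}, (∀ x, (∀ i, weight R θ i x = 0) → f x = 0) →
      ∫ x, f x = ∫ x in B, f x := by
    intro f hf
    refine (setIntegral_eq_integral_of_forall_compl_eq_zero fun x hx => hf x fun i => ?_).symm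
    exact hp.support i x (by rw [hB, mem_closedBall_zero_iff, not_le] at hx; exact hx.le)
  have hint : ∀ {f : E4 → ℝ}, Continuous f → IntegrableOn f B := fun hf =>
    hf.continuousOn.integrableOn_compact hBc
  have hnl := integral_inner_nonlinear_ge hp (weight_zero_nonneg hR) hv hα hb hη
  rw [hsupp (fun x hx => by simp [divW, hx]), hsupp (fun x hx => by simp [multW, divW, hx])] at hnl
  rw [integral_momentum_schrodinger hp hv hF, hsupp (fun x hx => by simp [lapDivW, hx]),
    hsupp (f := fun x => inner ℝ (F x) _) (fun x hx => by simp [multW, divW, hx])]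
  set e : E4 → ℝ := fun x => 3 * α / (α + 2) *
    (Metric.closedBall (0 : E4) R).indicator (fun x => (‖x‖ ^ 2 + η) ^ (-b / 2) *
      (√(‖x‖ ^ 2 + θ * R ^ 2))⁻¹ * ‖v x‖ ^ (α + 2)) x with he
  have hsub : Metric.closedBall (0 : E4) R ⊆ B := Metric.closedBall_subset_closedBall (by linarith)
  have hLe : 3 * α / (α + 2) * ∫ x in Metric.closedBall (0 : E4) R,
      (‖x‖ ^ 2 + η) ^ (-b / 2) * (√(‖x‖ ^ 2 + θ * R ^ 2))⁻¹ * ‖v x‖ ^ (α + 2) = ∫ x in B, e x := by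
    rw [he, integral_const_mul, setIntegral_indicator Metric.isClosed_closedBall.measurableSet,
      inter_eq_right.2 hsub]
  have hei : IntegrableOn e B :=
    ((hint (f := fun x => (‖x‖ ^ 2 + η) ^ (-b / 2) * (√(‖x‖ ^ 2 + θ * R ^ 2))⁻¹ * ‖v x‖ ^ (α + 2))
      (by fun_prop)).indicator Metric.isClosed_closedBall.measurableSet).const_mul _
  have hinner : ∫ x in B, inner ℝ (F x) (multW (weight R θ) v x) =
      (∫ x in B, inner ℝ (N x) (multW (weight R θ) v x)) +
        ∫ x in B, inner ℝ (F x - N x) (multW (weight R θ) v x) := by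
    rw [← integral_add (hint (by fun_prop)) (hint (by fun_prop))]
    simp only [inner_sub_left, add_sub_cancel]
  rw [← integral_const_mul] at hnl
  rw [hLe, hinner]
  have i1 := hint (f := fun x => 2 * weight R θ 0 x * ∑ j, ‖pd j v x‖ ^ 2 +
    4 * weight R θ 1 x * ‖∑ j, x j • pd j v x‖ ^ 2 - lapDivW (weight R θ) x / 2 * ‖v x‖ ^ 2)
    (by fun_prop)
  have i2 := hint (f := fun x => α / (α + 2) *
    ((‖x‖ ^ 2 + η) ^ (-b / 2) * divW (weight R θ) x * ‖v x‖ ^ (α + 2))) (by fun_prop)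
  have i3 := hint (f := fun x => inner ℝ (F x - N x) (multW (weight R θ) v x)) (by fun_prop)
  have i4 := hint (f := fun x => 6 * K / R * ∑ j, ‖pd j v x‖ ^ 2 +
    6 * K / R ^ 3 * ‖v x‖ ^ 2 + 6 * K / R * R ^ (-b) * ‖v x‖ ^ (α + 2) +
    ‖F x - N x‖ * ‖multW (weight R θ) v x‖) (by fun_prop)
  have key : ∫ x in B, e x ≤ ∫ x in B, (((2 * weight R θ 0 x * ∑ j, ‖pd j v x‖ ^ 2 +
      4 * weight R θ 1 x * ‖∑ j, x j • pd j v x‖ ^ 2 - lapDivW (weight R θ) x / 2 * ‖v x‖ ^ 2) +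
      (α / (α + 2) * ((‖x‖ ^ 2 + η) ^ (-b / 2) * divW (weight R θ) x * ‖v x‖ ^ (α + 2)) +
      inner ℝ (F x - N x) (multW (weight R θ) v x))) + (6 * K / R * ∑ j, ‖pd j v x‖ ^ 2 +
        6 * K / R ^ 3 * ‖v x‖ ^ 2 + 6 * K / R * R ^ (-b) * ‖v x‖ ^ (α + 2) +
        ‖F x - N x‖ * ‖multW (weight R θ) v x‖)) := by
    exact integral_mono hei ((i1.add (i2.add i3)).add i4) fun x =>
      virial_pointwise hK0 hR hθ hη hα hb (hK R θ hR hθ hθ1 x) v F N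
  have i3' : IntegrableOn (fun x => α / (α + 2) * ((‖x‖ ^ 2 + η) ^ (-b / 2) * divW (weight R θ) x *
    ‖v x‖ ^ (α + 2)) + inner ℝ (F x - N x) (multW (weight R θ) v x)) B := i2.add i3
  replace key := key.trans_eq (integral_add (i1.add i3') i4)
  rw [integral_add i1 i3', integral_add i2 i3] at key
  linarith

/-! ### Estimates on time slices -/

theorem Represents.locallyIntegrable {T : 𝓢'(E4, ℂ)} {f : E4 → ℂ} (h : Represents T f) :
    LocallyIntegrable f := by
  rw [locallyIntegrable_iff]
  intro K hK
  obtain ⟨ρ, hρ⟩ := hK.isBounded.subset_closedBall 0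
  set r := max ρ 1 with hr
  have hr0 : 0 < r := by positivity
  let B : ContDiffBump (0 : E4) := ⟨r, r + 1, hr0, by linarith⟩
  have hc : HasCompactSupport (Complex.ofRealCLM ∘ B) := B.hasCompactSupport.comp_left rfl
  have hd : ContDiff ℝ ((⊤ : ℕ∞) : WithTop ℕ∞) (Complex.ofRealCLM ∘ B) :=
    Complex.ofRealCLM.contDiff.comp B.contDiff
  refine (h (hc.toSchwartzMap hd)).1.integrableOn.congr_fun_ae ?_
  filter_upwards [ae_restrict_mem hK.measurableSet] with x hx
  have : (hc.toSchwartzMap hd) x = (B x : ℂ) := rfl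
  rw [this, B.one_of_mem_closedBall (Metric.closedBall_subset_closedBall (le_max_left _ _) (hρ hx))]
  simp

theorem locallyIntegrable_of_homSobolevNorm_lt_top {s : ℝ} {f : E4 → ℂ}
    (h : homSobolevNorm s f < ∞) : LocallyIntegrable f := by
  by_contra hf
  refine h.ne (top_unique ?_)
  rw [homSobolevNorm]
  exact le_iInf fun T => le_iInf fun g => le_iInf fun hT => absurd hT.locallyIntegrable hf

theorem Represents.congr {T : 𝓢'(E4, ℂ)} {f g : E4 → ℂ} (hfg : f =ᵐ[volume] g)
    (h : Represents T f) : Represents T g := fun φ =>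
  have e : (fun x => φ x * f x) =ᵐ[volume] fun x => φ x * g x := by
    filter_upwards [hfg] with x hx
    rw [hx]
  ⟨(h φ).1.congr e, (h φ).2.trans (integral_congr_ae e)⟩

theorem homSobolevNorm_congr {s : ℝ} {f g : E4 → ℂ} (hfg : f =ᵐ[volume] g) :
    homSobolevNorm s f = homSobolevNorm s g := by
  have h : ∀ T, Represents T f ↔ Represents T g := fun T =>
    ⟨Represents.congr hfg, Represents.congr hfg.symm⟩
  simp only [homSobolevNorm, h]

theorem lorentzNorm_congr {r ρ : ℝ} {f g : E4 → ℂ} (hfg : f =ᵐ[volume] g) :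
    lorentzNorm r ρ f = lorentzNorm r ρ g := by
  have h : ∀ l : ℝ≥0∞, volume {x | l < ‖f x‖ₑ} = volume {x | l < ‖g x‖ₑ} := fun l =>
    measure_congr (by
      filter_upwards [hfg] with x hx
      exact congrArg (fun z => l < ‖z‖ₑ) hx)
  simp only [lorentzNorm, decreasingRearrangement, h]

theorem nonlinearity_congr {α b : ℝ} {f g : E4 → ℂ} (hfg : f =ᵐ[volume] g) :
    nonlinearity α b f =ᵐ[volume] nonlinearity α b g := by
  filter_upwards [hfg] with x hx
  simp only [nonlinearity, hx]

/-- A Schwartz function, translated by a bounded amount, is dominated by the weight `wt`. -/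
theorem exists_norm_schwartz_sub_le (ψ : 𝓢(E4, ℂ)) {ρ : ℝ} (hρ : 0 ≤ ρ) :
    ∃ C : ℝ, 0 ≤ C ∧ ∀ y ∈ Metric.closedBall (0 : E4) ρ, ∀ x, ‖ψ (y - x)‖ ≤ C * wt x := by
  obtain ⟨C, hC, h⟩ := exists_norm_freeEvolution_le ψ 0
  refine ⟨C * (1 + ρ) ^ (8 : ℝ), by positivity, fun y hy x => ?_⟩
  have h1 := h 0 (by simp) (y - x)
  rw [freeEvolution_zero] at h1
  refine h1.trans ?_
  rw [mul_assoc]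
  refine mul_le_mul_of_nonneg_left ?_ hC
  have hy' : ‖y‖ ≤ ρ := by simpa using hy
  have h2 : 1 + ‖x‖ ≤ (1 + ρ) * (1 + ‖y - x‖) := by
    have : ‖x‖ ≤ ‖y‖ + ‖y - x‖ := by simpa using norm_sub_le y (y - x)
    nlinarith [norm_nonneg (y - x)]
  have h3 : (1 + ‖x‖) ^ (8 : ℝ) ≤ (1 + ρ) ^ (8 : ℝ) * (1 + ‖y - x‖) ^ (8 : ℝ) := by
    rw [← Real.mul_rpow (by positivity) (by positivity)]
    exact Real.rpow_le_rpow (by positivity) h2 (by norm_num)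
  rw [wt, wt, Real.rpow_neg (by positivity), Real.rpow_neg (by positivity), ← div_eq_mul_inv,
    le_div_iff₀ (by positivity), inv_mul_le_iff₀ (by positivity), mul_comm]
  exact h3

/-- The finite measure `wt(x) dx`. -/
def wtMeasure : Measure E4 := volume.withDensity fun x => ENNReal.ofReal (wt x)

theorem measurable_ofReal_wt : Measurable fun x => ENNReal.ofReal (wt x) :=
  continuous_wt.measurable.ennreal_ofReal

theorem lintegral_wtMeasure (g : E4 → ℝ≥0∞) :
    ∫⁻ x, g x ∂wtMeasure = ∫⁻ x, g x * ENNReal.ofReal (wt x) := by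
  rw [wtMeasure, lintegral_withDensity_eq_lintegral_mul_non_measurable _ measurable_ofReal_wt
    (Eventually.of_forall fun x => ENNReal.ofReal_lt_top)]
  exact lintegral_congr fun x => mul_comm _ _

theorem wtMeasure_le : wtMeasure ≤ (volume : Measure E4) := by
  conv_rhs => rw [← withDensity_one (μ := (volume : Measure E4))]
  exact withDensity_mono (Eventually.of_forall fun x => by simpa using wt_le_one x)

theorem wtMeasure_univ_le : wtMeasure univ ≤ ENNReal.ofReal ((∫ x, wt x) + 1) := by
  rw [wtMeasure, withDensity_apply _ MeasurableSet.univ, Measure.restrict_univ,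
    ← ofReal_integral_eq_lintegral_ofReal integrable_wt (Eventually.of_forall fun x => (wt_pos x).le)]
  exact ENNReal.ofReal_le_ofReal (by linarith)

theorem integral_wt_add_one_pos : 0 < (∫ x, wt x) + 1 := by
  have : 0 ≤ ∫ x, wt x := integral_nonneg fun x => (wt_pos x).le
  linarith

theorem enorm_schwartzConv_le {ψ : 𝓢(E4, ℂ)} {C : ℝ} {y : E4} (h : ∀ x, ‖ψ (y - x)‖ ≤ C * wt x)
    (f : E4 → ℂ) : ‖schwartzConv f ψ y‖ₑ ≤ ENNReal.ofReal C * ∫⁻ x, ‖f x‖ₑ ∂wtMeasure := by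
  rw [lintegral_wtMeasure, schwartzConv, ← lintegral_const_mul' _ _ ENNReal.ofReal_ne_top]
  refine (enorm_integral_le_lintegral_enorm _).trans (lintegral_mono fun x => ?_)
  rw [enorm_mul]
  have : ‖ψ (y - x)‖ₑ ≤ ENNReal.ofReal C * ENNReal.ofReal (wt x) := by
    rw [← ENNReal.ofReal_mul' (wt_pos x).le, ← ofReal_norm]
    exact ENNReal.ofReal_le_ofReal (h x)
  calc ‖f x‖ₑ * ‖ψ (y - x)‖ₑ ≤ ‖f x‖ₑ * (ENNReal.ofReal C * ENNReal.ofReal (wt x)) := by gcongr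
    _ = _ := by ring

/-- Sobolev-type bound in `Lʳ` of a ball, for the convolution with a Schwartz function. The scaling
exponent is the one of functions with `|∇|^σ` in `L²`. -/
theorem exists_lintegral_schwartzConv_rpow_le {s σ r : ℝ} (hσ : 0 < σ) (hσ2 : σ < 2) (hr : 0 < r)
    (hr' : r * (2 - σ) < 4) : ∃ C : ℝ, 0 ≤ C ∧ ∀ f : E4 → ℂ, LocallyIntegrable f →
      ∀ ψ : 𝓢(E4, ℂ), HasCompactSupport ψ →
      (∀ ξ, (2 * Real.pi * ‖ξ‖) ^ σ * ‖𝓕 ψ ξ‖ ≤ (2 * Real.pi * ‖ξ‖) ^ s) → ∀ ρ : ℝ, 0 < ρ →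
      ∫⁻ x in Metric.closedBall 0 ρ, ‖schwartzConv f ψ x‖ₑ ^ r ≤
        ENNReal.ofReal (C * ρ ^ (4 - r * (2 - σ))) * homSobolevNorm s f ^ r := by
  obtain ⟨C, hC, h⟩ := exists_volume_lt_schwartzConv_le (s := s) hσ hσ2
  have hb := ballVol_pos
  have h4 : 0 < 4 - r * (2 - σ) := by linarith
  refine ⟨4 / (4 - r * (2 - σ)) * ballVol ^ (1 - r * (2 - σ) / 4) * C ^ r, by positivity,
    fun f hf ψ hψ hF ρ hρ => ?_⟩
  refine (lintegral_closedBall_rpow_le_of_weak hσ2 hr hr'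
    (contDiff_schwartzConv hf hψ).continuous.aestronglyMeasurable (h f ψ hF) hρ).trans
    (le_of_eq ?_)
  rw [ENNReal.mul_rpow_of_nonneg _ _ hr.le, ENNReal.ofReal_rpow_of_pos hC, ← mul_assoc,
    ← ENNReal.ofReal_mul (by positivity)]
  congr 2
  ring

theorem fourier_moll_bound (s : ℝ) (n : ℕ) (ξ : E4) :
    (2 * Real.pi * ‖ξ‖) ^ s * ‖𝓕 (moll n) ξ‖ ≤ (2 * Real.pi * ‖ξ‖) ^ s :=
  mul_le_of_le_one_right (by positivity) (norm_fourier_moll_le n ξ)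

/-- The multiplier of `∂ₖ` and mollification, which costs one derivative. -/
theorem fourier_spd_moll_bound {s : ℝ} (hs : 1 < s) (n : ℕ) (k : Fin 4) (ξ : E4) :
    (2 * Real.pi * ‖ξ‖) ^ (s - 1) * ‖𝓕 (spd k (moll n)) ξ‖ ≤ (2 * Real.pi * ‖ξ‖) ^ s := by
  have h0 : 0 ≤ 2 * Real.pi * ‖ξ‖ := by positivity
  calc _ ≤ (2 * Real.pi * ‖ξ‖) ^ (s - 1) * (2 * Real.pi * ‖ξ‖ * 1) := by
        refine mul_le_mul_of_nonneg_left ((norm_fourier_spd_le k _ ξ).trans ?_) (by positivity)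
        exact mul_le_mul_of_nonneg_left (norm_fourier_moll_le n ξ) h0
    _ = (2 * Real.pi * ‖ξ‖) ^ (s - 1) * (2 * Real.pi * ‖ξ‖) ^ (1 : ℝ) := by rw [mul_one, Real.rpow_one]
    _ = (2 * Real.pi * ‖ξ‖) ^ s := by
        rw [← Real.rpow_add_of_nonneg h0 (by linarith) zero_le_one]
        congr 1; ring

/-- A function with `|∇|^s f` in `L²` is integrable with respect to `wt(x) dx`. -/
theorem exists_lintegral_wtMeasure_le {s : ℝ} (hs : 0 < s) (hs2 : s < 2) :
    ∃ C : ℝ, 0 ≤ C ∧ ∀ f : E4 → ℂ, LocallyIntegrable f →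
      ∫⁻ x, ‖f x‖ₑ ∂wtMeasure ≤ ENNReal.ofReal C * homSobolevNorm s f := by
  obtain ⟨C, hC, h⟩ := exists_volume_lt_schwartzConv_le (s := s) hs hs2
  set q := 4 / (2 - s) with hq
  set V := (∫ x, wt x) + 1 with hV
  have hq1 : 1 < q := by rw [hq, one_lt_div (by linarith)]; linarith
  have hVpos := integral_wt_add_one_pos
  refine ⟨q / (q - 1) * V ^ (1 - 1 / q) * C, ?_, fun f hf => ?_⟩
  · have : 0 < q - 1 := by linarith
    positivity
  have hn : ∀ n, ∫⁻ x, ‖schwartzConv f (moll n) x‖ₑ ∂wtMeasure ≤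
      ENNReal.ofReal (q / (q - 1) * V ^ (1 - 1 / q) * C) * homSobolevNorm s f := by
    intro n
    have := lintegral_rpow_le_of_weak (μ := wtMeasure) (f := schwartzConv f (moll n))
      (contDiff_schwartzConv hf (hasCompactSupport_moll n)).continuous.aestronglyMeasurable
      hVpos wtMeasure_univ_le one_pos hq1
      (fun t ht => (wtMeasure_le _).trans (h f (moll n) (fourier_moll_bound s n) t ht))
    simp only [ENNReal.rpow_one] at this
    rw [ENNReal.ofReal_mul' hC.le, mul_assoc]
    exact this
  have hae : ∀ᵐ x ∂wtMeasure, ‖f x‖ₑ ≤ liminf (fun n => ‖schwartzConv f (moll n) x‖ₑ) atTop := by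
    filter_upwards [(Measure.absolutelyContinuous_of_le wtMeasure_le).ae_le
      (ae_tendsto_schwartzConv_moll hf)] with x hx
    exact (hx.enorm).liminf_eq.ge
  calc ∫⁻ x, ‖f x‖ₑ ∂wtMeasure
      ≤ ∫⁻ x, liminf (fun n => ‖schwartzConv f (moll n) x‖ₑ) atTop ∂wtMeasure := lintegral_mono_ae hae
    _ ≤ liminf (fun n => ∫⁻ x, ‖schwartzConv f (moll n) x‖ₑ ∂wtMeasure) atTop :=
        lintegral_liminf_le fun n =>
          (contDiff_schwartzConv hf (hasCompactSupport_moll n)).continuous.enorm.measurable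
    _ ≤ _ := by
        refine (liminf_le_liminf (Eventually.of_forall hn)).trans (le_of_eq ?_)
        simp

/-- The integrability exponent in space of the solution that puts the nonlinearity in `L²`
locally. -/
def powExp (α b s : ℝ) : ℝ := 8 * (α + 1) / (5 - s - 2 * b)

section
variable {α b s : ℝ}

/-- The denominator in the definition of `powExp` is positive. -/
theorem powExp_den_pos (hs1 : 1 < s) (hbs : b < 3 - s) : 0 < 5 - s - 2 * b := by linarith

/-- Hölder's inequality for a nonlinearity of the form `|x|^{-b}|f|^{α+1}`. -/
theorem exists_lintegral_nonlinear_sq_le (hs1 : 1 < s) (hb : 0 < b) (hbs : b < 3 - s)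
    {V : ℝ} (hV : 0 < V) : ∃ C : ℝ, 0 ≤ C ∧ ∀ μ : Measure E4, μ ≤ volume →
      μ univ ≤ ENNReal.ofReal V → ∀ f : E4 → ℝ≥0∞, AEMeasurable f μ →
      ∫⁻ x, (ENNReal.ofReal (‖x‖ ^ (-b)) * f x ^ (α + 1)) ^ (2 : ℝ) ∂μ ≤
        ENNReal.ofReal C * (∫⁻ x, f x ^ powExp α b s ∂μ) ^ ((5 - s - 2 * b) / 4) := by
  have h5 := powExp_den_pos hs1 hbs
  have h1 : 0 < 2 * b + s - 1 := by linarith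
  set ν := 4 / (2 * b + s - 1) with hν
  set ν' := 4 / (5 - s - 2 * b) with hν'
  have hconj : ν.HolderConjugate ν' := by
    rw [Real.holderConjugate_iff]
    refine ⟨?_, ?_⟩
    · rw [hν, one_lt_div h1]; linarith
    · rw [hν, hν', inv_div, inv_div]; ring
  have hκ : 0 < 2 * b * ν := by positivity
  have hκ4 : 2 * b * ν < 4 := by
    rw [hν, ← mul_div_assoc, div_lt_iff₀ h1]; linarith
  refine ⟨(4 / (4 - 2 * b * ν) * V ^ (1 - 2 * b * ν / 4) * ballVol ^ (2 * b * ν / 4)) ^ (1 / ν), ?_,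
    fun μ hμ hμV f hf => ?_⟩
  · have := ballVol_pos
    have : 0 < 4 - 2 * b * ν := by linarith
    positivity
  have hm : Measurable fun x : E4 => ENNReal.ofReal (‖x‖ ^ (-(2 * b))) := by fun_prop
  have e1 : ∀ x, (ENNReal.ofReal (‖x‖ ^ (-b)) * f x ^ (α + 1)) ^ (2 : ℝ) =
      ENNReal.ofReal (‖x‖ ^ (-(2 * b))) * f x ^ (2 * (α + 1)) := by
    intro x
    rw [ENNReal.mul_rpow_of_nonneg _ _ (by norm_num), ENNReal.ofReal_rpow_of_nonneg (by positivity)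
      (by norm_num), ← Real.rpow_mul (norm_nonneg _), ← ENNReal.rpow_mul,
      show -b * 2 = -(2 * b) by ring, mul_comm (α + 1)]
  simp only [e1]
  refine (ENNReal.lintegral_mul_le_Lp_mul_Lq μ hconj hm.aemeasurable (hf.pow_const _)).trans ?_
  have e2 : ∀ x : E4, ENNReal.ofReal (‖x‖ ^ (-(2 * b))) ^ ν = ENNReal.ofReal (‖x‖ ^ (-(2 * b * ν))) := by
    intro x
    rw [ENNReal.ofReal_rpow_of_nonneg (by positivity) hconj.nonneg, ← Real.rpow_mul (norm_nonneg _)]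
    congr 2; ring
  have e3 : ∀ x, (f x ^ (2 * (α + 1))) ^ ν' = f x ^ powExp α b s := by
    intro x
    rw [← ENNReal.rpow_mul, hν', powExp]
    congr 1; ring
  simp only [e2, e3]
  have hpos : 0 < 4 / (4 - 2 * b * ν) * V ^ (1 - 2 * b * ν / 4) * ballVol ^ (2 * b * ν / 4) := by
    have := ballVol_pos
    have : 0 < 4 - 2 * b * ν := by linarith
    positivity
  rw [← ENNReal.ofReal_rpow_of_pos hpos]
  refine mul_le_mul' (ENNReal.rpow_le_rpow (lintegral_norm_rpow_neg_le hμ hV hμV hκ hκ4)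
    (by have := hconj.pos; positivity)) (le_of_eq ?_)
  congr 1
  rw [hν']; field_simp

/-- The exponent `powExp` lies below the Lorentz exponent of the solution, so that the Lorentz norm
controls the `L^p` norm with this exponent on sets of finite measure. -/
theorem exists_lintegral_powExp_le (hα : 0 < α) (hs : s = 2 - (2 - b) / α) (hs1 : 1 < s)
    (hbs : b < 3 - s) {V : ℝ} (hV : 0 < V) :
    ∃ C : ℝ, 0 ≤ C ∧ ∀ μ : Measure E4, μ ≤ volume → μ univ ≤ ENNReal.ofReal V →
      ∀ f : E4 → ℂ, AEStronglyMeasurable f volume → ∫⁻ x, ‖f x‖ₑ ^ powExp α b s ∂μ ≤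
        ENNReal.ofReal C * lorentzNorm (4 * α * (α + 1) / (α + 2 - b * (α + 1))) 2 f ^ powExp α b s := by
  have h5 := powExp_den_pos hs1 hbs
  have hαs : α * s = 2 * α - 2 + b := by rw [hs]; field_simp; ring
  have hden : 0 < α + 2 - b * (α + 1) := by nlinarith
  have hp : 0 < powExp α b s := by rw [powExp]; positivity
  set m := 4 * α * (α + 1) / (α + 2 - b * (α + 1)) with hm
  have hm0 : 0 < m := by positivity
  have hpm : powExp α b s < m := by
    rw [powExp, hm, div_lt_div_iff₀ h5 hden]
    have : 0 < α * (s - 1) := by apply mul_pos hα; linarith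
    have h2 : 2 * (α + 2 - b * (α + 1)) < α * (5 - s - 2 * b) := by nlinarith
    nlinarith
  refine ⟨m / (m - powExp α b s) * V ^ (1 - powExp α b s / m), ?_, fun μ hμ hμV f hf => ?_⟩
  · have : 0 < m - powExp α b s := by linarith
    positivity
  exact lintegral_rpow_le_of_weak (hf.mono_ac (Measure.absolutelyContinuous_of_le hμ)) hV hμV hp hpm
    fun t ht => (hμ _).trans (volume_lt_le_lorentzNorm hm0 two_pos f ht)

end

/-! ### The Morawetz action of the mollified solution -/

/-- The product rule for absolutely continuous functions, which are given as primitives. -/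
theorem integral_product_rule {t₀ t₁ : ℝ} {f g w z : ℝ → ℂ} (hw : IntegrableOn w (Ioc t₀ t₁))
    (hz : IntegrableOn z (Ioc t₀ t₁)) {f₀ g₀ f₁ g₁ : ℂ} (hf₁ : f₁ - f₀ = ∫ τ in Ioc t₀ t₁, w τ)
    (hg₁ : g₁ - g₀ = ∫ τ in Ioc t₀ t₁, z τ)
    (hf : ∀ᵐ t ∂(volume.restrict (Ioc t₀ t₁)), f t - f₀ = ∫ τ in Ioc t₀ t, w τ)
    (hg : ∀ᵐ t ∂(volume.restrict (Ioc t₀ t₁)), g t - g₀ = ∫ τ in Ioc t₀ t, z τ) :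
    IntegrableOn (fun t => w t * g t + f t * z t) (Ioc t₀ t₁) ∧
      ∫ t in Ioc t₀ t₁, (w t * g t + f t * z t) = f₁ * g₁ - f₀ * g₀ := by
  set μ : Measure ℝ := volume.restrict (Ioc t₀ t₁) with hμ
  have hwz : Integrable (fun q : ℝ × ℝ => w q.1 * z q.2) (μ.prod μ) := hw.mul_prod hz
  have hzw : Integrable (fun q : ℝ × ℝ => z q.1 * w q.2) (μ.prod μ) := hz.mul_prod hw
  have hS : MeasurableSet {q : ℝ × ℝ | q.2 ≤ q.1} := measurableSet_le measurable_snd measurable_fst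
  have hS' : MeasurableSet {q : ℝ × ℝ | q.2 < q.1} := measurableSet_lt measurable_snd measurable_fst
  set H₁ : ℝ × ℝ → ℂ := {q : ℝ × ℝ | q.2 ≤ q.1}.indicator fun q => w q.1 * z q.2 with hH₁
  set H₂ : ℝ × ℝ → ℂ := {q : ℝ × ℝ | q.2 < q.1}.indicator fun q => z q.1 * w q.2 with hH₂
  have i1 : Integrable H₁ (μ.prod μ) := hwz.indicator hS
  have i2 : Integrable H₂ (μ.prod μ) := hzw.indicator hS'
  have e1 : ∀ᵐ t ∂μ, w t * g t = w t * g₀ + ∫ σ, H₁ (t, σ) ∂μ := by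
    filter_upwards [hg, ae_restrict_mem measurableSet_Ioc] with t ht htm
    have : ∀ σ, H₁ (t, σ) = (Iic t).indicator (fun σ => w t * z σ) σ := fun σ => rfl
    simp only [this]
    rw [hμ, setIntegral_indicator measurableSet_Iic, integral_const_mul,
      show Ioc t₀ t₁ ∩ Iic t = Ioc t₀ t by rw [Ioc_inter_Iic, min_eq_right htm.2], ← ht]
    ring
  have e2 : ∀ᵐ t ∂μ, f t * z t = f₀ * z t + ∫ σ, H₂ (t, σ) ∂μ := by
    filter_upwards [hf, ae_restrict_mem measurableSet_Ioc] with t ht htm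
    have : ∀ σ, H₂ (t, σ) = (Iio t).indicator (fun σ => z t * w σ) σ := fun σ => rfl
    simp only [this]
    rw [hμ, setIntegral_indicator measurableSet_Iio, integral_const_mul,
      show Ioc t₀ t₁ ∩ Iio t = Ioo t₀ t by
        ext σ; simp only [mem_inter_iff, mem_Ioc, mem_Iio, mem_Ioo]
        exact ⟨fun h => ⟨h.1.1, h.2⟩, fun h => ⟨⟨h.1, (h.2.trans_le htm.2).le⟩, h.2⟩⟩,
      ← integral_Ioc_eq_integral_Ioo, ← ht]
    ring
  have e12 : ∀ᵐ t ∂μ, w t * g t + f t * z t = (w t * g₀ + ∫ σ, H₁ (t, σ) ∂μ) +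
      (f₀ * z t + ∫ σ, H₂ (t, σ) ∂μ) := by
    filter_upwards [e1, e2] with t h1 h2
    rw [h1, h2]
  have i3 : Integrable (fun t => ∫ σ, H₁ (t, σ) ∂μ) μ := i1.integral_prod_left
  have i4 : Integrable (fun t => ∫ σ, H₂ (t, σ) ∂μ) μ := i2.integral_prod_left
  have i5 : Integrable (fun t => w t * g₀ + ∫ σ, H₁ (t, σ) ∂μ) μ := (hw.mul_const g₀).add i3
  have i6 : Integrable (fun t => f₀ * z t + ∫ σ, H₂ (t, σ) ∂μ) μ := (hz.const_mul f₀).add i4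
  refine ⟨(i5.add i6).congr (e12.mono fun t ht => ht.symm), ?_⟩
  rw [integral_congr_ae e12, integral_add i5 i6, integral_add (hw.mul_const g₀) i3,
    integral_add (hz.const_mul f₀) i4, integral_mul_const, integral_const_mul,
    ← integral_prod _ i1, ← integral_prod _ i2, ← hf₁, ← hg₁]
  have e3 : ∫ q, H₂ q ∂(μ.prod μ) = ∫ q, H₂ q.swap ∂(μ.prod μ) :=
    (integral_prod_swap (μ := μ) (ν := μ) H₂).symm
  have e4 : (∫ q, H₁ q ∂(μ.prod μ)) + ∫ q, H₂ q ∂(μ.prod μ) = (f₁ - f₀) * (g₁ - g₀) := by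
    have i7 : Integrable (fun q : ℝ × ℝ => H₂ q.swap) (μ.prod μ) := i2.swap
    rw [e3, ← integral_add i1 i7, hf₁, hg₁, ← integral_prod_mul]
    refine integral_congr_ae (Eventually.of_forall fun q => ?_)
    simp only [hH₁, hH₂, indicator_apply, mem_ofPred_eq, Prod.fst_swap, Prod.snd_swap]
    by_cases h : q.2 ≤ q.1
    · rw [if_pos h, if_neg (not_lt.2 h), add_zero]
    · rw [if_neg h, if_pos (not_le.1 h), zero_add, mul_comm]
  linear_combination e4

theorem spd_neg (k : Fin 4) (φ : 𝓢(E4, ℂ)) : spd k (-φ) = -spd k φ := by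
  simp only [spd]
  exact LineDeriv.lineDerivOp_neg _ _

theorem spd_reflectShift (k : Fin 4) (ψ : 𝓢(E4, ℂ)) (y : E4) :
    spd k (reflectShift ψ y) = -reflectShift (spd k ψ) y := by
  ext x
  rw [spd_apply, neg_apply, reflectShift_apply, spd_apply]
  have hd : DifferentiableAt ℝ ψ (y - x) := ψ.differentiableAt
  refine pd_eq_of_hasDerivAt (reflectShift ψ y).differentiableAt ?_
  have h1 := hasDerivAt_line hd k
  have h2 : HasDerivAt (fun t : ℝ => -t) (-1) 0 := hasDerivAt_neg 0
  have h3 := HasDerivAt.scomp (0 : ℝ) (h := fun t : ℝ => -t) (by simpa using h1) h2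
  refine (h3.congr_deriv (by simp)).congr_of_eventuallyEq (Eventually.of_forall fun t => ?_)
  simp only [reflectShift_apply, Function.comp_apply, neg_smul]
  congr 1
  abel

theorem slap_reflectShift (ψ : 𝓢(E4, ℂ)) (y : E4) :
    slap (reflectShift ψ y) = reflectShift (slap ψ) y := by
  ext x
  simp only [slap, spd_reflectShift, spd_neg, neg_neg, sum_apply, reflectShift_apply]

theorem hasCompactSupport_slap {ψ : 𝓢(E4, ℂ)} (h : HasCompactSupport ψ) :
    HasCompactSupport (slap ψ) := by
  have : (slap ψ : E4 → ℂ) = fun x => ∑ k, spd k (spd k ψ) x := by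
    ext x; rw [slap, sum_apply]
  rw [this]
  obtain ⟨K, hK, hK'⟩ : ∃ K, IsCompact K ∧ ∀ x ∉ K, ∀ k, spd k (spd k ψ) x = 0 := by
    refine ⟨⋃ k, tsupport (spd k (spd k ψ)), isCompact_iUnion fun k =>
      hasCompactSupport_spd (hasCompactSupport_spd h k) k, fun x hx k => ?_⟩
    exact image_eq_zero_of_notMem_tsupport fun h' => hx (mem_iUnion.2 ⟨k, h'⟩)
  exact HasCompactSupport.intro hK fun x hx => Finset.sum_eq_zero fun k _ => hK' x hx k

theorem sum_pd_pd_schwartzConv {f : E4 → ℂ} (hf : LocallyIntegrable f) {ψ : 𝓢(E4, ℂ)}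
    (hψ : HasCompactSupport ψ) (y : E4) :
    ∑ k, pd k (pd k (schwartzConv f ψ)) y = schwartzConv f (slap ψ) y := by
  have h : ∀ k, pd k (pd k (schwartzConv f ψ)) = schwartzConv f (spd k (spd k ψ)) := fun k => by
    rw [pd_schwartzConv hf hψ, pd_schwartzConv hf (hasCompactSupport_spd hψ k)]
  have hint : ∀ k, Integrable fun x => f x * spd k (spd k ψ) (y - x) := by
    intro k
    have hc := hasCompactSupport_spd (hasCompactSupport_spd hψ k) k
    have := hc.convolutionExists_right (ContinuousLinearMap.mul ℝ ℂ) hf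
      (spd k (spd k ψ)).continuous y
    simpa [ConvolutionExistsAt] using this
  simp only [h]
  simp only [schwartzConv, slap, sum_apply, Finset.mul_sum]
  rw [integral_finsetSum _ fun k _ => hint k]

/-- The right-hand side `i (Δu - N)` of the equation, convolved with `ψ`. -/
def convRhs (f N : E4 → ℂ) (ψ : 𝓢(E4, ℂ)) (y : E4) : ℂ :=
  Complex.I * schwartzConv f (slap ψ) y - Complex.I * schwartzConv N ψ y

theorem convRhs_eq {f N : E4 → ℂ} (hf : LocallyIntegrable f) {ψ : 𝓢(E4, ℂ)}
    (hψ : HasCompactSupport ψ) : convRhs f N ψ =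
      fun y => Complex.I * ((∑ k, pd k (pd k (schwartzConv f ψ)) y) - schwartzConv N ψ y) := by
  ext y
  rw [sum_pd_pd_schwartzConv hf hψ, convRhs, mul_sub]

theorem spd_slap (k : Fin 4) (ψ : 𝓢(E4, ℂ)) : spd k (slap ψ) = slap (spd k ψ) := by
  have h : ∀ j (φ : 𝓢(E4, ℂ)), spd k (spd j φ) = spd j (spd k φ) := by
    intro j φ
    ext x
    rw [spd_apply, spd_apply, show (spd j φ : E4 → ℂ) = pd j φ from funext (spd_apply j φ),
      show (spd k φ : E4 → ℂ) = pd k φ from funext (spd_apply k φ)]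
    exact pd_comm (φ.smooth ⊤) k j x
  have hsum : spd k (slap ψ) = ∑ j, spd k (spd j (spd j ψ)) := by
    simp only [spd, slap]
    exact map_sum (LineDeriv.lineDerivOpCLM ℂ 𝓢(E4, ℂ) (dir k)) _ _
  rw [hsum, slap]
  refine Finset.sum_congr rfl fun j _ => ?_
  rw [h, h]

theorem pd_convRhs {f N : E4 → ℂ} (hf : LocallyIntegrable f) (hN : LocallyIntegrable N)
    {ψ : 𝓢(E4, ℂ)} (hψ : HasCompactSupport ψ) (k : Fin 4) :
    pd k (convRhs f N ψ) = convRhs f N (spd k ψ) := by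
  ext y
  have h1 := (contDiff_schwartzConv hf (hasCompactSupport_slap hψ)).differentiable (by simp) y
  have h2 := (contDiff_schwartzConv hN hψ).differentiable (by simp) y
  have e1 := hasDerivAt_line h1 k
  have e2 := hasDerivAt_line h2 k
  rw [pd_schwartzConv hf (hasCompactSupport_slap hψ), spd_slap] at e1
  rw [pd_schwartzConv hN hψ] at e2
  exact pd_eq_of_hasDerivAt ((h1.const_mul _).sub (h2.const_mul _))
    ((e1.const_mul _).sub (e2.const_mul _))

theorem enorm_nonlinearity {α b : ℝ} (hα : 0 < α) (f : E4 → ℂ) (x : E4) :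
    ‖nonlinearity α b f x‖ₑ = ENNReal.ofReal (‖x‖ ^ (-b)) * ‖f x‖ₑ ^ (α + 1) := by
  have h : ‖f x‖ₑ ^ (α + 1) = ‖f x‖ₑ ^ α * ‖f x‖ₑ := by
    rw [ENNReal.rpow_add_of_nonneg _ _ hα.le zero_le_one, ENNReal.rpow_one]
  rw [nonlinearity, enorm_mul, h, ← mul_assoc]
  congr 1
  rw [← ofReal_norm, Complex.norm_real, Real.norm_of_nonneg (by positivity),
    ENNReal.ofReal_mul (by positivity), ← ofReal_norm (f x),
    ENNReal.ofReal_rpow_of_nonneg (norm_nonneg _) hα.le]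

theorem setLIntegral_closedBall_le_wtMeasure {ρ : ℝ} (hρ : 0 ≤ ρ) (g : E4 → ℝ≥0∞) :
    ∫⁻ x in Metric.closedBall 0 ρ, g x ≤ ENNReal.ofReal ((1 + ρ) ^ (8 : ℝ)) * ∫⁻ x, g x ∂wtMeasure := by
  rw [lintegral_wtMeasure, ← lintegral_const_mul' _ _ ENNReal.ofReal_ne_top]
  refine (setLIntegral_mono' measurableSet_closedBall fun x hx => ?_).trans
    (lintegral_mono' Measure.restrict_le_self le_rfl)
  have hx' : ‖x‖ ≤ ρ := by simpa using hx
  have h1 : 1 ≤ ENNReal.ofReal ((1 + ρ) ^ (8 : ℝ)) * ENNReal.ofReal (wt x) := by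
    rw [← ENNReal.ofReal_mul (by positivity), ← ENNReal.ofReal_one]
    refine ENNReal.ofReal_le_ofReal ?_
    rw [wt, Real.rpow_neg (by positivity), ← div_eq_mul_inv, one_le_div (by positivity)]
    exact Real.rpow_le_rpow (by positivity) (by linarith) (by norm_num)
  calc g x = 1 * g x := (one_mul _).symm
    _ ≤ ENNReal.ofReal ((1 + ρ) ^ (8 : ℝ)) * ENNReal.ofReal (wt x) * g x := by gcongr
    _ = _ := by ring

theorem locallyIntegrable_of_wtMeasure {f : E4 → ℂ} (hf : AEStronglyMeasurable f volume)
    (h : ∫⁻ x, ‖f x‖ₑ ∂wtMeasure < ∞) : LocallyIntegrable f := by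
  rw [locallyIntegrable_iff]
  intro K hK
  obtain ⟨ρ, hρ⟩ := hK.isBounded.subset_closedBall 0
  refine IntegrableOn.mono_set (t := Metric.closedBall 0 |ρ|) ⟨hf.restrict, ?_⟩
    (hρ.trans (Metric.closedBall_subset_closedBall (le_abs_self ρ)))
  exact (setLIntegral_closedBall_le_wtMeasure (abs_nonneg ρ) _).trans_lt
    (ENNReal.mul_lt_top ENNReal.ofReal_lt_top h)

theorem exists_lintegral_nonlinearity_wtMeasure_le {α b s : ℝ} (hα : 0 < α) (hs1 : 1 < s) (hb : 0 < b)
    (hbs : b < 3 - s) : ∃ C : ℝ, 0 ≤ C ∧ ∀ f : E4 → ℂ, AEStronglyMeasurable f volume →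
      ∫⁻ x, ‖nonlinearity α b f x‖ₑ ∂wtMeasure ≤
        ENNReal.ofReal C * (∫⁻ x, ‖f x‖ₑ ^ powExp α b s ∂wtMeasure) ^ ((α + 1) / powExp α b s) := by
  have h5 := powExp_den_pos hs1 hbs
  obtain ⟨C, hC, h⟩ := exists_lintegral_nonlinear_sq_le (α := α) hs1 hb hbs integral_wt_add_one_pos
  set V := (∫ x, wt x) + 1 with hV
  have hVpos : 0 < V := integral_wt_add_one_pos
  refine ⟨C ^ (1 / 2 : ℝ) * V ^ (1 / 2 : ℝ), by positivity, fun f hf => ?_⟩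
  have hac := Measure.absolutelyContinuous_of_le wtMeasure_le
  have hf' : AEMeasurable (fun x => ‖f x‖ₑ) wtMeasure := (hf.mono_ac hac).enorm
  have hm : AEMeasurable (fun x => ENNReal.ofReal (‖x‖ ^ (-b)) * ‖f x‖ₑ ^ (α + 1)) wtMeasure :=
    (by fun_prop : Measurable fun x : E4 => ENNReal.ofReal (‖x‖ ^ (-b))).aemeasurable.mul
      (hf'.pow_const _)
  simp only [enorm_nonlinearity hα]
  have h1 := ENNReal.lintegral_mul_le_Lp_mul_Lq wtMeasure Real.HolderConjugate.two_two hm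
    (aemeasurable_const (b := (1 : ℝ≥0∞)))
  simp only [Pi.mul_apply, mul_one, ENNReal.one_rpow, lintegral_one] at h1
  refine h1.trans ?_
  have h2 : (∫⁻ x, (ENNReal.ofReal (‖x‖ ^ (-b)) * ‖f x‖ₑ ^ (α + 1)) ^ (2 : ℝ) ∂wtMeasure) ^ (1 / 2 : ℝ) ≤
      ENNReal.ofReal (C ^ (1 / 2 : ℝ)) *
        (∫⁻ x, ‖f x‖ₑ ^ powExp α b s ∂wtMeasure) ^ ((α + 1) / powExp α b s) := by
    refine (ENNReal.rpow_le_rpow (h wtMeasure wtMeasure_le wtMeasure_univ_le _ hf')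
      (by norm_num)).trans (le_of_eq ?_)
    rw [ENNReal.mul_rpow_of_nonneg _ _ (by norm_num), ENNReal.ofReal_rpow_of_nonneg hC (by norm_num),
      ← ENNReal.rpow_mul]
    congr 2
    rw [powExp]
    field_simp
    norm_num
  have h3 : wtMeasure univ ^ (1 / 2 : ℝ) ≤ ENNReal.ofReal (V ^ (1 / 2 : ℝ)) := by
    rw [← ENNReal.ofReal_rpow_of_pos hVpos]
    exact ENNReal.rpow_le_rpow wtMeasure_univ_le (by norm_num)
  calc _ ≤ _ := mul_le_mul' h2 h3
    _ = _ := by rw [ENNReal.ofReal_mul (by positivity)]; ring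

/-- A jointly measurable solution on `[t₀, t₁]`, with the bounds that the proof of the Morawetz
inequality uses, at almost all times and at the two endpoints. -/
structure GoodSolution (α b s M t₀ t₁ : ℝ) (U : ℝ → E4 → ℂ) : Prop where
  le : t₀ ≤ t₁
  meas : Measurable (Function.uncurry U)
  left : homSobolevNorm s (U t₀) ≤ ENNReal.ofReal M
  right : homSobolevNorm s (U t₁) ≤ ENNReal.ofReal M
  ae : ∀ᵐ t ∂(volume.restrict (Ioc t₀ t₁)), homSobolevNorm s (U t) ≤ ENNReal.ofReal M
  nonlin : ∫⁻ t in Ioc t₀ t₁,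
    (∫⁻ x, ‖U t x‖ₑ ^ powExp α b s ∂wtMeasure) ^ ((α + 1) / powExp α b s) < ∞
  duhamel_right : ∀ φ : 𝓢(E4, ℂ), ∫ x, U t₁ x * φ x =
    (∫ x, U t₀ x * freeEvolution (t₁ - t₀) φ x) - Complex.I * ∫ τ in t₀..t₁, ∫ x,
      nonlinearity α b (U τ) x * freeEvolution (t₁ - τ) φ x
  duhamel : ∀ᵐ t ∂(volume.restrict (Ioc t₀ t₁)), ∀ φ : 𝓢(E4, ℂ), ∫ x, U t x * φ x =
    (∫ x, U t₀ x * freeEvolution (t - t₀) φ x) - Complex.I * ∫ τ in t₀..t, ∫ x,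
      nonlinearity α b (U τ) x * freeEvolution (t - τ) φ x

namespace GoodSolution

variable {α b s M t₀ t₁ : ℝ} {U : ℝ → E4 → ℂ}

theorem measurable_slice (h : GoodSolution α b s M t₀ t₁ U) (t : ℝ) : Measurable (U t) :=
  h.meas.comp measurable_prodMk_left

theorem measurable_nonlinearity (h : GoodSolution α b s M t₀ t₁ U) :
    Measurable (Function.uncurry fun t => nonlinearity α b (U t)) := by
  have h1 := h.meas
  have : (Function.uncurry fun t => nonlinearity α b (U t)) = fun q : ℝ × E4 =>
      ((‖q.2‖ ^ (-b) * ‖Function.uncurry U q‖ ^ α : ℝ) : ℂ) * Function.uncurry U q := rfl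
  rw [this]
  fun_prop

theorem lintegral_nonlinearity_lt_top (h : GoodSolution α b s M t₀ t₁ U) (hα : 0 < α) (hs1 : 1 < s)
    (hb : 0 < b) (hbs : b < 3 - s) :
    ∫⁻ t in Ioc t₀ t₁, ∫⁻ x, ‖nonlinearity α b (U t) x‖ₑ ∂wtMeasure < ∞ := by
  obtain ⟨C, hC, hCb⟩ := exists_lintegral_nonlinearity_wtMeasure_le hα hs1 hb hbs
  refine (lintegral_mono fun t => hCb (U t) (h.measurable_slice t).aestronglyMeasurable).trans_lt ?_
  rw [lintegral_const_mul' _ _ ENNReal.ofReal_ne_top]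
  exact ENNReal.mul_lt_top ENNReal.ofReal_lt_top h.nonlin

theorem integrable_nonlinearity (h : GoodSolution α b s M t₀ t₁ U) (hα : 0 < α) (hs1 : 1 < s)
    (hb : 0 < b) (hbs : b < 3 - s) :
    Integrable (fun q : ℝ × E4 => ‖nonlinearity α b (U q.1) q.2‖ * wt q.2)
      ((volume.restrict (Ioc t₀ t₁)).prod volume) := by
  have hm : Measurable fun q : ℝ × E4 => ‖nonlinearity α b (U q.1) q.2‖ * wt q.2 :=
    h.measurable_nonlinearity.norm.mul (continuous_wt.measurable.comp measurable_snd)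
  refine ⟨hm.aestronglyMeasurable, ?_⟩
  rw [HasFiniteIntegral, lintegral_prod _ hm.enorm.aemeasurable]
  refine lt_of_eq_of_lt ?_ (h.lintegral_nonlinearity_lt_top hα hs1 hb hbs)
  refine lintegral_congr fun t => ?_
  rw [lintegral_wtMeasure]
  refine lintegral_congr fun x => ?_
  rw [enorm_mul, enorm_norm, Real.enorm_of_nonneg (wt_pos x).le]

theorem ae_nonlinearity_lt_top (h : GoodSolution α b s M t₀ t₁ U) (hα : 0 < α) (hs1 : 1 < s)
    (hb : 0 < b) (hbs : b < 3 - s) : ∀ᵐ t ∂(volume.restrict (Ioc t₀ t₁)),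
      ∫⁻ x, ‖nonlinearity α b (U t) x‖ₑ ∂wtMeasure < ∞ := by
  have hm : Measurable fun t => ∫⁻ x, ‖nonlinearity α b (U t) x‖ₑ * ENNReal.ofReal (wt x) :=
    Measurable.lintegral_prod_right' (f := fun q : ℝ × E4 =>
      ‖nonlinearity α b (U q.1) q.2‖ₑ * ENNReal.ofReal (wt q.2))
      (h.measurable_nonlinearity.enorm.mul (measurable_ofReal_wt.comp measurable_snd))
  refine ae_lt_top' ?_ (h.lintegral_nonlinearity_lt_top hα hs1 hb hbs).ne
  simp only [lintegral_wtMeasure]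
  exact hm.aemeasurable

theorem integrable_left (h : GoodSolution α b s M t₀ t₁ U) (hs1 : 1 < s) (hs2 : s < 2) :
    Integrable fun x => ‖U t₀ x‖ * wt x := by
  obtain ⟨C, hC, hCb⟩ := exists_lintegral_wtMeasure_le (by linarith : 0 < s) hs2
  have hlt := h.left.trans_lt ENNReal.ofReal_lt_top
  have h1 := hCb (U t₀) (locallyIntegrable_of_homSobolevNorm_lt_top hlt)
  refine ⟨((h.measurable_slice t₀).norm.mul continuous_wt.measurable).aestronglyMeasurable, ?_⟩
  refine lt_of_eq_of_lt ?_ (h1.trans_lt (ENNReal.mul_lt_top ENNReal.ofReal_lt_top hlt))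
  rw [lintegral_wtMeasure]
  refine lintegral_congr fun x => ?_
  rw [enorm_mul, enorm_norm, Real.enorm_of_nonneg (wt_pos x).le]

/-- The equation, convolved with a Schwartz function, in integrated form. -/
theorem time_eq (h : GoodSolution α b s M t₀ t₁ U) (hα : 0 < α) (hs1 : 1 < s) (hs2 : s < 2)
    (hb : 0 < b) (hbs : b < 3 - s) (ψ : 𝓢(E4, ℂ)) (y : E4) :
    IntegrableOn (fun τ => convRhs (U τ) (nonlinearity α b (U τ)) ψ y) (Ioc t₀ t₁) ∧
    schwartzConv (U t₁) ψ y - schwartzConv (U t₀) ψ y =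
      ∫ τ in Ioc t₀ t₁, convRhs (U τ) (nonlinearity α b (U τ)) ψ y ∧
    ∀ᵐ t ∂(volume.restrict (Ioc t₀ t₁)), schwartzConv (U t) ψ y - schwartzConv (U t₀) ψ y =
      ∫ τ in Ioc t₀ t, convRhs (U τ) (nonlinearity α b (U τ)) ψ y := by
  have hum := (h.measurable_slice t₀).aestronglyMeasurable (μ := volume)
  have hu := h.integrable_left hs1 hs2
  have hNm := h.measurable_nonlinearity.aestronglyMeasurable
    (μ := (volume.restrict (Ioc t₀ t₁)).prod (volume : Measure E4))
  have hN := h.integrable_nonlinearity hα hs1 hb hbs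
  have hconv : ∀ (f : E4 → ℂ) (χ : 𝓢(E4, ℂ)), schwartzConv f χ y = ∫ x, f x * reflectShift χ y x := by
    intro f χ; simp [schwartzConv]
  have key : ∀ t, t₀ ≤ t → t ≤ t₁ → (∀ φ : 𝓢(E4, ℂ), ∫ x, U t x * φ x =
      (∫ x, U t₀ x * freeEvolution (t - t₀) φ x) - Complex.I * ∫ τ in t₀..t, ∫ x,
      nonlinearity α b (U τ) x * freeEvolution (t - τ) φ x) →
      IntegrableOn (fun τ => convRhs (U τ) (nonlinearity α b (U τ)) ψ y) (Ioc t₀ t) ∧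
      schwartzConv (U t) ψ y - schwartzConv (U t₀) ψ y =
      ∫ τ in Ioc t₀ t, convRhs (U τ) (nonlinearity α b (U τ)) ψ y := by
    intro t ht0 ht1 hD
    have hsub : Ioc t₀ t ⊆ Ioc t₀ t₁ := Ioc_subset_Ioc_right ht1
    have hle : (volume.restrict (Ioc t₀ t)).prod (volume : Measure E4) ≤
        (volume.restrict (Ioc t₀ t₁)).prod volume :=
      Measure.prod_mono (Measure.restrict_mono hsub le_rfl) le_rfl
    obtain ⟨e1, e2, e3⟩ := weak_equation ht0 (N := fun τ => nonlinearity α b (U τ)) hum hu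
      (hNm.mono_measure hle) (hN.mono_measure hle) (reflectShift ψ y)
      ((ae_restrict_of_ae_restrict_of_subset hsub h.duhamel).mono fun τ hτ => hτ _) (hD _)
    rw [slap_reflectShift] at e1 e3
    simp only [← hconv] at e1 e2 e3
    exact ⟨(e1.const_mul Complex.I).sub (e2.const_mul Complex.I), e3⟩
  obtain ⟨k1, k2⟩ := key t₁ h.le le_rfl h.duhamel_right
  refine ⟨k1, k2, ?_⟩
  filter_upwards [h.duhamel, ae_restrict_mem measurableSet_Ioc] with t ht htm
  exact (key t htm.1.le htm.2 ht).2

end GoodSolution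

theorem measurable_schwartzConv {U : ℝ → E4 → ℂ} (hU : Measurable (Function.uncurry U))
    (ψ : 𝓢(E4, ℂ)) : Measurable fun q : ℝ × E4 => schwartzConv (U q.1) ψ q.2 := by
  have hm : Measurable fun p : (ℝ × E4) × E4 =>
      Function.uncurry U (p.1.1, p.2) * ψ (p.1.2 - p.2) :=
    (hU.comp (by fun_prop)).mul (ψ.continuous.measurable.comp (by fun_prop))
  exact (hm.stronglyMeasurable.integral_prod_right' (ν := volume)).measurable

theorem exists_enorm_schwartzConv_le (ψ : 𝓢(E4, ℂ)) {ρ : ℝ} (hρ : 0 ≤ ρ) :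
    ∃ C : ℝ≥0∞, C ≠ ∞ ∧ ∀ f : E4 → ℂ, ∀ y ∈ Metric.closedBall (0 : E4) ρ,
      ‖schwartzConv f ψ y‖ₑ ≤ C * ∫⁻ x, ‖f x‖ₑ ∂wtMeasure := by
  obtain ⟨C, _, h⟩ := exists_norm_schwartz_sub_le ψ hρ
  exact ⟨ENNReal.ofReal C, ENNReal.ofReal_ne_top, fun f y hy => enorm_schwartzConv_le (h y hy) f⟩

theorem enorm_coord_le (x : E4) (j : Fin 4) : ‖x j‖ₑ ≤ ‖x‖ₑ := by
  rw [← ofReal_norm, ← ofReal_norm]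
  exact ENNReal.ofReal_le_ofReal (PiLp.norm_apply_le x j)

theorem enorm_im_le (z : ℂ) : ‖z.im‖ₑ ≤ ‖z‖ₑ := by
  rw [← ofReal_norm, ← ofReal_norm, Real.norm_eq_abs]
  exact ENNReal.ofReal_le_ofReal (Complex.abs_im_le_norm z)

theorem enorm_conj (z : ℂ) : ‖(starRingEnd ℂ) z‖ₑ = ‖z‖ₑ := by
  rw [← ofReal_norm, ← ofReal_norm, RCLike.norm_conj]

/-- The vector field of the Morawetz action is bounded by one. -/
theorem enorm_mul_coord_le {p : Fin 4 → E4 → ℝ} (hp1 : ∀ x, ‖p 0 x‖ * ‖x‖ ≤ 1)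
    (x : E4) (j : Fin 4) : ‖p 0 x * x j‖ₑ ≤ 1 := by
  rw [enorm_mul]
  refine (mul_le_mul' le_rfl (enorm_coord_le x j)).trans ?_
  rw [← ofReal_norm, ← ofReal_norm, ← ENNReal.ofReal_mul (norm_nonneg _), ← ENNReal.ofReal_one]
  exact ENNReal.ofReal_le_ofReal (hp1 x)

namespace GoodSolution

variable {α b s M t₀ t₁ : ℝ} {U : ℝ → E4 → ℂ}

theorem ae_lintegral_wtMeasure_le (h : GoodSolution α b s M t₀ t₁ U) (hs1 : 1 < s) (hs2 : s < 2) :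
    ∃ A : ℝ≥0∞, A ≠ ∞ ∧ ∀ᵐ t ∂(volume.restrict (Ioc t₀ t₁)), LocallyIntegrable (U t) ∧
      ∫⁻ x, ‖U t x‖ₑ ∂wtMeasure ≤ A := by
  obtain ⟨C, hC, hCb⟩ := exists_lintegral_wtMeasure_le (by linarith : 0 < s) hs2
  refine ⟨ENNReal.ofReal C * ENNReal.ofReal M, by finiteness, ?_⟩
  filter_upwards [h.ae] with t ht
  have hl := locallyIntegrable_of_homSobolevNorm_lt_top (ht.trans_lt ENNReal.ofReal_lt_top)
  exact ⟨hl, (hCb _ hl).trans (mul_le_mul' le_rfl ht)⟩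

/-- The evolution of the Morawetz action of the mollified solution. -/
theorem momentum_eq (h : GoodSolution α b s M t₀ t₁ U) (hα : 0 < α) (hs1 : 1 < s) (hs2 : s < 2)
    (hb : 0 < b) (hbs : b < 3 - s) {R : ℝ} (hR : 0 < R) {p : Fin 4 → E4 → ℝ} (hp : RadialWeight R p)
    (hp1 : ∀ x, ‖p 0 x‖ * ‖x‖ ≤ 1) {ψ : 𝓢(E4, ℂ)} (hψ : HasCompactSupport ψ) :
    IntegrableOn (fun τ => ∫ y,
      (momentum p (convRhs (U τ) (nonlinearity α b (U τ)) ψ) (schwartzConv (U τ) ψ) y +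
      momentum p (schwartzConv (U τ) ψ) (convRhs (U τ) (nonlinearity α b (U τ)) ψ) y))
      (Ioc t₀ t₁) ∧
    (∫ y, momentum p (schwartzConv (U t₁) ψ) (schwartzConv (U t₁) ψ) y) -
      ∫ y, momentum p (schwartzConv (U t₀) ψ) (schwartzConv (U t₀) ψ) y =
      ∫ τ in Ioc t₀ t₁, ∫ y,
      (momentum p (convRhs (U τ) (nonlinearity α b (U τ)) ψ) (schwartzConv (U τ) ψ) y +
      momentum p (schwartzConv (U τ) ψ) (convRhs (U τ) (nonlinearity α b (U τ)) ψ) y) := by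
  set μ : Measure ℝ := volume.restrict (Ioc t₀ t₁) with hμ
  set B := Metric.closedBall (0 : E4) (2 * R) with hB
  set N : ℝ → E4 → ℂ := fun t => nonlinearity α b (U t) with hN
  set f : 𝓢(E4, ℂ) → ℝ → E4 → ℂ := fun χ τ => schwartzConv (U τ) χ with hf
  set w : 𝓢(E4, ℂ) → ℝ → E4 → ℂ := fun χ τ => convRhs (U τ) (N τ) χ with hw
  have hlt : ∀ {t}, homSobolevNorm s (U t) ≤ ENNReal.ofReal M → LocallyIntegrable (U t) := fun ht =>
    locallyIntegrable_of_homSobolevNorm_lt_top (ht.trans_lt ENNReal.ofReal_lt_top)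
  have hspd : ∀ j, HasCompactSupport (spd j ψ) := fun j => hasCompactSupport_spd hψ j
  have hmf : ∀ χ, Measurable fun q : ℝ × E4 => f χ q.1 q.2 := fun χ => measurable_schwartzConv h.meas χ
  have hmw : ∀ χ, Measurable fun q : ℝ × E4 => w χ q.1 q.2 := fun χ =>
    ((measurable_schwartzConv h.meas (slap χ)).const_mul Complex.I).sub
      ((measurable_schwartzConv h.measurable_nonlinearity χ).const_mul Complex.I)
  have hpm : Measurable (p 0) := (hp.contDiff 0).continuous.measurable
  -- The integrand with the derivatives moved to the mollifier, which is jointly measurable.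
  set Z : Fin 4 → ℝ → E4 → ℂ := fun j τ y =>
    (starRingEnd ℂ) (w ψ τ y) * f (spd j ψ) τ y + (starRingEnd ℂ) (f ψ τ y) * w (spd j ψ) τ y with hZ
  set H : Fin 4 → ℝ → E4 → ℝ := fun j τ y => p 0 y * y j * (Z j τ y).im with hH
  have hmH : ∀ j, Measurable fun q : ℝ × E4 => H j q.1 q.2 := by
    intro j
    have h1 := hmf ψ
    have h2 := hmw ψ
    have h3 := hmf (spd j ψ)
    have h4 := hmw (spd j ψ)
    have h5 : Measurable fun z : ℂ => (starRingEnd ℂ) z := Complex.continuous_conj.measurable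
    have h6 : Measurable fun q : ℝ × E4 => q.2 j := by fun_prop
    have h7 : Measurable fun q : ℝ × E4 => p 0 q.2 := hpm.comp measurable_snd
    exact (h7.mul h6).mul (Complex.measurable_im.comp
      (((h5.comp h2).mul h3).add ((h5.comp h1).mul h4)))
  have hHB : ∀ j τ y, y ∉ B → H j τ y = 0 := by
    intro j τ y hy
    rw [hB, mem_closedBall_zero_iff, not_le] at hy
    simp only [hH, hp.support 0 y hy.le, zero_mul]
  have hHi : ∀ j, Integrable (fun q : ℝ × E4 => H j q.1 q.2) (μ.prod volume) := by
    intro j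
    obtain ⟨A, hA, hAae⟩ := h.ae_lintegral_wtMeasure_le hs1 hs2
    have h2R : 0 ≤ 2 * R := by positivity
    obtain ⟨k₁, hk₁, b₁⟩ := exists_enorm_schwartzConv_le ψ h2R
    obtain ⟨k₂, hk₂, b₂⟩ := exists_enorm_schwartzConv_le (slap ψ) h2R
    obtain ⟨k₃, hk₃, b₃⟩ := exists_enorm_schwartzConv_le (spd j ψ) h2R
    obtain ⟨k₄, hk₄, b₄⟩ := exists_enorm_schwartzConv_le (slap (spd j ψ)) h2R
    set D : ℝ → ℝ≥0∞ := fun τ => ∫⁻ x, ‖N τ x‖ₑ ∂wtMeasure with hD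
    have hbound : ∀ᵐ τ ∂μ, ∀ y, ‖H j τ y‖ₑ ≤ B.indicator
        (fun _ => (k₂ * A * (k₃ * A) + k₁ * A * (k₄ * A)) +
          (k₁ * (k₃ * A) + k₁ * A * k₃) * D τ) y := by
      filter_upwards [hAae] with τ hτ y
      by_cases hy : y ∈ B
      · rw [indicator_of_mem hy]
        have c₁ := (b₁ (U τ) y hy).trans (mul_le_mul' le_rfl hτ.2)
        have c₂ := (b₂ (U τ) y hy).trans (mul_le_mul' le_rfl hτ.2)
        have c₃ := (b₃ (U τ) y hy).trans (mul_le_mul' le_rfl hτ.2)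
        have c₄ := (b₄ (U τ) y hy).trans (mul_le_mul' le_rfl hτ.2)
        have c₅ := b₁ (N τ) y hy
        have c₆ := b₃ (N τ) y hy
        have hI : ‖Complex.I‖ₑ = 1 := by rw [← ofReal_norm]; simp
        have hw1 : ‖w ψ τ y‖ₑ ≤ k₂ * A + k₁ * D τ := by
          refine (enorm_sub_le).trans ?_
          rw [enorm_mul, enorm_mul, hI, one_mul, one_mul]
          exact add_le_add c₂ c₅
        have hw2 : ‖w (spd j ψ) τ y‖ₑ ≤ k₄ * A + k₃ * D τ := by
          refine (enorm_sub_le).trans ?_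
          rw [enorm_mul, enorm_mul, hI, one_mul, one_mul]
          exact add_le_add c₄ c₆
        have hZb : ‖Z j τ y‖ₑ ≤ (k₂ * A + k₁ * D τ) * (k₃ * A) + k₁ * A * (k₄ * A + k₃ * D τ) := by
          refine (enorm_add_le _ _).trans ?_
          rw [enorm_mul, enorm_mul, enorm_conj, enorm_conj]
          exact add_le_add (mul_le_mul' hw1 c₃) (mul_le_mul' c₁ hw2)
        calc ‖H j τ y‖ₑ ≤ 1 * ‖Z j τ y‖ₑ := by
              rw [hH, enorm_mul]
              exact mul_le_mul' (enorm_mul_coord_le hp1 y j) (enorm_im_le _)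
          _ ≤ _ := by
              rw [one_mul]
              refine hZb.trans (le_of_eq ?_)
              ring
      · rw [hHB j τ y hy]
        simp
    refine ⟨(hmH j).aestronglyMeasurable, ?_⟩
    rw [HasFiniteIntegral, lintegral_prod _ (hmH j).enorm.aemeasurable]
    have hBvol : volume B ≠ ∞ := measure_closedBall_lt_top.ne
    calc ∫⁻ τ, ∫⁻ y, ‖H j τ y‖ₑ ∂volume ∂μ
        ≤ ∫⁻ τ, ((k₂ * A * (k₃ * A) + k₁ * A * (k₄ * A)) * volume B +
          (k₁ * (k₃ * A) + k₁ * A * k₃) * volume B * D τ) ∂μ := by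
          refine lintegral_mono_ae ?_
          filter_upwards [hbound] with τ hτ
          refine (lintegral_mono hτ).trans (le_of_eq ?_)
          rw [lintegral_indicator measurableSet_closedBall, setLIntegral_const]
          ring
      _ < ∞ := by
          rw [lintegral_add_left measurable_const, lintegral_const,
            lintegral_const_mul' _ _ (by finiteness)]
          have hDlt : ∫⁻ τ, D τ ∂μ < ∞ := h.lintegral_nonlinearity_lt_top hα hs1 hb hbs
          have hμlt : μ univ < ∞ := by rw [hμ, Measure.restrict_apply_univ]; exact measure_Ioc_lt_top
          finiteness
  have hsl : ∀ᵐ τ ∂μ, ∀ y, momentum p (w ψ τ) (f ψ τ) y + momentum p (f ψ τ) (w ψ τ) y =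
      ∑ j, H j τ y := by
    filter_upwards [h.ae, h.ae_nonlinearity_lt_top hα hs1 hb hbs] with τ h1 h2 y
    have hl := hlt h1
    have hlN : LocallyIntegrable (N τ) := locallyIntegrable_of_wtMeasure
      ((h.measurable_nonlinearity.comp measurable_prodMk_left).aestronglyMeasurable) h2
    simp only [momentum, hf, hw, pd_schwartzConv hl hψ, pd_convRhs hl hlN hψ, hH, hZ]
    rw [← Finset.sum_add_distrib]
    refine Finset.sum_congr rfl fun j _ => ?_
    rw [Complex.add_im, mul_add]
  have hQ : (fun τ => ∫ y, (momentum p (w ψ τ) (f ψ τ) y + momentum p (f ψ τ) (w ψ τ) y)) =ᵐ[μ]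
      fun τ => ∫ y, ∑ j, H j τ y := by
    filter_upwards [hsl] with τ hτ
    exact integral_congr_ae (Eventually.of_forall hτ)
  have hsumI : Integrable (fun q : ℝ × E4 => ∑ j, H j q.1 q.2) (μ.prod volume) :=
    integrable_finsetSum _ fun j _ => hHi j
  refine ⟨hsumI.integral_prod_left.congr hQ.symm, ?_⟩
  rw [integral_congr_ae hQ, integral_integral_swap (f := fun τ y => ∑ j, H j τ y) hsumI]
  have hend : ∀ {t}, homSobolevNorm s (U t) ≤ ENNReal.ofReal M → ∀ y,
      momentum p (f ψ t) (f ψ t) y =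
        ∑ j, p 0 y * y j * ((starRingEnd ℂ) (f ψ t y) * f (spd j ψ) t y).im := by
    intro t ht y
    simp only [momentum, hf, pd_schwartzConv (hlt ht) hψ]
  have hendi : ∀ {t}, homSobolevNorm s (U t) ≤ ENNReal.ofReal M →
      Integrable (momentum p (f ψ t) (f ψ t)) := by
    intro t ht
    have hsm := contDiff_schwartzConv (hlt ht) hψ
    have c1 := fun j => (contDiff_pd hsm j).continuous
    have c2 := hsm.continuous
    have c3 := fun j => (contDiff_coord j (n := 1)).continuous
    have c4 := (hp.contDiff 0).continuous
    have c5 := Complex.continuous_im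
    have c6 := Complex.continuous_conj
    refine Continuous.integrable_of_hasCompactSupport ?_ (hp.hasCompactSupport fun x hx => by
      simp [momentum, hx])
    unfold momentum
    exact continuous_finsetSum _ fun j _ => (c4.mul (c3 j)).mul
      (c5.comp ((c6.comp c2).mul (c1 j)))
  rw [← integral_sub (hendi h.right) (hendi h.left)]
  refine integral_congr_ae ?_
  have hHy : ∀ᵐ y, ∀ j, Integrable (fun τ => H j τ y) μ := by
    rw [ae_all_iff]
    exact fun j => (hHi j).prod_left_ae
  filter_upwards [hHy] with y hy
  rw [hend h.right, hend h.left, ← Finset.sum_sub_distrib, integral_finsetSum _ fun j _ => hy j]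
  refine Finset.sum_congr rfl fun j _ => ?_
  obtain ⟨r1, r2, r3⟩ := h.time_eq hα hs1 hs2 hb hbs ψ y
  obtain ⟨q1, q2, q3⟩ := h.time_eq hα hs1 hs2 hb hbs (spd j ψ) y
  have hconjInt : ∀ t, (starRingEnd ℂ) (∫ τ in Ioc t₀ t, w ψ τ y) =
      ∫ τ in Ioc t₀ t, (starRingEnd ℂ) (w ψ τ y) := fun t => integral_conj.symm
  obtain ⟨hZi, hpr⟩ := integral_product_rule (f := fun t => (starRingEnd ℂ) (f ψ t y))
    (g := fun t => f (spd j ψ) t y) (w := fun t => (starRingEnd ℂ) (w ψ t y))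
    (z := fun t => w (spd j ψ) t y) (f₀ := (starRingEnd ℂ) (f ψ t₀ y)) (g₀ := f (spd j ψ) t₀ y)
    (f₁ := (starRingEnd ℂ) (f ψ t₁ y)) (g₁ := f (spd j ψ) t₁ y)
    (Complex.conjCLE.toContinuousLinearMap.integrable_comp r1) q1
    (by rw [← map_sub, r2]; exact hconjInt t₁) q2
    (by filter_upwards [r3] with t ht
        rw [← map_sub, ht]; exact hconjInt t) q3
  simp only [hH]
  rw [integral_const_mul, ← mul_sub, ← Complex.sub_im, ← hpr]
  congr 1
  exact (Complex.imCLM.integral_comp_comm hZi).symm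

end GoodSolution

/-! ### The commutator of the mollification and the nonlinearity -/

/-- A consequence of Bernoulli's inequality, which covers `α < 1` as well as `α ≥ 1`. -/
theorem rpow_sub_rpow_mul_le {α x y : ℝ} (hα : 0 < α) (hy : 0 ≤ y) (hxy : y ≤ x) :
    (x ^ α - y ^ α) * y ≤ (α + 1) * x ^ α * (x - y) := by
  rcases hy.eq_or_lt with rfl | hy
  · simp only [mul_zero, sub_zero]
    positivity
  have hx : 0 < x := hy.trans_le hxy
  have h1 : 1 + (α + 1) * ((y - x) / x) ≤ (1 + (y - x) / x) ^ (α + 1) :=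
    one_add_mul_self_le_rpow_one_add (by rw [le_div_iff₀ hx]; linarith) (by linarith)
  have h2 : 1 + (y - x) / x = y / x := by field_simp; ring
  rw [h2, Real.div_rpow hy.le hx.le, le_div_iff₀ (by positivity)] at h1
  have h3 : x ^ (α + 1) = x ^ α * x := Real.rpow_add_one hx.ne' α
  have h4 : y ^ (α + 1) = y ^ α * y := Real.rpow_add_one hy.ne' α
  have h5 : (1 + (α + 1) * ((y - x) / x)) * x ^ (α + 1) =
      x ^ α * x - (α + 1) * x ^ α * (x - y) := by rw [h3]; field_simp; ring
  rw [h5, h4] at h1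
  have h6 : x ^ α * y ≤ x ^ α * x := mul_le_mul_of_nonneg_left hxy (by positivity)
  linarith

/-- The map `z ↦ |z|^α z` is locally Lipschitz, with a constant of the order `|z|^α`. -/
theorem norm_rpow_smul_sub_le {α : ℝ} (hα : 0 < α) (z w : ℂ) :
    ‖‖z‖ ^ α • z - ‖w‖ ^ α • w‖ ≤ (α + 2) * (‖z - w‖ * (‖z‖ + ‖w‖) ^ α) := by
  wlog h : ‖w‖ ≤ ‖z‖ generalizing z w
  · have := this w z (not_le.1 h).le
    rwa [norm_sub_rev, norm_sub_rev w z, add_comm ‖w‖] at this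
  have e : ‖z‖ ^ α • z - ‖w‖ ^ α • w = ‖z‖ ^ α • (z - w) + (‖z‖ ^ α - ‖w‖ ^ α) • w := by
    rw [smul_sub, sub_smul]; abel
  have h0 : 0 ≤ ‖z‖ ^ α - ‖w‖ ^ α := sub_nonneg.2 (Real.rpow_le_rpow (norm_nonneg _) h hα.le)
  have h1 : ‖z‖ ^ α ≤ (‖z‖ + ‖w‖) ^ α :=
    Real.rpow_le_rpow (norm_nonneg _) (by linarith [norm_nonneg w]) hα.le
  rw [e]
  refine (norm_add_le _ _).trans ?_
  rw [norm_smul, norm_smul, Real.norm_of_nonneg h0, Real.norm_of_nonneg (by positivity)]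
  calc ‖z‖ ^ α * ‖z - w‖ + (‖z‖ ^ α - ‖w‖ ^ α) * ‖w‖
      ≤ ‖z‖ ^ α * ‖z - w‖ + (α + 1) * ‖z‖ ^ α * (‖z‖ - ‖w‖) := by
        have := rpow_sub_rpow_mul_le hα (norm_nonneg w) h
        linarith
    _ ≤ ‖z‖ ^ α * ‖z - w‖ + (α + 1) * ‖z‖ ^ α * ‖z - w‖ := by
        gcongr; exact norm_sub_norm_le z w
    _ = (α + 2) * (‖z - w‖ * ‖z‖ ^ α) := by ring
    _ ≤ _ := by gcongr

/-- The regularized nonlinearity `(|x|² + η)^{-b/2} |f|^α f`. -/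
def regNonlinearity (α b η : ℝ) (f : E4 → ℂ) (x : E4) : ℂ :=
  ((‖x‖ ^ 2 + η) ^ (-b / 2) * ‖f x‖ ^ α) • f x

theorem regWeight_le {b η : ℝ} (hb : 0 < b) (hη : 0 < η) {x : E4} (hx : x ≠ 0) :
    (‖x‖ ^ 2 + η) ^ (-b / 2) ≤ ‖x‖ ^ (-b) := by
  have hx' : 0 < ‖x‖ := norm_pos_iff.2 hx
  calc (‖x‖ ^ 2 + η) ^ (-b / 2) ≤ (‖x‖ ^ 2) ^ (-b / 2) :=
        Real.rpow_le_rpow_of_nonpos (by positivity) (by linarith) (by linarith)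
    _ = ‖x‖ ^ (-b) := by
        rw [← Real.rpow_natCast, ← Real.rpow_mul hx'.le]
        congr 1
        push_cast
        ring

theorem tendsto_regWeight {b : ℝ} {x : E4} (hx : x ≠ 0) :
    Tendsto (fun n : ℕ => (‖x‖ ^ 2 + 1 / ((n : ℝ) + 1)) ^ (-b / 2)) atTop (𝓝 (‖x‖ ^ (-b))) := by
  have hx' : 0 < ‖x‖ := norm_pos_iff.2 hx
  have h1 : Tendsto (fun n : ℕ => ‖x‖ ^ 2 + 1 / ((n : ℝ) + 1)) atTop (𝓝 (‖x‖ ^ 2 + 0)) :=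
    tendsto_const_nhds.add tendsto_one_div_add_atTop_nhds_zero_nat
  rw [add_zero] at h1
  have h2 := h1.rpow_const (p := -b / 2) (Or.inl (by positivity))
  have e : (‖x‖ ^ 2) ^ (-b / 2) = ‖x‖ ^ (-b) := by
    rw [← Real.rpow_natCast, ← Real.rpow_mul hx'.le]
    congr 1
    push_cast
    ring
  rwa [e] at h2

/-- The error from replacing the function in the nonlinearity by another one and from regularizing
the weight. -/
theorem enorm_regNonlinearity_sub_le {α b η : ℝ} (hα : 0 < α) (hb : 0 < b) (hη : 0 < η) (f v : E4 → ℂ)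
    {x : E4} (hx : x ≠ 0) : ‖nonlinearity α b f x - regNonlinearity α b η v x‖ₑ ≤
      ENNReal.ofReal (α + 2) * (ENNReal.ofReal (‖x‖ ^ (-b)) *
        (‖v x - f x‖ₑ * (‖v x‖ₑ + ‖f x‖ₑ) ^ α)) +
      ENNReal.ofReal (‖x‖ ^ (-b) - (‖x‖ ^ 2 + η) ^ (-b / 2)) * ‖f x‖ₑ ^ (α + 1) := by
  have hw := regWeight_le hb hη hx
  set w := (‖x‖ ^ 2 + η) ^ (-b / 2) with hwdef
  have hw0 : 0 ≤ w := by positivity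
  have e : nonlinearity α b f x - regNonlinearity α b η v x =
      w • (‖f x‖ ^ α • f x - ‖v x‖ ^ α • v x) + (‖x‖ ^ (-b) - w) • (‖f x‖ ^ α • f x) := by
    rw [nonlinearity, regNonlinearity, ← Complex.real_smul, ← hwdef]
    module
  have hf : ‖f x‖ ^ (α + 1) = ‖f x‖ ^ α * ‖f x‖ := by
    rw [Real.rpow_add_of_nonneg (norm_nonneg _) hα.le zero_le_one, Real.rpow_one]
  have key : ‖nonlinearity α b f x - regNonlinearity α b η v x‖ ≤
      (α + 2) * (‖x‖ ^ (-b) * (‖v x - f x‖ * (‖v x‖ + ‖f x‖) ^ α)) +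
      (‖x‖ ^ (-b) - w) * ‖f x‖ ^ (α + 1) := by
    rw [e]
    refine (norm_add_le _ _).trans (add_le_add ?_ (le_of_eq ?_))
    · rw [norm_smul, Real.norm_of_nonneg hw0, norm_sub_rev]
      calc w * ‖‖v x‖ ^ α • v x - ‖f x‖ ^ α • f x‖
          ≤ ‖x‖ ^ (-b) * ((α + 2) * (‖v x - f x‖ * (‖v x‖ + ‖f x‖) ^ α)) := by
            gcongr
            exact norm_rpow_smul_sub_le hα _ _
        _ = _ := by ring
    · rw [norm_smul, norm_smul, Real.norm_of_nonneg (sub_nonneg.2 hw),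
        Real.norm_of_nonneg (by positivity), hf]
  have a1 : ENNReal.ofReal (‖v x - f x‖ * (‖v x‖ + ‖f x‖) ^ α) =
      ‖v x - f x‖ₑ * (‖v x‖ₑ + ‖f x‖ₑ) ^ α := by
    rw [ENNReal.ofReal_mul (norm_nonneg _), ← ENNReal.ofReal_rpow_of_nonneg (by positivity) hα.le,
      ENNReal.ofReal_add (norm_nonneg _) (norm_nonneg _), ofReal_norm, ofReal_norm, ofReal_norm]
  have a2 : ENNReal.ofReal (‖f x‖ ^ (α + 1)) = ‖f x‖ₑ ^ (α + 1) := by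
    rw [← ENNReal.ofReal_rpow_of_nonneg (norm_nonneg _) (by positivity), ofReal_norm]
  rw [← ofReal_norm, ← a1, ← a2]
  refine (ENNReal.ofReal_le_ofReal key).trans (le_of_eq ?_)
  rw [ENNReal.ofReal_add (by positivity) (mul_nonneg (sub_nonneg.2 hw) (by positivity)),
    ENNReal.ofReal_mul (by positivity), ENNReal.ofReal_mul (by positivity),
    ENNReal.ofReal_mul (sub_nonneg.2 hw)]

theorem lintegral_rpow_enorm_eq {X : Type*} [MeasurableSpace X] {μ : Measure X} (f : X → ℂ) {p : ℝ}
    (hp : 0 < p) : ∫⁻ x, ‖f x‖ₑ ^ p ∂μ = eLpNorm f (ENNReal.ofReal p) μ ^ p := by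
  rw [eLpNorm_eq_lintegral_rpow_enorm_toReal (by simpa using hp) ENNReal.ofReal_ne_top,
    ENNReal.toReal_ofReal hp.le, ← ENNReal.rpow_mul, one_div_mul_cancel hp.ne', ENNReal.rpow_one]

section
variable {α b s : ℝ}

theorem one_lt_powExp (hα : 0 < α) (hs1 : 1 < s) (hb : 0 < b) (hbs : b < 3 - s) :
    1 < powExp α b s := by
  rw [powExp, one_lt_div (powExp_den_pos hs1 hbs)]
  linarith

/-- Hölder's inequality, for the `L²` norm of `|x|^{-b}|f|^{α+1}` on a set of finite measure. -/
theorem exists_eLpNorm_nonlinear_le (hα : 0 < α) (hs1 : 1 < s) (hb : 0 < b) (hbs : b < 3 - s)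
    {V : ℝ} (hV : 0 < V) : ∃ C : ℝ≥0∞, C ≠ ∞ ∧ ∀ {ε : Type} [TopologicalSpace ε] [ContinuousENorm ε]
      (K : ℝ≥0∞), K ≠ ∞ → ∀ μ : Measure E4, μ ≤ volume → μ univ ≤ ENNReal.ofReal V →
      ∀ (f : E4 → ℝ≥0∞) (g : E4 → ε), AEMeasurable f μ →
      (∀ᵐ x ∂μ, ‖g x‖ₑ ≤ K * (ENNReal.ofReal (‖x‖ ^ (-b)) * f x ^ (α + 1))) →
      eLpNorm g 2 μ ≤ K * C * (∫⁻ x, f x ^ powExp α b s ∂μ) ^ ((α + 1) / powExp α b s) := by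
  have h5 := powExp_den_pos hs1 hbs
  obtain ⟨C, hC, h⟩ := exists_lintegral_nonlinear_sq_le (α := α) hs1 hb hbs hV
  refine ⟨ENNReal.ofReal C ^ (1 / 2 : ℝ), by finiteness, fun K hK μ hμ hμV f g hf hg => ?_⟩
  rw [eLpNorm_eq_lintegral_rpow_enorm_toReal (by simp) (by simp)]
  simp only [ENNReal.toReal_ofNat]
  calc (∫⁻ x, ‖g x‖ₑ ^ (2 : ℝ) ∂μ) ^ (1 / 2 : ℝ)
      ≤ (∫⁻ x, K ^ (2 : ℝ) * (ENNReal.ofReal (‖x‖ ^ (-b)) * f x ^ (α + 1)) ^ (2 : ℝ) ∂μ) ^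
          (1 / 2 : ℝ) := by
        refine ENNReal.rpow_le_rpow (lintegral_mono_ae ?_) (by norm_num)
        filter_upwards [hg] with x hx
        rw [← ENNReal.mul_rpow_of_nonneg _ _ (by norm_num)]
        exact ENNReal.rpow_le_rpow hx (by norm_num)
    _ ≤ (K ^ (2 : ℝ) * (ENNReal.ofReal C *
          (∫⁻ x, f x ^ powExp α b s ∂μ) ^ ((5 - s - 2 * b) / 4))) ^ (1 / 2 : ℝ) := by
        rw [lintegral_const_mul' _ _ (by finiteness)]
        exact ENNReal.rpow_le_rpow (mul_le_mul' le_rfl (h μ hμ hμV f hf)) (by norm_num)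
    _ = _ := by
        rw [ENNReal.mul_rpow_of_nonneg _ _ (by norm_num),
          ENNReal.mul_rpow_of_nonneg (ENNReal.ofReal C) _ (by norm_num), ← ENNReal.rpow_mul,
          ← ENNReal.rpow_mul, mul_assoc]
        congr 1
        · norm_num
        congr 2
        rw [powExp]
        field_simp
        norm_num

/-- The commutator of mollification and nonlinearity is bounded in `L²` of a ball, and tends to
zero. -/
theorem exists_eLpNorm_commutator_le (hα : 0 < α) (hs1 : 1 < s) (hb : 0 < b) (hbs : b < 3 - s)
    {ρ : ℝ} (hρ : 0 < ρ) : ∃ C : ℝ≥0∞, C ≠ ∞ ∧ ∀ f : E4 → ℂ, Measurable f → LocallyIntegrable f →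
      LocallyIntegrable (nonlinearity α b f) →
      ∫⁻ x, ‖f x‖ₑ ^ powExp α b s ∂wtMeasure < ∞ →
      (∀ n : ℕ, eLpNorm (fun x => schwartzConv (nonlinearity α b f) (moll n) x -
        regNonlinearity α b (1 / ((n : ℝ) + 1)) (schwartzConv f (moll n)) x) 2
        (volume.restrict (Metric.closedBall 0 ρ)) ≤
        C * (∫⁻ x, ‖f x‖ₑ ^ powExp α b s ∂wtMeasure) ^ ((α + 1) / powExp α b s)) ∧
      Tendsto (fun n : ℕ => eLpNorm (fun x => schwartzConv (nonlinearity α b f) (moll n) x -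
        regNonlinearity α b (1 / ((n : ℝ) + 1)) (schwartzConv f (moll n)) x) 2
        (volume.restrict (Metric.closedBall 0 ρ))) atTop (𝓝 0) := by
  have hp1 := one_lt_powExp hα hs1 hb hbs
  set p := powExp α b s with hp
  have hp0 : 0 < p := by linarith
  set κ := (α + 1) / p with hκ
  have hκ0 : 0 < κ := by positivity
  set B := Metric.closedBall (0 : E4) ρ with hB
  set B' := Metric.closedBall (0 : E4) (ρ + 1) with hB'
  have hBB' : B ⊆ B' := Metric.closedBall_subset_closedBall (by linarith)
  set μ : Measure E4 := volume.restrict B with hμ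
  set μ' : Measure E4 := volume.restrict B' with hμ'
  have hμμ' : μ ≤ μ' := Measure.restrict_mono hBB' le_rfl
  have hb0 := ballVol_pos
  have hV : 0 < ballVol * (ρ + 1) ^ (4 : ℕ) := by positivity
  have hμ'V : μ' univ ≤ ENNReal.ofReal (ballVol * (ρ + 1) ^ (4 : ℕ)) := by
    rw [hμ', Measure.restrict_apply_univ, hB', volume_closedBall_eq (by linarith)]
  have hμV := (hμμ' univ).trans hμ'V
  obtain ⟨C, hC, H⟩ := exists_eLpNorm_nonlinear_le hα hs1 hb hbs hV
  set c := ENNReal.ofReal ((1 + (ρ + 1)) ^ (8 : ℝ)) with hc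
  have hcf : c ≠ ∞ := ENNReal.ofReal_ne_top
  set c' := (2 : ℝ≥0∞) ^ (p - 1) * (2 * c) with hc'
  have hc'f : c' ≠ ∞ := by
    have : (2 : ℝ≥0∞) ^ (p - 1) ≠ ∞ := by finiteness
    finiteness
  set K := ENNReal.ofReal (α + 2) with hK
  have hKf : K ≠ ∞ := ENNReal.ofReal_ne_top
  refine ⟨2 * (C * c ^ κ) + (K * C * c' ^ κ + C * c ^ κ), by finiteness,
    fun f hfm hfl hNl hA => ?_⟩
  set A := ∫⁻ x, ‖f x‖ₑ ^ p ∂wtMeasure with hAdef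
  have hA' : ∫⁻ x, ‖f x‖ₑ ^ p ∂μ' ≤ c * A := setLIntegral_closedBall_le_wtMeasure (by linarith) _
  have hfB : ∫⁻ x, ‖f x‖ₑ ^ p ∂μ ≤ c * A := (lintegral_mono' hμμ' le_rfl).trans hA'
  set N := nonlinearity α b f with hN
  have hNm : Measurable N := by
    rw [hN]; unfold nonlinearity; fun_prop
  set v : ℕ → E4 → ℂ := fun n => schwartzConv f (moll n) with hv
  have hvc : ∀ n, Continuous (v n) := fun n =>
    (contDiff_schwartzConv hfl (hasCompactSupport_moll n)).continuous
  have hp1' : 1 ≤ ENNReal.ofReal p := by rw [← ENNReal.ofReal_one]; exact ENNReal.ofReal_le_ofReal hp1.le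
  have hvB : ∀ n, ∫⁻ x, ‖v n x‖ₑ ^ p ∂μ ≤ c * A := by
    intro n
    refine le_trans ?_ hA'
    rw [lintegral_rpow_enorm_eq _ hp0, lintegral_rpow_enorm_eq _ hp0]
    exact ENNReal.rpow_le_rpow (eLpNorm_restrict_schwartzConv_moll_le hfm.aestronglyMeasurable hp1'
      ENNReal.ofReal_ne_top n ρ) hp0.le
  have hsum : ∀ n, ∫⁻ x, (‖v n x‖ₑ + ‖f x‖ₑ) ^ p ∂μ ≤ c' * A := by
    intro n
    calc ∫⁻ x, (‖v n x‖ₑ + ‖f x‖ₑ) ^ p ∂μ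
        ≤ ∫⁻ x, 2 ^ (p - 1) * (‖v n x‖ₑ ^ p + ‖f x‖ₑ ^ p) ∂μ :=
          lintegral_mono fun x => ENNReal.rpow_add_le_mul_rpow_add_rpow _ _ hp1.le
      _ = 2 ^ (p - 1) * ((∫⁻ x, ‖v n x‖ₑ ^ p ∂μ) + ∫⁻ x, ‖f x‖ₑ ^ p ∂μ) := by
          rw [lintegral_const_mul' _ _ (by finiteness),
            lintegral_add_left ((hvc n).enorm.measurable.pow_const _)]
      _ ≤ 2 ^ (p - 1) * (c * A + c * A) :=
          mul_le_mul' le_rfl (add_le_add (hvB n) hfB)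
      _ = c' * A := by rw [hc']; ring
  have hNx : ∀ x, ‖N x‖ₑ ≤ 1 * (ENNReal.ofReal (‖x‖ ^ (-b)) * ‖f x‖ₑ ^ (α + 1)) := fun x => by
    rw [one_mul, hN, enorm_nonlinearity hα]
  have hNB' : eLpNorm N 2 μ' ≤ C * (c * A) ^ κ := by
    refine (H 1 ENNReal.one_ne_top μ' Measure.restrict_le_self hμ'V (fun x => ‖f x‖ₑ) N
      hfm.enorm.aemeasurable (Eventually.of_forall hNx)).trans ?_
    rw [one_mul]
    exact mul_le_mul' le_rfl (ENNReal.rpow_le_rpow hA' hκ0.le)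
  have hNB : eLpNorm N 2 μ ≤ C * (c * A) ^ κ := (eLpNorm_mono_measure _ hμμ').trans hNB'
  have hne0 : ∀ᵐ x ∂μ, x ≠ (0 : E4) := ae_restrict_of_ae (Measure.ae_ne volume 0)
  -- The three contributions: mollification of `N`, the difference of `v n` and `f`, and the
  -- regularization of the weight.
  set T₁ : ℕ → ℝ≥0∞ := fun n => eLpNorm (fun x => schwartzConv N (moll n) x - N x) 2 μ with hT₁
  set w : ℕ → E4 → ℝ := fun n x => (‖x‖ ^ 2 + 1 / ((n : ℝ) + 1)) ^ (-b / 2) with hw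
  set G₂ : ℕ → E4 → ℝ≥0∞ := fun n x => K * (ENNReal.ofReal (‖x‖ ^ (-b)) *
    (‖v n x - f x‖ₑ * (‖v n x‖ₑ + ‖f x‖ₑ) ^ α)) with hG₂
  set G₃ : ℕ → E4 → ℝ≥0∞ := fun n x => ENNReal.ofReal (‖x‖ ^ (-b) - w n x) * ‖f x‖ₑ ^ (α + 1) with hG₃
  have hwm : ∀ n, Measurable (w n) := fun n => by rw [hw]; fun_prop
  have hG₂m : ∀ n, Measurable (G₂ n) := fun n => by
    have := (hvc n).measurable
    rw [hG₂]; fun_prop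
  have hG₃m : ∀ n, Measurable (G₃ n) := fun n => by
    have := hwm n
    rw [hG₃]; fun_prop
  have htri : ∀ n, eLpNorm (fun x => schwartzConv N (moll n) x -
      regNonlinearity α b (1 / ((n : ℝ) + 1)) (v n) x) 2 μ ≤
      T₁ n + (eLpNorm (G₂ n) 2 μ + eLpNorm (G₃ n) 2 μ) := by
    intro n
    have hcm : Measurable fun x => schwartzConv N (moll n) x :=
      (contDiff_schwartzConv hNl (hasCompactSupport_moll n)).continuous.measurable
    have hrm : Measurable fun x => regNonlinearity α b (1 / ((n : ℝ) + 1)) (v n) x := by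
      have := (hvc n).measurable
      unfold regNonlinearity; fun_prop
    have e : (fun x => schwartzConv N (moll n) x - regNonlinearity α b (1 / ((n : ℝ) + 1)) (v n) x) =
        (fun x => schwartzConv N (moll n) x - N x) +
          fun x => N x - regNonlinearity α b (1 / ((n : ℝ) + 1)) (v n) x := by
      ext x; simp
    rw [e]
    refine (eLpNorm_add_le (hcm.sub hNm).aestronglyMeasurable (hNm.sub hrm).aestronglyMeasurable
      one_le_two).trans (add_le_add le_rfl ?_)
    refine le_trans ?_ (eLpNorm_add_le (hG₂m n).aestronglyMeasurable (hG₃m n).aestronglyMeasurable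
      one_le_two)
    refine eLpNorm_mono_enorm_ae ?_
    filter_upwards [hne0] with x hx
    exact enorm_regNonlinearity_sub_le hα hb (by positivity) f (v n) hx
  have hT₁le : ∀ n, T₁ n ≤ 2 * (C * (c * A) ^ κ) := by
    intro n
    have hcm : Measurable fun x => schwartzConv N (moll n) x :=
      (contDiff_schwartzConv hNl (hasCompactSupport_moll n)).continuous.measurable
    refine (eLpNorm_sub_le hcm.aestronglyMeasurable hNm.aestronglyMeasurable one_le_two).trans ?_
    rw [two_mul]
    exact add_le_add ((eLpNorm_restrict_schwartzConv_moll_le hNm.aestronglyMeasurable one_le_two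
      ENNReal.ofNat_ne_top n ρ).trans hNB') hNB
  have hcA : c * A ≠ ∞ := by have := hA.ne; finiteness
  have hc'A : c' * A ≠ ∞ := by have := hA.ne; finiteness
  have hT₁lim : Tendsto T₁ atTop (𝓝 0) :=
    tendsto_eLpNorm_schwartzConv_moll hNl one_le_two ENNReal.ofNat_ne_top
      (hNB'.trans_lt (by have : (c * A) ^ κ ≠ ∞ := by finiteness
                         exact (ENNReal.mul_lt_top hC.lt_top this.lt_top)))
  -- the interpolated function to which Hölder's inequality applies
  set h : ℕ → E4 → ℝ≥0∞ := fun n x => ‖v n x - f x‖ₑ ^ (1 / (α + 1)) *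
    (‖v n x‖ₑ + ‖f x‖ₑ) ^ (α / (α + 1)) with hh
  have hhm : ∀ n, Measurable (h n) := fun n => by
    have := (hvc n).measurable
    rw [hh]; fun_prop
  have hα1 : 0 < α + 1 := by linarith
  have hG₂le : ∀ n, eLpNorm (G₂ n) 2 μ ≤ K * C * (∫⁻ x, h n x ^ p ∂μ) ^ κ := by
    intro n
    refine H K hKf μ Measure.restrict_le_self hμV (h n) (G₂ n) (hhm n).aemeasurable
      (Eventually.of_forall fun x => le_of_eq ?_)
    rw [enorm_eq_self, hG₂, hh]
    simp only
    rw [ENNReal.mul_rpow_of_nonneg _ _ hα1.le, ← ENNReal.rpow_mul, ← ENNReal.rpow_mul,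
      one_div_mul_cancel hα1.ne', ENNReal.rpow_one, div_mul_cancel₀ _ hα1.ne']
  have hhS : ∀ n x, h n x ≤ ‖v n x‖ₑ + ‖f x‖ₑ := by
    intro n x
    calc h n x ≤ (‖v n x‖ₑ + ‖f x‖ₑ) ^ (1 / (α + 1)) * (‖v n x‖ₑ + ‖f x‖ₑ) ^ (α / (α + 1)) :=
          mul_le_mul' (ENNReal.rpow_le_rpow enorm_sub_le (by positivity)) le_rfl
      _ = ‖v n x‖ₑ + ‖f x‖ₑ := by
          rw [← ENNReal.rpow_add_of_nonneg _ _ (by positivity) (by positivity)]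
          have : 1 / (α + 1) + α / (α + 1) = 1 := by field_simp; ring
          rw [this, ENNReal.rpow_one]
  have hG₂le' : ∀ n, eLpNorm (G₂ n) 2 μ ≤ K * C * (c' * A) ^ κ := fun n =>
    (hG₂le n).trans (mul_le_mul' le_rfl (ENNReal.rpow_le_rpow
      ((lintegral_mono fun x => ENNReal.rpow_le_rpow (hhS n x) hp0.le).trans (hsum n)) hκ0.le))
  have hhlim : Tendsto (fun n => ∫⁻ x, h n x ^ p ∂μ) atTop (𝓝 0) := by
    have hconj : (α + 1).HolderConjugate ((α + 1) / α) := by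
      rw [Real.holderConjugate_iff]
      refine ⟨by linarith, ?_⟩
      field_simp
      ring
    have h1 : ∀ n, ∫⁻ x, h n x ^ p ∂μ ≤
        (eLpNorm (v n - f) (ENNReal.ofReal p) μ ^ p) ^ (1 / (α + 1)) *
          (c' * A) ^ (1 / ((α + 1) / α)) := by
      intro n
      have hm1 : AEMeasurable (fun x => ‖v n x - f x‖ₑ ^ (p / (α + 1))) μ :=
        (((hvc n).measurable.sub hfm).enorm.pow_const _).aemeasurable
      have hm2 : AEMeasurable (fun x => (‖v n x‖ₑ + ‖f x‖ₑ) ^ (p * α / (α + 1))) μ :=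
        (((hvc n).measurable.enorm.add hfm.enorm).pow_const _).aemeasurable
      have h2 := ENNReal.lintegral_mul_le_Lp_mul_Lq μ hconj hm1 hm2
      have e1 : ∀ x, h n x ^ p = ‖v n x - f x‖ₑ ^ (p / (α + 1)) *
          (‖v n x‖ₑ + ‖f x‖ₑ) ^ (p * α / (α + 1)) := by
        intro x
        rw [hh]
        simp only
        rw [ENNReal.mul_rpow_of_nonneg _ _ hp0.le, ← ENNReal.rpow_mul, ← ENNReal.rpow_mul]
        congr 2 <;> ring
      simp only [e1]
      refine h2.trans (mul_le_mul' (ENNReal.rpow_le_rpow (le_of_eq ?_) (by positivity))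
        (ENNReal.rpow_le_rpow ?_ (by positivity)))
      · rw [← lintegral_rpow_enorm_eq _ hp0]
        refine lintegral_congr fun x => ?_
        rw [← ENNReal.rpow_mul, div_mul_cancel₀ _ hα1.ne']
        rfl
      · refine (lintegral_mono fun x => ?_).trans (hsum n)
        rw [← ENNReal.rpow_mul]
        refine le_of_eq ?_
        congr 1
        field_simp
    have h3 : Tendsto (fun n => eLpNorm (v n - f) (ENNReal.ofReal p) μ) atTop (𝓝 0) := by
      refine tendsto_eLpNorm_schwartzConv_moll hfl hp1' ENNReal.ofReal_ne_top ?_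
      rw [eLpNorm_eq_lintegral_rpow_enorm_toReal (by simpa using hp0) ENNReal.ofReal_ne_top,
        ENNReal.toReal_ofReal hp0.le]
      have := hA'.trans_lt hcA.lt_top
      exact ENNReal.rpow_lt_top_of_nonneg (by positivity) this.ne
    have h4 : Tendsto (fun n => (eLpNorm (v n - f) (ENNReal.ofReal p) μ ^ p) ^ (1 / (α + 1)) *
        (c' * A) ^ (1 / ((α + 1) / α))) atTop (𝓝 0) := by
      have h5 := ENNReal.Tendsto.mul_const (b := (c' * A) ^ (1 / ((α + 1) / α)))
        (((ENNReal.continuous_rpow_const (y := 1 / (α + 1))).tendsto _).comp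
          (((ENNReal.continuous_rpow_const (y := p)).tendsto _).comp h3)) (Or.inr (by finiteness))
      rw [ENNReal.zero_rpow_of_pos hp0, ENNReal.zero_rpow_of_pos (by positivity), zero_mul] at h5
      exact h5
    exact tendsto_of_tendsto_of_tendsto_of_le_of_le tendsto_const_nhds h4 (fun n => zero_le) h1
  have hG₂lim : Tendsto (fun n => eLpNorm (G₂ n) 2 μ) atTop (𝓝 0) := by
    have h5 := ENNReal.Tendsto.const_mul (a := K * C)
      (((ENNReal.continuous_rpow_const (y := κ)).tendsto _).comp hhlim) (Or.inr (by finiteness))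
    rw [ENNReal.zero_rpow_of_pos hκ0, mul_zero] at h5
    exact tendsto_of_tendsto_of_tendsto_of_le_of_le tendsto_const_nhds h5 (fun n => zero_le) hG₂le
  have hG₃le : ∀ n, ∀ᵐ x ∂μ, G₃ n x ≤ ‖N x‖ₑ := by
    intro n
    filter_upwards [hne0] with x hx
    rw [hN, enorm_nonlinearity hα]
    refine mul_le_mul' (ENNReal.ofReal_le_ofReal ?_) le_rfl
    have : 0 ≤ w n x := by rw [hw]; positivity
    linarith
  have hG₃le' : ∀ n, eLpNorm (G₃ n) 2 μ ≤ C * (c * A) ^ κ := fun n =>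
    (eLpNorm_mono_enorm_ae ((hG₃le n).mono fun x hx => by rwa [enorm_eq_self])).trans hNB
  have hG₃lim : Tendsto (fun n => eLpNorm (G₃ n) 2 μ) atTop (𝓝 0) := by
    have e2 : ∀ n, eLpNorm (G₃ n) 2 μ = (∫⁻ x, G₃ n x ^ (2 : ℝ) ∂μ) ^ (1 / 2 : ℝ) := by
      intro n
      rw [eLpNorm_eq_lintegral_rpow_enorm_toReal (by simp) (by simp)]
      simp
    have hfin : ∫⁻ x, ‖N x‖ₑ ^ (2 : ℝ) ∂μ ≠ ∞ := by
      have := lintegral_rpow_enorm_eq (μ := μ) N two_pos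
      rw [this]
      have h2 : ENNReal.ofReal 2 = 2 := by simp
      rw [h2]
      have h3 : eLpNorm N 2 μ ≠ ∞ := (hNB.trans_lt (ENNReal.mul_lt_top hC.lt_top
        (ENNReal.rpow_lt_top_of_nonneg hκ0.le hcA))).ne
      finiteness
    have h1 : Tendsto (fun n => ∫⁻ x, G₃ n x ^ (2 : ℝ) ∂μ) atTop (𝓝 (∫⁻ _, 0 ∂μ)) := by
      refine tendsto_lintegral_of_dominated_convergence (fun x => ‖N x‖ₑ ^ (2 : ℝ))
        (fun n => (hG₃m n).pow_const _) (fun n => (hG₃le n).mono fun x hx =>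
          ENNReal.rpow_le_rpow hx (by norm_num)) hfin ?_
      filter_upwards [hne0] with x hx
      have h2 : Tendsto (fun n => ‖x‖ ^ (-b) - w n x) atTop (𝓝 (‖x‖ ^ (-b) - ‖x‖ ^ (-b))) :=
        tendsto_const_nhds.sub (tendsto_regWeight hx)
      rw [sub_self] at h2
      have h3 := ENNReal.Tendsto.mul_const (b := ‖f x‖ₑ ^ (α + 1)) (ENNReal.tendsto_ofReal h2)
        (Or.inr (by finiteness))
      rw [ENNReal.ofReal_zero, zero_mul] at h3
      have h4 := ((ENNReal.continuous_rpow_const (y := (2 : ℝ))).tendsto _).comp h3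
      rw [ENNReal.zero_rpow_of_pos two_pos] at h4
      exact h4
    simp only [e2]
    have h4 := ((ENNReal.continuous_rpow_const (y := (1 / 2 : ℝ))).tendsto _).comp h1
    rw [lintegral_zero, ENNReal.zero_rpow_of_pos (by norm_num)] at h4
    exact h4
  refine ⟨fun n => ?_, ?_⟩
  · refine (htri n).trans ((add_le_add (hT₁le n) (add_le_add (hG₂le' n) (hG₃le' n))).trans
      (le_of_eq ?_))
    rw [ENNReal.mul_rpow_of_nonneg _ _ hκ0.le, ENNReal.mul_rpow_of_nonneg _ _ hκ0.le]
    ring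
  · have := hT₁lim.add (hG₂lim.add hG₃lim)
    rw [add_zero, add_zero] at this
    exact tendsto_of_tendsto_of_tendsto_of_le_of_le tendsto_const_nhds this (fun n => zero_le) htri

end

/-! ### The Morawetz inequality on compact time intervals -/

/-- Integration of an inequality `G ≤ Q + E`, where `G ≥ 0` need not be integrable a priori and `E` is
only known to be dominated by `e`. -/
theorem lintegral_ofReal_le_of_le_add {X : Type*} [MeasurableSpace X] {μ : Measure X} {G Q E : X → ℝ}
    {e : X → ℝ≥0∞} (hG : ∀ᵐ x ∂μ, 0 ≤ G x) (hQ : Integrable Q μ) (he : AEMeasurable e μ)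
    (hE : ∀ᵐ x ∂μ, ENNReal.ofReal (E x) ≤ e x) (h : ∀ᵐ x ∂μ, G x ≤ Q x + E x) :
    ∫⁻ x, ENNReal.ofReal (G x) ∂μ ≤ ENNReal.ofReal (∫ x, Q x ∂μ) + ∫⁻ x, e x ∂μ := by
  by_cases hfin : ∫⁻ x, e x ∂μ = ∞
  · simp [hfin]
  have hei : Integrable (fun x => (e x).toReal) μ := integrable_toReal_of_lintegral_ne_top he hfin
  have hlt := ae_lt_top' he hfin
  have hle : ∀ᵐ x ∂μ, G x ≤ Q x + (e x).toReal := by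
    filter_upwards [hlt, hE, h] with x h1 h2 h3
    have := (ENNReal.ofReal_le_iff_le_toReal h1.ne).1 h2
    linarith
  calc ∫⁻ x, ENNReal.ofReal (G x) ∂μ ≤ ∫⁻ x, ENNReal.ofReal (Q x + (e x).toReal) ∂μ :=
        lintegral_mono_ae (hle.mono fun x hx => ENNReal.ofReal_le_ofReal hx)
    _ = ENNReal.ofReal (∫ x, (Q x + (e x).toReal) ∂μ) := by
        refine (ofReal_integral_eq_lintegral_ofReal (hQ.add hei) ?_).symm
        filter_upwards [hG, hle] with x h1 h2
        exact h1.trans h2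
    _ ≤ ENNReal.ofReal (∫ x, Q x ∂μ) + ENNReal.ofReal (∫ x, (e x).toReal ∂μ) := by
        rw [integral_add hQ hei]
        exact ENNReal.ofReal_add_le
    _ = _ := by
        rw [integral_toReal he hlt, ENNReal.ofReal_toReal hfin]

/-- Fatou's lemma for iterated integrals. -/
theorem lintegral_lintegral_le_liminf {X Y : Type*} [MeasurableSpace X] [MeasurableSpace Y]
    {μ : Measure X} {ν : Measure Y} [SFinite ν] {F : ℕ → X → Y → ℝ≥0∞} {g : X → Y → ℝ≥0∞}
    (hF : ∀ n, Measurable (Function.uncurry (F n)))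
    (h : ∀ᵐ x ∂μ, ∀ᵐ y ∂ν, g x y ≤ liminf (fun n => F n x y) atTop) :
    ∫⁻ x, ∫⁻ y, g x y ∂ν ∂μ ≤ liminf (fun n => ∫⁻ x, ∫⁻ y, F n x y ∂ν ∂μ) atTop := by
  refine le_trans (lintegral_mono_ae ?_) (lintegral_liminf_le fun n => (hF n).lintegral_prod_right')
  filter_upwards [h] with x hx
  exact (lintegral_mono_ae hx).trans
    (lintegral_liminf_le fun n => (hF n).comp measurable_prodMk_left)

theorem setIntegral_rpow_norm_le {g : E4 → ℂ} (hg : Continuous g) {S : Set E4} {r X : ℝ} (hr : 0 < r)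
    (hX : 0 ≤ X) (h : ∫⁻ x in S, ‖g x‖ₑ ^ r ≤ ENNReal.ofReal X) : ∫ x in S, ‖g x‖ ^ r ≤ X := by
  rw [integral_eq_lintegral_of_nonneg_ae (Eventually.of_forall fun x => by positivity)
    (by fun_prop (disch := exact hr.le))]
  refine ENNReal.toReal_le_of_le_ofReal hX (le_trans (le_of_eq (lintegral_congr fun x => ?_)) h)
  rw [← ENNReal.ofReal_rpow_of_nonneg (norm_nonneg _) hr.le, ofReal_norm]

section
variable {α b s : ℝ}

/-- Local bounds for a mollified function of `Ḣˢ`, with the scaling in the radius. -/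
theorem exists_slice_bounds (hα : 0 < α) (hs : s = 2 - (2 - b) / α) (hs1 : 1 < s) (hs2 : s < 2)
    (hb : 0 < b) : ∃ C : ℝ, 0 < C ∧ ∀ (f : E4 → ℂ) (n : ℕ) (R M : ℝ), 0 < R → 0 ≤ M →
      homSobolevNorm s f ≤ ENNReal.ofReal M →
      (∫ x in Metric.closedBall 0 (2 * R), ‖schwartzConv f (moll n) x‖ ^ 2 ≤
        C * R ^ (2 * s) * M ^ 2) ∧
      (∀ j, ∫ x in Metric.closedBall 0 (2 * R), ‖pd j (schwartzConv f (moll n)) x‖ ^ 2 ≤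
        C * R ^ (2 * s - 2) * M ^ 2) ∧
      ∫ x in Metric.closedBall 0 (2 * R), ‖schwartzConv f (moll n) x‖ ^ (α + 2) ≤
        C * R ^ (2 * s - 2 + b) * M ^ (α + 2) := by
  have hαs : α * s = 2 * α - 2 + b := by rw [hs]; field_simp; ring
  obtain ⟨C₁, hC₁, H₁⟩ := exists_lintegral_schwartzConv_rpow_le (s := s) (σ := s) (r := 2)
    (by linarith) hs2 two_pos (by linarith)
  obtain ⟨C₂, hC₂, H₂⟩ := exists_lintegral_schwartzConv_rpow_le (s := s) (σ := s - 1) (r := 2)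
    (by linarith) (by linarith) two_pos (by linarith)
  obtain ⟨C₃, hC₃, H₃⟩ := exists_lintegral_schwartzConv_rpow_le (s := s) (σ := s) (r := α + 2)
    (by linarith) hs2 (by linarith) (by nlinarith)
  have k₁ : 0 ≤ C₁ * 2 ^ (2 * s) := by positivity
  have k₂ : 0 ≤ C₂ * 2 ^ (2 * s - 2) := by positivity
  have k₃ : 0 ≤ C₃ * 2 ^ (2 * s - 2 + b) := by positivity
  set C := C₁ * 2 ^ (2 * s) + C₂ * 2 ^ (2 * s - 2) + C₃ * 2 ^ (2 * s - 2 + b) + 1 with hC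
  have hCpos : 0 < C := by linarith
  refine ⟨C, hCpos, fun f n R M hR hM hf => ?_⟩
  have hl := locallyIntegrable_of_homSobolevNorm_lt_top (hf.trans_lt ENNReal.ofReal_lt_top)
  have hψ := hasCompactSupport_moll n
  have hcont : Continuous (schwartzConv f (moll n)) := (contDiff_schwartzConv hl hψ).continuous
  have h2R : 0 < 2 * R := by positivity
  have conv : ∀ {c e r : ℝ}, 0 ≤ c → 0 < r → c * 2 ^ e ≤ C → ∀ {L : ℝ≥0∞},
      L ≤ ENNReal.ofReal (c * (2 * R) ^ e) * homSobolevNorm s f ^ r →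
      L ≤ ENNReal.ofReal (C * R ^ e * M ^ r) := by
    intro c e r hc hr hcC L hL
    refine hL.trans ?_
    have h1 : homSobolevNorm s f ^ r ≤ ENNReal.ofReal (M ^ r) := by
      rw [← ENNReal.ofReal_rpow_of_nonneg hM hr.le]
      exact ENNReal.rpow_le_rpow hf hr.le
    refine (mul_le_mul' le_rfl h1).trans ?_
    rw [← ENNReal.ofReal_mul (by positivity)]
    refine ENNReal.ofReal_le_ofReal (mul_le_mul_of_nonneg_right ?_ (by positivity))
    rw [Real.mul_rpow two_pos.le hR.le, ← mul_assoc]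
    exact mul_le_mul_of_nonneg_right hcC (by positivity)
  refine ⟨?_, fun j => ?_, ?_⟩
  · have h1 := conv hC₁ two_pos (by rw [hC, show 4 - 2 * (2 - s) = 2 * s by ring]; linarith)
      (H₁ f hl (moll n) hψ (fourier_moll_bound s n) (2 * R) h2R)
    have h2 := setIntegral_rpow_norm_le hcont two_pos (by positivity) h1
    simp only [Real.rpow_two] at h2
    rwa [show 4 - 2 * (2 - s) = 2 * s by ring] at h2
  · have h1 := conv hC₂ two_pos (by rw [hC, show 4 - 2 * (2 - (s - 1)) = 2 * s - 2 by ring]; linarith)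
      (H₂ f hl (spd j (moll n)) (hasCompactSupport_spd hψ j) (fourier_spd_moll_bound hs1 n j)
        (2 * R) h2R)
    have h2 := setIntegral_rpow_norm_le (contDiff_schwartzConv hl (hasCompactSupport_spd hψ j)).continuous
      two_pos (by positivity) h1
    simp only [Real.rpow_two] at h2
    rw [pd_schwartzConv hl hψ]
    rwa [show 4 - 2 * (2 - (s - 1)) = 2 * s - 2 by ring] at h2
  · have e : 4 - (α + 2) * (2 - s) = 2 * s - 2 + b := by linarith
    have h1 := conv hC₃ (by linarith) (by rw [hC, e]; linarith)
      (H₃ f hl (moll n) hψ (fourier_moll_bound s n) (2 * R) h2R)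
    have h2 := setIntegral_rpow_norm_le hcont (by linarith) (by positivity) h1
    rwa [e] at h2

end

section
variable {R : ℝ} {p : Fin 4 → E4 → ℝ} {v : E4 → ℂ}

/-- The Morawetz action is bounded by the local `L²` norms of the function and its gradient. -/
theorem abs_integral_momentum_le (hR : 0 < R) (hp : RadialWeight R p)
    (hp1 : ∀ x, ‖p 0 x‖ * ‖x‖ ≤ 1) (hv : ContDiff ℝ ((⊤ : ℕ∞) : WithTop ℕ∞) v) :
    |∫ x, momentum p v v x| ≤ 2 / R * (∫ x in Metric.closedBall 0 (2 * R), ‖v x‖ ^ 2) +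
      R / 2 * ∑ j, ∫ x in Metric.closedBall 0 (2 * R), ‖pd j v x‖ ^ 2 := by
  set B := Metric.closedBall (0 : E4) (2 * R) with hB
  have hBc : IsCompact B := isCompact_closedBall _ _
  have hvc := hv.continuous
  have hpc := fun j => (contDiff_pd hv j).continuous
  have hint : ∀ {f : E4 → ℝ}, Continuous f → IntegrableOn f B := fun hf =>
    hf.continuousOn.integrableOn_compact hBc
  have hsupp : ∫ x, momentum p v v x = ∫ x in B, momentum p v v x := by
    refine (setIntegral_eq_integral_of_forall_compl_eq_zero fun x hx => ?_).symm
    rw [hB, mem_closedBall_zero_iff, not_le] at hx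
    simp [momentum, hp.support 0 x hx.le]
  have hpt : ∀ x, ‖momentum p v v x‖ ≤ 2 / R * ‖v x‖ ^ 2 + R / 2 * ∑ j, ‖pd j v x‖ ^ 2 := by
    intro x
    have hj : ∀ j, ‖p 0 x * x j * ((starRingEnd ℂ) (v x) * pd j v x).im‖ ≤
        1 / (2 * R) * ‖v x‖ ^ 2 + R / 2 * ‖pd j v x‖ ^ 2 := by
      intro j
      have h1 : ‖p 0 x * x j‖ ≤ 1 := by
        rw [norm_mul]
        exact (mul_le_mul_of_nonneg_left (PiLp.norm_apply_le x j) (norm_nonneg _)).trans (hp1 x)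
      have h2 : ‖((starRingEnd ℂ) (v x) * pd j v x).im‖ ≤ ‖v x‖ * ‖pd j v x‖ := by
        rw [Real.norm_eq_abs]
        refine (Complex.abs_im_le_norm _).trans (le_of_eq ?_)
        rw [norm_mul, RCLike.norm_conj]
      rw [norm_mul]
      refine (mul_le_mul h1 h2 (norm_nonneg _) zero_le_one).trans ?_
      rw [one_mul]
      have h3 : 1 / (2 * R) * ‖v x‖ ^ 2 + R / 2 * ‖pd j v x‖ ^ 2 - ‖v x‖ * ‖pd j v x‖ =
          1 / (2 * R) * (‖v x‖ - R * ‖pd j v x‖) ^ 2 := by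
        field_simp
        ring
      have : 0 ≤ 1 / (2 * R) * (‖v x‖ - R * ‖pd j v x‖) ^ 2 := by positivity
      linarith
    refine (norm_sum_le _ _).trans ((Finset.sum_le_sum fun j _ => hj j).trans (le_of_eq ?_))
    rw [Finset.sum_add_distrib, Finset.sum_const, Finset.card_univ, Fintype.card_fin, Finset.mul_sum]
    simp only [nsmul_eq_mul]
    push_cast
    field_simp
    ring
  rw [hsupp]
  have i1 : IntegrableOn (fun x => 2 / R * ‖v x‖ ^ 2) B := hint (by fun_prop)
  have i2 : IntegrableOn (fun x => R / 2 * ∑ j, ‖pd j v x‖ ^ 2) B := hint (by fun_prop)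
  refine (norm_integral_le_of_norm_le (i1.add i2) (Eventually.of_forall hpt)).trans (le_of_eq ?_)
  simp only [Pi.add_apply]
  rw [integral_add i1 i2, integral_const_mul, integral_const_mul,
    integral_finsetSum _ fun j _ => hint (by fun_prop)]

/-- The constant depends on the weight, in particular on its regularization; it only multiplies the
commutator, which tends to zero. -/
theorem exists_norm_multW_sq_le (hp : RadialWeight R p) (hp1 : ∀ x, ‖p 0 x‖ * ‖x‖ ≤ 1) :
    ∃ D : ℝ, 0 ≤ D ∧ ∀ (v : E4 → ℂ) x,
      ‖multW p v x‖ ^ 2 ≤ 20 * (∑ j, ‖pd j v x‖ ^ 2) + D * ‖v x‖ ^ 2 := by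
  obtain ⟨D, hD⟩ := hp.contDiff_divW.continuous.bounded_above_of_compact_support
    (hp.hasCompactSupport fun x hx => by simp [divW, hx])
  have hD0 : 0 ≤ D := (norm_nonneg _).trans (hD 0)
  refine ⟨5 * D ^ 2, by positivity, fun v x => ?_⟩
  have h1 : ‖multW p v x‖ ≤ 2 * (∑ j, ‖pd j v x‖) + D * ‖v x‖ := by
    rw [multW]
    refine (norm_add_le _ _).trans (add_le_add ?_ ?_)
    · rw [Finset.smul_sum, Finset.mul_sum]
      refine (norm_sum_le _ _).trans (Finset.sum_le_sum fun j _ => ?_)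
      rw [smul_smul, norm_smul]
      refine mul_le_mul_of_nonneg_right ?_ (norm_nonneg _)
      rw [mul_assoc, norm_mul, Real.norm_two, norm_mul]
      have := (mul_le_mul_of_nonneg_left (PiLp.norm_apply_le x j) (norm_nonneg (p 0 x))).trans (hp1 x)
      linarith
    · rw [norm_smul]
      exact mul_le_mul_of_nonneg_right (hD x) (norm_nonneg _)
  refine (pow_le_pow_left₀ (norm_nonneg _) h1 2).trans ?_
  rw [show 5 * D ^ 2 * ‖v x‖ ^ 2 = 5 * (D * ‖v x‖) ^ 2 by ring]
  generalize D * ‖v x‖ = a₄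
  simp only [Fin.sum_univ_four]
  generalize ‖pd 0 v x‖ = a₀
  generalize ‖pd 1 v x‖ = a₁
  generalize ‖pd 2 v x‖ = a₂
  generalize ‖pd 3 v x‖ = a₃
  linarith [sq_nonneg (2 * a₀ - 2 * a₁), sq_nonneg (2 * a₀ - 2 * a₂), sq_nonneg (2 * a₀ - 2 * a₃),
    sq_nonneg (2 * a₀ - a₄), sq_nonneg (2 * a₁ - 2 * a₂), sq_nonneg (2 * a₁ - 2 * a₃),
    sq_nonneg (2 * a₁ - a₄), sq_nonneg (2 * a₂ - 2 * a₃), sq_nonneg (2 * a₂ - a₄),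
    sq_nonneg (2 * a₃ - a₄)]

end

section
variable {α b s : ℝ}

theorem ofReal_integral_mul_norm_le {f g : E4 → ℂ} (hf : Continuous f) (hg : Continuous g) {ρ Λ : ℝ}
    (hΛ : 0 ≤ Λ) (h : ∫ x in Metric.closedBall 0 ρ, ‖g x‖ ^ 2 ≤ Λ ^ 2) :
    ENNReal.ofReal (∫ x in Metric.closedBall 0 ρ, ‖f x‖ * ‖g x‖) ≤
      ENNReal.ofReal Λ * eLpNorm f 2 (volume.restrict (Metric.closedBall 0 ρ)) := by
  set μ : Measure E4 := volume.restrict (Metric.closedBall 0 ρ) with hμ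
  have hint : ∀ {h : E4 → ℝ}, Continuous h → Integrable h μ := fun hh =>
    hh.continuousOn.integrableOn_compact (isCompact_closedBall _ _)
  have e2 : ∀ k : E4 → ℂ, eLpNorm k 2 μ = (∫⁻ x, ‖k x‖ₑ ^ (2 : ℝ) ∂μ) ^ (1 / 2 : ℝ) := fun k => by
    rw [eLpNorm_eq_lintegral_rpow_enorm_toReal (by simp) (by simp)]
    simp
  have hgL : eLpNorm g 2 μ ≤ ENNReal.ofReal Λ := by
    have : ∫⁻ x, ‖g x‖ₑ ^ (2 : ℝ) ∂μ ≤ ENNReal.ofReal (Λ ^ (2 : ℝ)) := by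
      rw [Real.rpow_two]
      refine le_trans (le_of_eq ?_) (ENNReal.ofReal_le_ofReal h)
      rw [ofReal_integral_eq_lintegral_ofReal (hint (by fun_prop))
        (Eventually.of_forall fun x => by positivity)]
      refine lintegral_congr fun x => ?_
      rw [ENNReal.rpow_two, ENNReal.ofReal_pow (norm_nonneg _), ofReal_norm]
    rw [e2]
    refine (ENNReal.rpow_le_rpow this (by norm_num)).trans (le_of_eq ?_)
    rw [← ENNReal.ofReal_rpow_of_nonneg hΛ two_pos.le, ← ENNReal.rpow_mul]
    norm_num
  rw [ofReal_integral_eq_lintegral_ofReal (hint (by fun_prop))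
    (Eventually.of_forall fun x => by positivity)]
  have h1 := ENNReal.lintegral_mul_le_Lp_mul_Lq μ Real.HolderConjugate.two_two
    hf.enorm.measurable.aemeasurable hg.enorm.measurable.aemeasurable
  rw [← e2, ← e2] at h1
  calc ∫⁻ x, ENNReal.ofReal (‖f x‖ * ‖g x‖) ∂μ = ∫⁻ x, ‖f x‖ₑ * ‖g x‖ₑ ∂μ :=
        lintegral_congr fun x => by rw [ENNReal.ofReal_mul (norm_nonneg _), ofReal_norm, ofReal_norm]
    _ ≤ eLpNorm f 2 μ * eLpNorm g 2 μ := h1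
    _ ≤ _ := by rw [mul_comm]; exact mul_le_mul' hgL le_rfl

theorem continuous_regNonlinearity (hα : 0 < α) {η : ℝ} (hη : 0 < η) {v : E4 → ℂ}
    (hv : Continuous v) : Continuous (regNonlinearity α b η v) := by
  have c0 : Continuous fun x : E4 => (‖x‖ ^ 2 + η) ^ (-b / 2) :=
    (by fun_prop : Continuous fun x : E4 => ‖x‖ ^ 2 + η).rpow_const
      fun x => Or.inl (by positivity)
  have c3 : Continuous fun x => ‖v x‖ ^ α := hv.norm.rpow_const fun x => Or.inr hα.le
  exact (c0.mul c3).smul hv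

/-- The virial inequality for a mollified time slice. The error is controlled by the commutator of
mollification and nonlinearity. -/
theorem exists_slice_virial (hα : 0 < α) (hs : s = 2 - (2 - b) / α) (hs1 : 1 < s) (hs2 : s < 2)
    (hb : 0 < b) : ∃ C : ℝ, 0 < C ∧ ∀ R θ M : ℝ, 0 < R → 0 < θ → θ ≤ 1 → 0 ≤ M →
      ∃ Λ : ℝ, ∀ (f : E4 → ℂ) (n : ℕ), homSobolevNorm s f ≤ ENNReal.ofReal M →
      LocallyIntegrable (nonlinearity α b f) → ∃ E : ℝ,
      ENNReal.ofReal E ≤ ENNReal.ofReal Λ *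
        eLpNorm (fun x => schwartzConv (nonlinearity α b f) (moll n) x -
          regNonlinearity α b (1 / ((n : ℝ) + 1)) (schwartzConv f (moll n)) x) 2
          (volume.restrict (Metric.closedBall 0 (2 * R))) ∧
      3 * α / (α + 2) * (∫ x in Metric.closedBall (0 : E4) R,
        (‖x‖ ^ 2 + 1 / ((n : ℝ) + 1)) ^ (-b / 2) * (√(‖x‖ ^ 2 + θ * R ^ 2))⁻¹ *
          ‖schwartzConv f (moll n) x‖ ^ (α + 2)) ≤
      (∫ y, (momentum (weight R θ) (convRhs f (nonlinearity α b f) (moll n))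
          (schwartzConv f (moll n)) y +
        momentum (weight R θ) (schwartzConv f (moll n))
          (convRhs f (nonlinearity α b f) (moll n)) y)) +
      C * R ^ (2 * s - 3) * (M ^ 2 + M ^ (α + 2)) + E := by
  obtain ⟨C, hC, H⟩ := exists_slice_bounds hα hs hs1 hs2 hb
  obtain ⟨K, hK, V⟩ := exists_virial_lower_bound
  refine ⟨5 * K * C, by positivity, fun R θ M hR hθ hθ1 hM => ?_⟩
  have hp := radialWeight_weight hR hθ
  have hp1 : ∀ x, ‖weight R θ 0 x‖ * ‖x‖ ≤ 1 := fun x => by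
    rw [Real.norm_of_nonneg (weight_zero_nonneg hR x)]
    exact weight_zero_mul_norm_le hR hθ x
  obtain ⟨D, hD, hDb⟩ := exists_norm_multW_sq_le hp hp1
  set X := 20 * (4 * (C * R ^ (2 * s - 2) * M ^ 2)) + D * (C * R ^ (2 * s) * M ^ 2) with hX
  have hX0 : 0 ≤ X := by positivity
  refine ⟨√X, fun f n hf hN => ?_⟩
  have hl := locallyIntegrable_of_homSobolevNorm_lt_top (hf.trans_lt ENNReal.ofReal_lt_top)
  have hψ := hasCompactSupport_moll n
  set v := schwartzConv f (moll n) with hv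
  set F := schwartzConv (nonlinearity α b f) (moll n) with hF
  have hvs : ContDiff ℝ ((⊤ : ℕ∞) : WithTop ℕ∞) v := contDiff_schwartzConv hl hψ
  have hFs : ContDiff ℝ ((⊤ : ℕ∞) : WithTop ℕ∞) F := contDiff_schwartzConv hN hψ
  have hη : 0 < 1 / ((n : ℝ) + 1) := by positivity
  obtain ⟨b1, b2, b3⟩ := H f n R M hR hM hf
  have key := V hR hθ hθ1 hη hα hb.le hvs hFs
  rw [convRhs_eq hl hψ]
  set B := Metric.closedBall (0 : E4) (2 * R) with hB
  have hint : ∀ {f : E4 → ℝ}, Continuous f → IntegrableOn f B := fun hf =>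
    hf.continuousOn.integrableOn_compact (isCompact_closedBall _ _)
  have c1 := hvs.continuous
  have c2 := fun j => (contDiff_pd hvs j).continuous
  have c3 := continuous_multW hp hvs
  have c4 : Continuous fun x => F x - regNonlinearity α b (1 / ((n : ℝ) + 1)) v x :=
    hFs.continuous.sub (continuous_regNonlinearity hα hη c1)
  have c5 : Continuous fun x => ‖v x‖ ^ (α + 2) := c1.norm.rpow_const fun x => Or.inr (by linarith)
  have hsumj : ∑ j, ∫ x in B, ‖pd j v x‖ ^ 2 ≤ 4 * (C * R ^ (2 * s - 2) * M ^ 2) := by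
    refine (Finset.sum_le_sum fun j _ => b2 j).trans (le_of_eq ?_)
    simp
  have hsumi : ∫ x in B, ∑ j, ‖pd j v x‖ ^ 2 = ∑ j, ∫ x in B, ‖pd j v x‖ ^ 2 :=
    integral_finsetSum _ fun j _ => hint (by fun_prop)
  refine ⟨∫ x in B, ‖F x - regNonlinearity α b (1 / ((n : ℝ) + 1)) v x‖ * ‖multW (weight R θ) v x‖,
    ofReal_integral_mul_norm_le c4 c3 (Real.sqrt_nonneg _) ?_, ?_⟩
  · rw [Real.sq_sqrt hX0]
    have i1 : IntegrableOn (fun x => 20 * ∑ j, ‖pd j v x‖ ^ 2) B := hint (by fun_prop)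
    have i2 : IntegrableOn (fun x => D * ‖v x‖ ^ 2) B := hint (by fun_prop)
    calc ∫ x in B, ‖multW (weight R θ) v x‖ ^ 2
        ≤ ∫ x in B, (20 * (∑ j, ‖pd j v x‖ ^ 2) + D * ‖v x‖ ^ 2) :=
          integral_mono (hint (by fun_prop)) (Integrable.add i1 i2) fun x => hDb v x
      _ = 20 * (∑ j, ∫ x in B, ‖pd j v x‖ ^ 2) + D * ∫ x in B, ‖v x‖ ^ 2 := by
          rw [integral_add i1 i2, integral_const_mul, integral_const_mul, hsumi]
      _ ≤ X := add_le_add (mul_le_mul_of_nonneg_left hsumj (by norm_num))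
          (mul_le_mul_of_nonneg_left b1 hD)
  · refine key.trans ?_
    rw [add_assoc]
    refine add_le_add le_rfl ?_
    have i1 : IntegrableOn (fun x => K / R * ∑ j, ‖pd j v x‖ ^ 2) B := hint (by fun_prop)
    have i2 : IntegrableOn (fun x => K / R ^ 3 * ‖v x‖ ^ 2) B := hint (by fun_prop)
    have i3 : IntegrableOn (fun x => K / R * R ^ (-b) * ‖v x‖ ^ (α + 2)) B := hint (by fun_prop)
    have i4 : IntegrableOn (fun x => ‖F x - ((‖x‖ ^ 2 + 1 / ((n : ℝ) + 1)) ^ (-b / 2) * ‖v x‖ ^ α) • v x‖ *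
      ‖multW (weight R θ) v x‖) B := hint (c4.norm.mul c3.norm)
    have i12 : IntegrableOn (fun x => K / R * ∑ j, ‖pd j v x‖ ^ 2 + K / R ^ 3 * ‖v x‖ ^ 2) B :=
      i1.add i2
    have i123 : IntegrableOn (fun x => K / R * ∑ j, ‖pd j v x‖ ^ 2 + K / R ^ 3 * ‖v x‖ ^ 2 +
      K / R * R ^ (-b) * ‖v x‖ ^ (α + 2)) B := i12.add i3
    rw [integral_add i123 i4, integral_add i12 i3, integral_add i1 i2, integral_const_mul,
      integral_const_mul, integral_const_mul, hsumi]
    refine add_le_add ?_ le_rfl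
    have hr1 : R ^ (2 * s - 2) = R * R ^ (2 * s - 3) := by
      rw [show 2 * s - 2 = 1 + (2 * s - 3) by ring, Real.rpow_add hR, Real.rpow_one]
    have hr2 : R ^ (2 * s) = R ^ 3 * R ^ (2 * s - 3) := by
      rw [← Real.rpow_natCast, ← Real.rpow_add hR]
      congr 1
      push_cast
      ring
    have hr3 : R ^ (-b) * R ^ (2 * s - 2 + b) = R * R ^ (2 * s - 3) := by
      rw [← hr1, ← Real.rpow_add hR]
      congr 1
      ring
    have t1 : K / R * ∑ j, ∫ x in B, ‖pd j v x‖ ^ 2 ≤ 4 * K * C * R ^ (2 * s - 3) * M ^ 2 := by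
      refine (mul_le_mul_of_nonneg_left hsumj (by positivity)).trans (le_of_eq ?_)
      rw [hr1]
      field_simp
    have t2 : K / R ^ 3 * ∫ x in B, ‖v x‖ ^ 2 ≤ K * C * R ^ (2 * s - 3) * M ^ 2 := by
      refine (mul_le_mul_of_nonneg_left b1 (by positivity)).trans (le_of_eq ?_)
      rw [hr2]
      field_simp
    have t3 : K / R * R ^ (-b) * ∫ x in B, ‖v x‖ ^ (α + 2) ≤
        K * C * R ^ (2 * s - 3) * M ^ (α + 2) := by
      refine (mul_le_mul_of_nonneg_left b3 (by positivity)).trans (le_of_eq ?_)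
      calc K / R * R ^ (-b) * (C * R ^ (2 * s - 2 + b) * M ^ (α + 2))
          = K / R * C * M ^ (α + 2) * (R ^ (-b) * R ^ (2 * s - 2 + b)) := by ring
        _ = _ := by rw [hr3]; field_simp
    have t4 : 0 ≤ K * C * R ^ (2 * s - 3) * M ^ (α + 2) := by positivity
    linarith

end

namespace GoodSolution
variable {α b s M t₀ t₁ : ℝ} {U : ℝ → E4 → ℂ}

theorem ae_locallyIntegrable (h : GoodSolution α b s M t₀ t₁ U) (hα : 0 < α) (hs1 : 1 < s)
    (hb : 0 < b) (hbs : b < 3 - s) : ∀ᵐ t ∂(volume.restrict (Ioc t₀ t₁)),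
      homSobolevNorm s (U t) ≤ ENNReal.ofReal M ∧ LocallyIntegrable (U t) ∧
        LocallyIntegrable (nonlinearity α b (U t)) := by
  filter_upwards [h.ae, h.ae_nonlinearity_lt_top hα hs1 hb hbs] with t h1 h2
  exact ⟨h1, locallyIntegrable_of_homSobolevNorm_lt_top (h1.trans_lt ENNReal.ofReal_lt_top),
    locallyIntegrable_of_wtMeasure
      ((h.measurable_nonlinearity.comp measurable_prodMk_left).aestronglyMeasurable) h2⟩

theorem measurable_commutator (h : GoodSolution α b s M t₀ t₁ U) (ρ : ℝ) (n : ℕ) :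
    Measurable fun t => eLpNorm (fun x => schwartzConv (nonlinearity α b (U t)) (moll n) x -
      regNonlinearity α b (1 / ((n : ℝ) + 1)) (schwartzConv (U t) (moll n)) x) 2
      (volume.restrict (Metric.closedBall 0 ρ)) := by
  simp only [eLpNorm_eq_lintegral_rpow_enorm_toReal (p := 2) (by simp) (by simp)]
  have h1 := measurable_schwartzConv h.meas (moll n)
  have h2 := measurable_schwartzConv h.measurable_nonlinearity (moll n)
  have h3 : Measurable fun q : ℝ × E4 => ‖schwartzConv (nonlinearity α b (U q.1)) (moll n) q.2 -
      regNonlinearity α b (1 / ((n : ℝ) + 1)) (schwartzConv (U q.1) (moll n)) q.2‖ₑ ^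
        (2 : ℝ≥0∞).toReal := by
    refine Measurable.pow_const (Measurable.enorm (h2.sub ?_)) _
    unfold regNonlinearity
    have h4 : Measurable fun q : ℝ × E4 => (‖q.2‖ ^ 2 + 1 / ((n : ℝ) + 1)) ^ (-b / 2) *
        ‖schwartzConv (U q.1) (moll n) q.2‖ ^ α := by fun_prop
    exact h4.smul h1
  exact h3.lintegral_prod_right'.pow_const _

/-- Dominated convergence in time, with the nonlinear estimate as the dominating function. -/
theorem tendsto_commutator (h : GoodSolution α b s M t₀ t₁ U) (hα : 0 < α) (hs1 : 1 < s)
    (hb : 0 < b) (hbs : b < 3 - s) {ρ : ℝ} (hρ : 0 < ρ) :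
    Tendsto (fun n : ℕ => ∫⁻ t in Ioc t₀ t₁,
      eLpNorm (fun x => schwartzConv (nonlinearity α b (U t)) (moll n) x -
        regNonlinearity α b (1 / ((n : ℝ) + 1)) (schwartzConv (U t) (moll n)) x) 2
        (volume.restrict (Metric.closedBall 0 ρ))) atTop (𝓝 0) := by
  obtain ⟨C, hC, H⟩ := exists_eLpNorm_commutator_le (s := s) hα hs1 hb hbs hρ
  have hp : 0 < powExp α b s := by linarith [one_lt_powExp hα hs1 hb hbs]
  have hκ : 0 < (α + 1) / powExp α b s := by positivity
  have : SFinite wtMeasure := by unfold wtMeasure; infer_instance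
  have hmp : Measurable fun t => ∫⁻ x, ‖U t x‖ₑ ^ powExp α b s ∂wtMeasure :=
    Measurable.lintegral_prod_right' (f := fun q : ℝ × E4 => ‖U q.1 q.2‖ₑ ^ powExp α b s)
      (h.meas.enorm.pow_const _)
  have hfin : ∀ᵐ t ∂(volume.restrict (Ioc t₀ t₁)),
      ∫⁻ x, ‖U t x‖ₑ ^ powExp α b s ∂wtMeasure < ∞ := by
    filter_upwards [ae_lt_top (hmp.pow_const _) h.nonlin.ne] with t ht
    exact (ENNReal.rpow_lt_top_iff_of_pos hκ).1 ht
  have hall := ((h.ae_locallyIntegrable hα hs1 hb hbs).and hfin).mono fun t ht =>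
    H (U t) (h.measurable_slice t) ht.1.2.1 ht.1.2.2 ht.2
  have h0 : ∫⁻ t in Ioc t₀ t₁, (0 : ℝ≥0∞) = 0 := by simp
  rw [← h0]
  refine tendsto_lintegral_of_dominated_convergence
    (fun t => C * (∫⁻ x, ‖U t x‖ₑ ^ powExp α b s ∂wtMeasure) ^ ((α + 1) / powExp α b s))
    (fun n => h.measurable_commutator ρ n) (fun n => hall.mono fun t ht => ht.1 n) ?_
    (hall.mono fun t ht => ht.2)
  rw [lintegral_const_mul' _ _ hC]
  exact ENNReal.mul_ne_top hC h.nonlin.ne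

end GoodSolution

section
variable {α b s : ℝ}

/-- The Morawetz inequality for the mollified solution, up to the commutator of mollification and
nonlinearity. -/
theorem exists_moll_morawetz (hα : 0 < α) (hs : s = 2 - (2 - b) / α) (hs1 : 1 < s) (hs2 : s < 2)
    (hb : 0 < b) (hbs : b < 3 - s) : ∃ C : ℝ, 0 < C ∧ ∀ {R θ M t₀ t₁ : ℝ} {U : ℝ → E4 → ℂ},
      0 < R → 0 < θ → θ ≤ 1 → 0 ≤ M → t₁ - t₀ ≤ R ^ 2 → GoodSolution α b s M t₀ t₁ U →
      ∃ Λ : ℝ≥0∞, Λ ≠ ∞ ∧ ∀ n : ℕ,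
      ∫⁻ t in Ioc t₀ t₁, ENNReal.ofReal (3 * α / (α + 2) * (∫ x in Metric.closedBall (0 : E4) R,
        (‖x‖ ^ 2 + 1 / ((n : ℝ) + 1)) ^ (-b / 2) * (√(‖x‖ ^ 2 + θ * R ^ 2))⁻¹ *
          ‖schwartzConv (U t) (moll n) x‖ ^ (α + 2))) ≤
        ENNReal.ofReal (C * R ^ (2 * s - 1) * (M ^ 2 + M ^ (α + 2))) + Λ * ∫⁻ t in Ioc t₀ t₁,
          eLpNorm (fun x => schwartzConv (nonlinearity α b (U t)) (moll n) x -
            regNonlinearity α b (1 / ((n : ℝ) + 1)) (schwartzConv (U t) (moll n)) x) 2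
            (volume.restrict (Metric.closedBall 0 (2 * R))) := by
  obtain ⟨C₁, hC₁, H₁⟩ := exists_slice_bounds hα hs hs1 hs2 hb
  obtain ⟨C₂, hC₂, H₂⟩ := exists_slice_virial hα hs hs1 hs2 hb
  refine ⟨8 * C₁ + C₂, by positivity, fun {R θ M t₀ t₁ U} hR hθ hθ1 hM hlen h => ?_⟩
  obtain ⟨Λ, HΛ⟩ := H₂ R θ M hR hθ hθ1 hM
  refine ⟨ENNReal.ofReal Λ, ENNReal.ofReal_ne_top, fun n => ?_⟩
  have hp := radialWeight_weight hR hθ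
  have hp1 : ∀ x, ‖weight R θ 0 x‖ * ‖x‖ ≤ 1 := fun x => by
    rw [Real.norm_of_nonneg (weight_zero_nonneg hR x)]
    exact weight_zero_mul_norm_le hR hθ x
  obtain ⟨hQi, hQ⟩ := h.momentum_eq hα hs1 hs2 hb hbs hR hp hp1 (hasCompactSupport_moll n)
  have hr1 : R * R ^ (2 * s - 2) = R ^ (2 * s - 1) := by
    rw [show 2 * s - 1 = 1 + (2 * s - 2) by ring, Real.rpow_add hR, Real.rpow_one]
  have hr2 : R ^ (2 * s) = R * R ^ (2 * s - 1) := by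
    rw [show 2 * s = 1 + (2 * s - 1) by ring, Real.rpow_add hR, Real.rpow_one]
    ring_nf
  have hr3 : R ^ 2 * R ^ (2 * s - 3) = R ^ (2 * s - 1) := by
    rw [show 2 * s - 1 = ((2 : ℕ) : ℝ) + (2 * s - 3) by push_cast; ring, Real.rpow_add hR,
      Real.rpow_natCast]
  have hend : ∀ {t}, homSobolevNorm s (U t) ≤ ENNReal.ofReal M →
      |∫ y, momentum (weight R θ) (schwartzConv (U t) (moll n)) (schwartzConv (U t) (moll n)) y| ≤
        4 * C₁ * R ^ (2 * s - 1) * M ^ 2 := by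
    intro t ht
    have hl := locallyIntegrable_of_homSobolevNorm_lt_top (ht.trans_lt ENNReal.ofReal_lt_top)
    obtain ⟨b1, b2, -⟩ := H₁ (U t) n R M hR hM ht
    have hsumj := Finset.sum_le_sum fun j (_ : j ∈ Finset.univ) => b2 j
    refine (abs_integral_momentum_le hR hp hp1 (contDiff_schwartzConv hl
      (hasCompactSupport_moll n))).trans ?_
    calc _ ≤ 2 / R * (C₁ * R ^ (2 * s) * M ^ 2) +
          R / 2 * ∑ j : Fin 4, C₁ * R ^ (2 * s - 2) * M ^ 2 :=
          add_le_add (mul_le_mul_of_nonneg_left b1 (by positivity))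
            (mul_le_mul_of_nonneg_left hsumj (by positivity))
      _ = 2 * C₁ * R ^ (2 * s - 1) * M ^ 2 + 2 * C₁ * (R * R ^ (2 * s - 2)) * M ^ 2 := by
          rw [hr2, Finset.sum_const, Finset.card_univ, Fintype.card_fin]
          simp only [nsmul_eq_mul]
          push_cast
          field_simp
          ring
      _ = _ := by rw [hr1]; ring
  set c := C₂ * R ^ (2 * s - 3) * (M ^ 2 + M ^ (α + 2)) with hc
  have hc0 : 0 ≤ c := by positivity
  set Q : ℝ → ℝ := fun τ => ∫ y, (momentum (weight R θ)
      (convRhs (U τ) (nonlinearity α b (U τ)) (moll n)) (schwartzConv (U τ) (moll n)) y +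
      momentum (weight R θ) (schwartzConv (U τ) (moll n))
        (convRhs (U τ) (nonlinearity α b (U τ)) (moll n)) y) with hQdef
  have hci : IntegrableOn (fun _ : ℝ => c) (Ioc t₀ t₁) := by simp
  have hall := (h.ae_locallyIntegrable hα hs1 hb hbs).mono fun t ht => HΛ (U t) n ht.1 ht.2.2
  set G : ℝ → ℝ := fun t => 3 * α / (α + 2) * (∫ x in Metric.closedBall (0 : E4) R,
        (‖x‖ ^ 2 + 1 / ((n : ℝ) + 1)) ^ (-b / 2) * (√(‖x‖ ^ 2 + θ * R ^ 2))⁻¹ *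
          ‖schwartzConv (U t) (moll n) x‖ ^ (α + 2)) with hG
  have hG0 : ∀ t, 0 ≤ G t := fun t =>
    mul_nonneg (by positivity) (integral_nonneg fun x => by positivity)
  choose! E hE using fun t => fun ht : ∃ E : ℝ, ENNReal.ofReal E ≤ ENNReal.ofReal Λ *
      eLpNorm (fun x => schwartzConv (nonlinearity α b (U t)) (moll n) x -
        regNonlinearity α b (1 / ((n : ℝ) + 1)) (schwartzConv (U t) (moll n)) x) 2
        (volume.restrict (Metric.closedBall 0 (2 * R))) ∧ G t ≤ Q t + c + E => ht
  have := lintegral_ofReal_le_of_le_add (μ := volume.restrict (Ioc t₀ t₁)) (G := G)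
    (Q := fun t => Q t + c) (E := E) (Eventually.of_forall hG0) (hQi.add hci)
    ((h.measurable_commutator (2 * R) n).const_mul (ENNReal.ofReal Λ)).aemeasurable
    (hall.mono fun t ht => (hE t ht).1) (hall.mono fun t ht => (hE t ht).2)
  refine this.trans ?_
  rw [lintegral_const_mul' _ _ ENNReal.ofReal_ne_top, integral_add hQi hci, ← hQ]
  refine add_le_add (ENNReal.ofReal_le_ofReal ?_) le_rfl
  have e1 := abs_le.1 (hend h.right)
  have e2 := abs_le.1 (hend h.left)
  have e3 : ∫ _ in Ioc t₀ t₁, c ≤ C₂ * R ^ (2 * s - 1) * (M ^ 2 + M ^ (α + 2)) := by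
    rw [setIntegral_const, smul_eq_mul, Real.volume_real_Ioc_of_le h.le]
    refine (mul_le_mul_of_nonneg_right hlen hc0).trans (le_of_eq ?_)
    rw [hc, ← hr3]
    ring
  have e4 : 0 ≤ 8 * C₁ * R ^ (2 * s - 1) * M ^ (α + 2) := by positivity
  linarith [e1.2, e2.1]

end

section
variable {α b s : ℝ}

theorem tendsto_ofReal_mul_enorm_rpow {r : ℝ} (a : ℕ → ℝ) {a₀ : ℝ} (ha : Tendsto a atTop (𝓝 a₀))
    {z : ℕ → ℂ} {z₀ : ℂ} (hz : Tendsto z atTop (𝓝 z₀)) (hr : 0 < r) :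
    Tendsto (fun n => ENNReal.ofReal (a n) * ‖z n‖ₑ ^ r) atTop
      (𝓝 (ENNReal.ofReal a₀ * ‖z₀‖ₑ ^ r)) := by
  refine ENNReal.Tendsto.mul (ENNReal.tendsto_ofReal ha) (Or.inr ?_)
    ((ENNReal.continuous_rpow_const.tendsto _).comp hz.enorm) (Or.inr ENNReal.ofReal_ne_top)
  exact ENNReal.rpow_ne_top_of_nonneg hr.le enorm_ne_top

/-- The Morawetz inequality, with the weight regularized at the origin. -/
theorem exists_regularized_morawetz (hα : 0 < α) (hs : s = 2 - (2 - b) / α) (hs1 : 1 < s)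
    (hs2 : s < 2) (hb : 0 < b) (hbs : b < 3 - s) : ∃ C : ℝ, 0 < C ∧
      ∀ {R θ M t₀ t₁ : ℝ} {U : ℝ → E4 → ℂ}, 0 < R → 0 < θ → θ ≤ 1 → 0 ≤ M → t₁ - t₀ ≤ R ^ 2 →
      GoodSolution α b s M t₀ t₁ U →
      ∫⁻ t in Ioc t₀ t₁, ∫⁻ x in Metric.closedBall (0 : E4) R,
        ENNReal.ofReal (‖x‖ ^ (-b) * (√(‖x‖ ^ 2 + θ * R ^ 2))⁻¹) * ‖U t x‖ₑ ^ (α + 2) ≤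
        ENNReal.ofReal (C * R ^ (2 * s - 1) * (M ^ 2 + M ^ (α + 2))) := by
  obtain ⟨C, hC, H⟩ := exists_moll_morawetz hα hs hs1 hs2 hb hbs
  have hα2 : 0 < α + 2 := by linarith
  refine ⟨(α + 2) / (3 * α) * C, by positivity, fun {R θ M t₀ t₁ U} hR hθ hθ1 hM hlen h => ?_⟩
  obtain ⟨Λ, hΛ, HΛ⟩ := H hR hθ hθ1 hM hlen h
  set d : ℕ → ℝ≥0∞ := fun n => ∫⁻ t in Ioc t₀ t₁,
    eLpNorm (fun x => schwartzConv (nonlinearity α b (U t)) (moll n) x -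
      regNonlinearity α b (1 / ((n : ℝ) + 1)) (schwartzConv (U t) (moll n)) x) 2
      (volume.restrict (Metric.closedBall 0 (2 * R))) with hd
  have hdlim : Tendsto d atTop (𝓝 0) := h.tendsto_commutator hα hs1 hb hbs (by positivity)
  set X := C * R ^ (2 * s - 1) * (M ^ 2 + M ^ (α + 2)) with hX
  set F : ℕ → ℝ → E4 → ℝ≥0∞ := fun n t x =>
    ENNReal.ofReal ((‖x‖ ^ 2 + 1 / ((n : ℝ) + 1)) ^ (-b / 2) * (√(‖x‖ ^ 2 + θ * R ^ 2))⁻¹) *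
      ‖schwartzConv (U t) (moll n) x‖ₑ ^ (α + 2) with hF
  have hFm : ∀ n, Measurable (Function.uncurry (F n)) := by
    intro n
    have h1 := measurable_schwartzConv h.meas (moll n)
    have h2 : Measurable fun q : ℝ × E4 => ENNReal.ofReal
      ((‖q.2‖ ^ 2 + 1 / ((n : ℝ) + 1)) ^ (-b / 2) * (√(‖q.2‖ ^ 2 + θ * R ^ 2))⁻¹) := by fun_prop
    exact h2.mul (h1.enorm.pow_const _)
  have hgood := h.ae_locallyIntegrable hα hs1 hb hbs
  have hFle : ∀ n, ∫⁻ t in Ioc t₀ t₁, ∫⁻ x in Metric.closedBall (0 : E4) R, F n t x ≤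
      ENNReal.ofReal ((α + 2) / (3 * α)) * (ENNReal.ofReal X + Λ * d n) := by
    intro n
    refine le_trans ?_ (mul_le_mul' le_rfl (HΛ n))
    rw [← lintegral_const_mul' _ _ ENNReal.ofReal_ne_top]
    refine lintegral_mono_ae ?_
    filter_upwards [hgood] with t ht
    have hv := (contDiff_schwartzConv ht.2.1 (hasCompactSupport_moll n)).continuous
    have hpos : ∀ x : E4, 0 < ‖x‖ ^ 2 + 1 / ((n : ℝ) + 1) := fun x => by positivity
    have hpos' : ∀ x : E4, 0 < ‖x‖ ^ 2 + θ * R ^ 2 := fun x => by positivity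
    have c0 : Continuous fun x : E4 => (‖x‖ ^ 2 + 1 / ((n : ℝ) + 1)) ^ (-b / 2) :=
      (by fun_prop : Continuous fun x : E4 => ‖x‖ ^ 2 + 1 / ((n : ℝ) + 1)).rpow_const
        fun x => Or.inl (hpos x).ne'
    have c1 : Continuous fun x : E4 => (√(‖x‖ ^ 2 + θ * R ^ 2))⁻¹ :=
      (by fun_prop : Continuous fun x : E4 => √(‖x‖ ^ 2 + θ * R ^ 2)).inv₀
        fun x => (Real.sqrt_pos.2 (hpos' x)).ne'
    have c2 := hv.norm.rpow_const (p := α + 2) fun x => Or.inr hα2.le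
    rw [← ENNReal.ofReal_mul (by positivity), ← mul_assoc]
    have e : (α + 2) / (3 * α) * (3 * α / (α + 2)) = 1 := by field_simp
    have c3 : IntegrableOn (fun x : E4 => (‖x‖ ^ 2 + 1 / ((n : ℝ) + 1)) ^ (-b / 2) *
        (√(‖x‖ ^ 2 + θ * R ^ 2))⁻¹ * ‖schwartzConv (U t) (moll n) x‖ ^ (α + 2))
        (Metric.closedBall 0 R) :=
      ((c0.mul c1).mul c2).continuousOn.integrableOn_compact (isCompact_closedBall _ _)
    rw [e, one_mul, ofReal_integral_eq_lintegral_ofReal c3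
      (Eventually.of_forall fun x => by positivity)]
    refine le_of_eq (lintegral_congr fun x => ?_)
    rw [hF, ENNReal.ofReal_mul (by positivity), ← ENNReal.ofReal_rpow_of_nonneg (norm_nonneg _) hα2.le,
      ofReal_norm]
  have hlim : Tendsto (fun n => ENNReal.ofReal ((α + 2) / (3 * α)) * (ENNReal.ofReal X + Λ * d n)) atTop
      (𝓝 (ENNReal.ofReal ((α + 2) / (3 * α)) * (ENNReal.ofReal X + Λ * 0))) :=
    ENNReal.Tendsto.const_mul (tendsto_const_nhds.add
      (ENNReal.Tendsto.const_mul hdlim (Or.inr hΛ))) (Or.inr ENNReal.ofReal_ne_top)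
  refine (lintegral_lintegral_le_liminf hFm ?_).trans
    ((liminf_le_liminf (Eventually.of_forall hFle)).trans (le_of_eq ?_))
  · filter_upwards [hgood] with t ht
    refine ae_restrict_of_ae ?_
    filter_upwards [ae_tendsto_schwartzConv_moll ht.2.1, Measure.ae_ne volume (0 : E4)] with x hx hx0
    exact (tendsto_ofReal_mul_enorm_rpow _ ((tendsto_regWeight hx0).mul_const _) hx
      hα2).liminf_eq.ge
  · rw [hlim.liminf_eq, mul_zero, add_zero, ← ENNReal.ofReal_mul (by positivity), hX]
    congr 1
    ring

/-- The Morawetz inequality between two good times. -/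
theorem exists_good_morawetz (hα : 0 < α) (hs : s = 2 - (2 - b) / α) (hs1 : 1 < s)
    (hs2 : s < 2) (hb : 0 < b) (hbs : b < 3 - s) : ∃ C : ℝ, 0 < C ∧
      ∀ {R M t₀ t₁ : ℝ} {U : ℝ → E4 → ℂ}, 0 < R → 0 ≤ M → t₁ - t₀ ≤ R ^ 2 →
      GoodSolution α b s M t₀ t₁ U →
      ∫⁻ t in Ioc t₀ t₁, ∫⁻ x in Metric.closedBall (0 : E4) R,
        ‖U t x‖ₑ ^ (α + 2) / ‖x‖ₑ ^ (1 + b) ≤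
        ENNReal.ofReal (C * R ^ (2 * s - 1) * (M ^ 2 + M ^ (α + 2))) := by
  obtain ⟨C, hC, H⟩ := exists_regularized_morawetz hα hs hs1 hs2 hb hbs
  refine ⟨C, hC, fun {R M t₀ t₁ U} hR hM hlen h => ?_⟩
  have hθ : ∀ k : ℕ, 1 / ((k : ℝ) + 1) ≤ 1 := fun k => by
    rw [div_le_one (by positivity)]
    linarith [(Nat.cast_nonneg k : (0 : ℝ) ≤ k)]
  have hlim : Tendsto (fun k : ℕ => 1 / ((k : ℝ) + 1)) atTop (𝓝 0) :=
    tendsto_one_div_add_atTop_nhds_zero_nat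
  refine (lintegral_lintegral_le_liminf (F := fun (k : ℕ) t x =>
    ENNReal.ofReal (‖x‖ ^ (-b) * (√(‖x‖ ^ 2 + 1 / ((k : ℝ) + 1) * R ^ 2))⁻¹) * ‖U t x‖ₑ ^ (α + 2))
    (fun k => ?_) (Eventually.of_forall fun t => ?_)).trans
    ((liminf_le_liminf (Eventually.of_forall fun k => H hR (by positivity) (hθ k) hM hlen h)).trans
      (le_of_eq (by simp)))
  · have h2 : Measurable fun q : ℝ × E4 => ENNReal.ofReal
      (‖q.2‖ ^ (-b) * (√(‖q.2‖ ^ 2 + 1 / ((k : ℝ) + 1) * R ^ 2))⁻¹) := by fun_prop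
    exact h2.mul (h.meas.enorm.pow_const _)
  · refine ae_restrict_of_ae ?_
    filter_upwards [Measure.ae_ne volume (0 : E4)] with x hx0
    have hx : 0 < ‖x‖ := norm_pos_iff.2 hx0
    have e : ‖U t x‖ₑ ^ (α + 2) / ‖x‖ₑ ^ (1 + b) =
        ENNReal.ofReal (‖x‖ ^ (-b) * (√(‖x‖ ^ 2 + 0 * R ^ 2))⁻¹) * ‖U t x‖ₑ ^ (α + 2) := by
      rw [zero_mul, add_zero, Real.sqrt_sq hx.le, ← Real.rpow_neg_one, ← Real.rpow_add hx,
        ← ENNReal.ofReal_rpow_of_pos hx, ofReal_norm, mul_comm, div_eq_mul_inv, ← ENNReal.rpow_neg]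
      congr 2
      ring
    rw [e]
    refine (tendsto_ofReal_mul_enorm_rpow _ (Tendsto.const_mul _ (Tendsto.inv₀
      ((tendsto_const_nhds.add (hlim.mul_const _)).sqrt) ?_)) tendsto_const_nhds
      (by linarith)).liminf_eq.ge
    simpa using hx.ne'

end

/-! ### Solutions at almost every time -/

/-- The homogeneous norm is definite: the Fourier transform is required to be a function, which
excludes polynomials. This settles intervals of infinite length, where `∞ · 0 = 0`. -/
theorem ae_eq_zero_of_homSobolevNorm_eq_zero {s : ℝ} (hs : 0 < s) (hs2 : s < 2) {f : E4 → ℂ}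
    (h : homSobolevNorm s f = 0) : f =ᵐ[volume] 0 := by
  obtain ⟨C, hC, H⟩ := exists_lintegral_wtMeasure_le hs hs2
  have hl := locallyIntegrable_of_homSobolevNorm_lt_top (h.trans_lt ENNReal.zero_lt_top)
  have h0 := H f hl
  have hm : AEMeasurable (fun x => ‖f x‖ₑ * ENNReal.ofReal (wt x)) volume :=
    hl.aestronglyMeasurable.enorm.mul measurable_ofReal_wt.aemeasurable
  rw [h, mul_zero, lintegral_wtMeasure, nonpos_iff_eq_zero, lintegral_eq_zero_iff' hm] at h0
  filter_upwards [h0] with x hx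
  have hw : ENNReal.ofReal (wt x) ≠ 0 := by simpa using wt_pos x
  simpa [hw] using hx

section
variable {α b s : ℝ} {I : Set ℝ} {u U : ℝ → E4 → ℂ}

/-- Restricted to the time between two good instants, a jointly measurable representative of a solution
is a good solution. The exponent `2(α+1)` in time is more than is needed, as only `α+1` is used. -/
theorem IsSolution.goodSolution (hu : IsSolution α b s I u) (hI : I.OrdConnected) (hα : 0 < α)
    (hs : s = 2 - (2 - b) / α) (hs1 : 1 < s) (hb : 0 < b) (hbs : b < 3 - s) {M t₀ t₁ : ℝ}
    (hU : Measurable (Function.uncurry U))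
    (hgood : ∀ᵐ t ∂(volume.restrict I), u t =ᵐ[volume] U t ∧
      homSobolevNorm s (u t) ≤ ENNReal.ofReal M)
    (h0 : t₀ ∈ I ∧ u t₀ =ᵐ[volume] U t₀ ∧ homSobolevNorm s (u t₀) ≤ ENNReal.ofReal M)
    (h1 : t₁ ∈ I ∧ u t₁ =ᵐ[volume] U t₁ ∧ homSobolevNorm s (u t₁) ≤ ENNReal.ofReal M)
    (h01 : t₀ ≤ t₁) : GoodSolution α b s M t₀ t₁ U := by
  have hIcc : Icc t₀ t₁ ⊆ I := hI.out h0.1 h1.1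
  have hIoc : Ioc t₀ t₁ ⊆ I := Ioc_subset_Icc_self.trans hIcc
  have hae := ae_restrict_of_ae_restrict_of_subset hIoc hgood
  have hslice : ∀ t, Measurable (U t) := fun t => hU.comp measurable_prodMk_left
  have duh : ∀ t ∈ Icc t₀ t₁, u t =ᵐ[volume] U t → ∀ φ : 𝓢(E4, ℂ), ∫ x, U t x * φ x =
      (∫ x, U t₀ x * freeEvolution (t - t₀) φ x) - Complex.I * ∫ τ in t₀..t, ∫ x,
      nonlinearity α b (U τ) x * freeEvolution (t - τ) φ x := by
    intro t ht htU φ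
    have hD := hu.duhamel t (hIcc ht) t₀ h0.1 φ
    have e : ∀ {f g : E4 → ℂ}, f =ᵐ[volume] g → ∀ k : E4 → ℂ, ∫ x, f x * k x = ∫ x, g x * k x :=
      fun hfg k => integral_congr_ae (by filter_upwards [hfg] with x hx; rw [hx])
    rw [e htU, e h0.2.1] at hD
    rw [hD]
    congr 2
    rw [intervalIntegral.integral_of_le ht.1, intervalIntegral.integral_of_le ht.1]
    refine integral_congr_ae ?_
    filter_upwards [ae_restrict_of_ae_restrict_of_subset (Ioc_subset_Ioc_right ht.2) hae] with τ hτ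
    exact e (nonlinearity_congr hτ.1) _
  refine ⟨h01, hU, ?_, ?_, ?_, ?_, duh t₁ (right_mem_Icc.2 h01) h1.2.1, ?_⟩
  · rw [← homSobolevNorm_congr h0.2.1]; exact h0.2.2
  · rw [← homSobolevNorm_congr h1.2.1]; exact h1.2.2
  · filter_upwards [hae] with t ht
    rw [← homSobolevNorm_congr ht.1]; exact ht.2
  · obtain ⟨C, hC, H⟩ := exists_lintegral_powExp_le hα hs hs1 hbs integral_wt_add_one_pos
    set m := 4 * α * (α + 1) / (α + 2 - b * (α + 1)) with hm
    set p := powExp α b s with hp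
    have hp0 : 0 < p := by linarith [one_lt_powExp hα hs1 hb hbs]
    have hκ : 0 < (α + 1) / p := by positivity
    have hbound : ∀ᵐ t ∂(volume.restrict (Ioc t₀ t₁)),
        (∫⁻ x, ‖U t x‖ₑ ^ p ∂wtMeasure) ^ ((α + 1) / p) ≤
        ENNReal.ofReal C ^ ((α + 1) / p) * (1 + lorentzNorm m 2 (u t) ^ (2 * (α + 1))) := by
      filter_upwards [hae] with t ht
      rw [lorentzNorm_congr ht.1]
      refine (ENNReal.rpow_le_rpow (H wtMeasure wtMeasure_le wtMeasure_univ_le (U t)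
        (hslice t).aestronglyMeasurable) hκ.le).trans ?_
      rw [ENNReal.mul_rpow_of_nonneg _ _ hκ.le, ← ENNReal.rpow_mul, mul_div_cancel₀ _ hp0.ne']
      refine mul_le_mul' le_rfl ?_
      rcases le_total (lorentzNorm m 2 (U t)) 1 with h | h
      · exact (ENNReal.rpow_le_one h (by linarith)).trans le_self_add
      · exact (ENNReal.rpow_le_rpow_of_exponent_le h (by linarith)).trans le_add_self
    refine (lintegral_mono_ae hbound).trans_lt ?_
    rw [lintegral_const_mul' _ _ (by finiteness), lintegral_add_left measurable_const]
    refine ENNReal.mul_lt_top (by finiteness) (ENNReal.add_lt_top.2 ⟨by simp, ?_⟩)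
    have h2 := hu.scattering_norm (Icc t₀ t₁) hIcc isCompact_Icc
    rw [mixedLorentzNorm, ENNReal.rpow_lt_top_iff_of_pos (by positivity)] at h2
    exact (lintegral_mono_set Ioc_subset_Icc_self).trans_lt h2
  · filter_upwards [hae, ae_restrict_mem measurableSet_Ioc] with t ht htm
    exact duh t (Ioc_subset_Icc_self htm) ht.1

/-- An interval of positive finite length is, up to null sets, an open interval with the same
endpoints. -/
theorem exists_Ioo_subset {I : Set ℝ} (hI : I.OrdConnected) (h0 : volume I ≠ 0)
    (htop : volume I ≠ ∞) : ∃ a c : ℝ, a < c ∧ Ioo a c ⊆ I ∧ I ⊆ Icc a c := by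
  have hne : I.Nonempty := by
    by_contra h
    exact h0 (by rw [not_nonempty_iff_eq_empty.1 h, measure_empty])
  obtain ⟨x, hx⟩ := hne
  have hbelow : BddBelow I := by
    by_contra h
    refine htop (top_unique ?_)
    rw [← Real.volume_Iic (a := x)]
    refine measure_mono fun y hy => ?_
    rw [not_bddBelow_iff] at h
    obtain ⟨z, hz, hzy⟩ := h y
    exact hI.out hz hx ⟨hzy.le, hy⟩
  have habove : BddAbove I := by
    by_contra h
    refine htop (top_unique ?_)
    rw [← Real.volume_Ici (a := x)]
    refine measure_mono fun y hy => ?_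
    rw [not_bddAbove_iff] at h
    obtain ⟨z, hz, hzy⟩ := h y
    exact hI.out hx hz ⟨hy, hzy.le⟩
  refine ⟨sInf I, sSup I, ?_, IsConnected.Ioo_csInf_csSup_subset ⟨⟨x, hx⟩, hI.isPreconnected⟩
    hbelow habove, subset_Icc_csInf_csSup hbelow habove⟩
  by_contra h
  refine h0 (measure_mono_null (subset_Icc_csInf_csSup hbelow habove) ?_)
  rw [Real.volume_Icc, ENNReal.ofReal_eq_zero]
  linarith

/-- The Morawetz inequality on a bounded interval, with real constants. -/
theorem exists_interval_morawetz (hα : 0 < α) (hs : s = 2 - (2 - b) / α) (hs1 : 1 < s)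
    (hs2 : s < 2) (hb : 0 < b) (hbs : b < 3 - s) : ∃ C : ℝ, 0 < C ∧
      ∀ {I : Set ℝ} {u : ℝ → E4 → ℂ} {a c R M : ℝ}, I.OrdConnected → IsSolution α b s I u → a < c →
      Ioo a c ⊆ I → I ⊆ Icc a c → 0 < R → c - a ≤ R ^ 2 → 0 ≤ M →
      supHomSobolevNorm s I u ≤ ENNReal.ofReal M →
      ∫⁻ t in I, ∫⁻ x in Metric.closedBall (0 : E4) R, ‖u t x‖ₑ ^ (α + 2) / ‖x‖ₑ ^ (1 + b) ≤
        ENNReal.ofReal (C * R ^ (2 * s - 1) * (M ^ 2 + M ^ (α + 2))) := by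
  obtain ⟨C, hC, H⟩ := exists_good_morawetz hα hs hs1 hs2 hb hbs
  refine ⟨C, hC, fun {I u a c R M} hI hu hac hsub hsup hR hlen hM hM' => ?_⟩
  -- a jointly measurable representative of the solution
  have hmk := hu.measurable.ae_eq_mk
  set W := hu.measurable.mk (Function.uncurry u) with hW
  set U : ℝ → E4 → ℂ := fun t x => W (t, x) with hU
  have hUm : Measurable (Function.uncurry U) := hu.measurable.stronglyMeasurable_mk.measurable
  have hgood : ∀ᵐ t ∂(volume.restrict I), u t =ᵐ[volume] U t ∧
      homSobolevNorm s (u t) ≤ ENNReal.ofReal M := by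
    filter_upwards [Measure.ae_ae_of_ae_prod hmk, ae_le_essSup (μ := volume.restrict I)
      (f := fun t => homSobolevNorm s (u t))] with t h1 h2
    exact ⟨h1, h2.trans hM'⟩
  have hIeq : I =ᵐ[volume] Ioo a c :=
    ((LE.le.eventuallyLE hsup).trans_eq Ioo_ae_eq_Icc.symm).antisymm (LE.le.eventuallyLE hsub)
  have hL : ∫⁻ t in I, ∫⁻ x in Metric.closedBall (0 : E4) R,
      ‖u t x‖ₑ ^ (α + 2) / ‖x‖ₑ ^ (1 + b) = ∫⁻ t in Ioo a c, ∫⁻ x in Metric.closedBall (0 : E4) R,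
      ‖U t x‖ₑ ^ (α + 2) / ‖x‖ₑ ^ (1 + b) := by
    rw [← setLIntegral_congr hIeq]
    refine lintegral_congr_ae ?_
    filter_upwards [hgood] with t ht
    refine lintegral_congr_ae (ae_restrict_of_ae ?_)
    filter_upwards [ht.1] with x hx
    rw [hx]
  -- good endpoints that exhaust the interval
  have hdense : Dense {t : ℝ | t ∈ I → u t =ᵐ[volume] U t ∧
      homSobolevNorm s (u t) ≤ ENNReal.ofReal M} :=
    Measure.dense_of_ae (μ := volume) ((ae_restrict_iff' hI.measurableSet).1 hgood)
  set m := (a + c) / 2 with hm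
  have ham : a < m := by rw [hm]; linarith
  have hmc : m < c := by rw [hm]; linarith
  have hcl : ∀ {x y z : ℝ}, x < y → z ∈ Icc x y → ∃ q : ℕ → ℝ, (∀ n, q n ∈ Ioo x y ∧
      (q n ∈ I → u (q n) =ᵐ[volume] U (q n) ∧ homSobolevNorm s (u (q n)) ≤ ENNReal.ofReal M)) ∧
      Tendsto q atTop (𝓝 z) := by
    intro x y z hxy hz
    have h1 : Icc x y ⊆ closure (Ioo x y ∩ {t : ℝ | t ∈ I → u t =ᵐ[volume] U t ∧
      homSobolevNorm s (u t) ≤ ENNReal.ofReal M}) := by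
      rw [← closure_Ioo hxy.ne]
      exact closure_minimal (hdense.open_subset_closure_inter isOpen_Ioo) isClosed_closure
    exact mem_closure_iff_seq_limit.1 (h1 hz)
  obtain ⟨p, hp, hplim⟩ := hcl ham (left_mem_Icc.2 ham.le)
  obtain ⟨q, hq, hqlim⟩ := hcl hmc (right_mem_Icc.2 hmc.le)
  have hcover := aecover_Ioo_of_Ioc (μ := (volume : Measure ℝ)) hplim hqlim
  have hmeas : Measurable fun t => ∫⁻ x in Metric.closedBall (0 : E4) R,
      ‖U t x‖ₑ ^ (α + 2) / ‖x‖ₑ ^ (1 + b) :=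
    Measurable.lintegral_prod_right' (f := fun r : ℝ × E4 => ‖U r.1 r.2‖ₑ ^ (α + 2) / ‖r.2‖ₑ ^ (1 + b))
      ((hUm.enorm.pow_const _).div (by fun_prop))
  rw [hL]
  refine le_of_tendsto (hcover.lintegral_tendsto_of_nat hmeas.aemeasurable)
    (Eventually.of_forall fun n => ?_)
  have hpn := (hp n).1
  have hqn := (hq n).1
  have hpI : p n ∈ I := hsub ⟨hpn.1, hpn.2.trans hmc⟩
  have hqI : q n ∈ I := hsub ⟨ham.trans hqn.1, hqn.2⟩
  refine (lintegral_mono' (Measure.restrict_mono le_rfl Measure.restrict_le_self) le_rfl).trans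
    (H hR hM ?_ (hu.goodSolution hI hα hs hs1 hb hbs hUm hgood ⟨hpI, (hp n).2 hpI⟩
      ⟨hqI, (hq n).2 hqI⟩ (hpn.2.trans hqn.1).le))
  linarith [hpn.1, hqn.2]

end

end INLS

end

open INLS in
theorem mainTheorem6 (α b s : ℝ) (hα : 0 < α) (hs : s = 2 - (2 - b) / α)
    (hs1 : 1 < s) (hs2 : s < 3 / 2) (hb : 0 < b) (hbs : b < 3 - s) :
    ∃ C : ℝ≥0, ∀ (I : Set ℝ) (u : ℝ → INLS.E4 → ℂ) (A : ℝ),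
      I.OrdConnected → INLS.IsSolution α b s I u → 1 ≤ A →
      ∫⁻ t in I, ∫⁻ x in {x : INLS.E4 | ‖x‖ₑ ≤ ENNReal.ofReal A * volume I ^ (1 / 2 : ℝ)},
          ‖u t x‖ₑ ^ (α + 2) / ‖x‖ₑ ^ (1 + b) ≤
        C * (ENNReal.ofReal A * volume I ^ (1 / 2 : ℝ)) ^ (2 * s - 1) *
          (INLS.supHomSobolevNorm s I u ^ 2 + INLS.supHomSobolevNorm s I u ^ (α + 2)) := by
  obtain ⟨C, hC, H⟩ := exists_interval_morawetz hα hs hs1 (by linarith) hb hbs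
  refine ⟨C.toNNReal, fun I u A hI hu hA => ?_⟩
  have hα2 : 0 < α + 2 := by linarith
  have hs3 : 0 < 2 * s - 1 := by linarith
  have hCe : ((C.toNNReal : ℝ≥0) : ℝ≥0∞) = ENNReal.ofReal C := rfl
  have hC0 : ENNReal.ofReal C ≠ 0 := by simpa using hC
  have hA0 : ENNReal.ofReal A ≠ 0 := by simp; linarith
  rw [hCe]
  by_cases hvol : volume I = 0
  · rw [setLIntegral_measure_zero _ _ hvol]
    exact zero_le
  by_cases hsup : supHomSobolevNorm s I u = 0
  · refine le_of_eq_of_le ?_ zero_le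
    refine (lintegral_congr_ae ?_).trans lintegral_zero
    filter_upwards [ae_le_essSup (μ := volume.restrict I) (f := fun t => homSobolevNorm s (u t))]
      with t ht
    have h0 : homSobolevNorm s (u t) = 0 := le_antisymm (ht.trans hsup.le) zero_le
    refine (lintegral_congr_ae (ae_restrict_of_ae ?_)).trans lintegral_zero
    filter_upwards [ae_eq_zero_of_homSobolevNorm_eq_zero (by linarith) (by linarith) h0] with x hx
    simp [hx, hα2]
  have hroot : volume I ^ (1 / 2 : ℝ) ≠ 0 := by simp [hvol]
  have hrad : (ENNReal.ofReal A * volume I ^ (1 / 2 : ℝ)) ^ (2 * s - 1) ≠ 0 := by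
    rw [Ne, ENNReal.rpow_eq_zero_iff_of_pos hs3]
    exact mul_ne_zero hA0 hroot
  have hnorm : supHomSobolevNorm s I u ^ 2 + supHomSobolevNorm s I u ^ (α + 2) ≠ 0 := by
    simp [hsup]
  by_cases hvol' : volume I = ∞
  · refine le_of_le_of_eq le_top (Eq.symm ?_)
    rw [hvol', ENNReal.top_rpow_of_pos (by norm_num), ENNReal.mul_top hA0,
      ENNReal.top_rpow_of_pos hs3, ENNReal.mul_top hC0, ENNReal.top_mul hnorm]
  by_cases hsup' : supHomSobolevNorm s I u = ∞
  · refine le_of_le_of_eq le_top (Eq.symm ?_)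
    rw [hsup']
    simp only [ENNReal.top_rpow_of_pos hα2, add_top]
    exact ENNReal.mul_top (mul_ne_zero hC0 hrad)
  obtain ⟨a, c, hac, hsub, hsub'⟩ := exists_Ioo_subset hI hvol hvol'
  have hvolI : volume I = ENNReal.ofReal (c - a) := by
    refine le_antisymm ?_ ?_
    · rw [← Real.volume_Icc]; exact measure_mono hsub'
    · rw [← Real.volume_Ioo]; exact measure_mono hsub
  have hca : 0 < c - a := by linarith
  set R := A * (c - a) ^ (1 / 2 : ℝ) with hR
  have hR0 : 0 < R := by positivity
  have hRe : ENNReal.ofReal A * volume I ^ (1 / 2 : ℝ) = ENNReal.ofReal R := by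
    rw [hvolI, hR, ENNReal.ofReal_mul (by linarith), ENNReal.ofReal_rpow_of_pos hca]
  have hlen : c - a ≤ R ^ 2 := by
    have : ((c - a) ^ (1 / 2 : ℝ)) ^ 2 = c - a := by
      rw [← Real.sqrt_eq_rpow, Real.sq_sqrt hca.le]
    rw [hR, mul_pow, this]
    exact le_mul_of_one_le_left hca.le (one_le_pow₀ hA)
  have hball : {x : E4 | ‖x‖ₑ ≤ ENNReal.ofReal R} = Metric.closedBall 0 R := by
    ext x
    rw [mem_ofPred_eq, mem_closedBall_zero_iff, ← ofReal_norm, ENNReal.ofReal_le_ofReal_iff hR0.le]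
  set M := (supHomSobolevNorm s I u).toReal with hM
  have hM0 : 0 ≤ M := ENNReal.toReal_nonneg
  have hMe : supHomSobolevNorm s I u = ENNReal.ofReal M := (ENNReal.ofReal_toReal hsup').symm
  rw [hRe, hball]
  refine (H hI hu hac hsub hsub' hR0 hlen hM0 hMe.le).trans (le_of_eq ?_)
  rw [hMe, ENNReal.ofReal_mul (by positivity), ENNReal.ofReal_mul hC.le,
    ENNReal.ofReal_add (by positivity) (by positivity), ENNReal.ofReal_rpow_of_pos hR0,
    ENNReal.ofReal_rpow_of_nonneg hM0 hα2.le, ENNReal.ofReal_pow hM0]
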